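/- Fix $s>1/2$ and $E_{\max},h_0,\varepsilon_0>0$, and write $\langle x\rangle=(1+|x|^2)^{1/2}$, $D_x=-i\partial_x$. For each $h\in(0,h_0]$ let $E(h)\in[-E_{\max},E_{\max}]$, and let $\alpha,\beta,V_1,b_1,b_0:\mathbb R\to\mathbb R$ and $V_0$ (all possibly depending on $h$) be such that $\alpha,\beta,V_1,b_1$ have bounded variation on $\mathbb R$ (each is a difference of bounded nondecreasing functions), $\inf\alpha>0$, $\inf\beta>0$, $b_0\in L^1(\mathbb R)\cap L^2(\mathbb R)$, and $V_0$ is a finite signed Borel measure on $\mathbb R$. Put $b=b_0+b_1$, $V=V_0+V_1\,dx$, and let $$P(h)=\beta\big(-h^2\partial_x(\alpha\partial_x)+hbD_x+hD_xb\big)+V$$ be the operator on $L^2(\mathbb R)$ (as a set equal to $L^2(\mathbb R;\beta^{-1}dx)$, with equivalent norm) with domain $$\mathcal D=\{u\in H^1(\mathbb R): h\alpha u'+ibu\in L^\infty(\mathbb R)\text{ has locally bounded variation, and }\beta\,d(-h^2\alpha u'-ihbu)+h\beta bD_xu+u_cV\in L^2(\mathbb R)\},$$ $$P(h)u=\beta\,d(-h^2\alpha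 u'-ihbu)+h\beta bD_xu+u_cV,\qquad u\in\mathcal D,$$ where $u_c$ is the continuous representative of $u$ and $df$ denotes the measure that is the distributional derivative of $f$. For a finite signed Borel measure $\mu$ let $\|\mu\|=|\mu|(\mathbb R)$ be its total variation. Assume: 1. $\|V_1\|_{L^\infty}$, $\|dV_1\|$, $\|b_1\|_{L^\infty}$, $\|db_1\|$, $\|d\alpha\|$, $\|d\beta\|$, $\sup\alpha$ and $\sup\beta$ are bounded uniformly for $h\in(0,h_0]$; 2. there is $c>0$ independent of $h$ with $\inf\alpha,\inf\beta>c$ for all $h\in(0,h_0]$; 3. there is $R_1>0$ independent of $h$ with $\displaystyle\inf_{h\in(0,h_0],\,|x|\ge R_1}\big(\beta^{-1}(x,h)\alpha(x,h)(E(h)-V_1(x,h))+b_1^2(x,h)\big)>0$; 4. there is $R_0>0$ independent of $h$ such that $V_0$ and $b_0$ are supported in $[-R_0,R_0]$ for all $h\in(0,h_0]$. Let $R=\max(R_0,R_1)$ and let $\mathbf 1_{>R}$ be the indicator function of $\{x:|x|>R\}$. Then there is $C_0>0$, independent of $h$ and $\varepsilon$, such that for all $h\in(0,h_0]$ and all $\varepsilon\in[-\varepsilon_0,\varepsilon_0]$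 with $\varepsilon\ne0$, the operator $P(h)-E(h)-i\varepsilon:\mathcal D\to L^2(\mathbb R)$ has a bounded inverse on $L^2(\mathbb R)$ and $$\big\|\langle x\rangle^{-s}\mathbf 1_{>R}\,(P(h)-E(h)-i\varepsilon)^{-1}\,\mathbf 1_{>R}\langle x\rangle^{-s}\big\|_{L^2(\mathbb R)\to L^2(\mathbb R)}\le\frac{C_0}{h}.$$ -/

import Mathlib

open MeasureTheory Set
open scoped ENNReal ContDiff

noncomputable section

namespace MagneticSchrodinger

/-- The complex Hilbert space `L²(ℝ) = L²(ℝ, dx)`.  Since `β` is bounded above and below by positive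
constants, it is the same space of functions as `L²(ℝ, β⁻¹ dx)`, with an equivalent norm. -/
abbrev L2 : Type := Lp ℂ 2 (volume : Measure ℝ)

/-- The coefficients, at one fixed value of `h`, of
`P(h) = β (-h² ∂ₓ (α ∂ₓ) + h b Dₓ + h Dₓ b) + V`, `Dₓ = -i ∂ₓ`, with `b = b₀ + b₁`, `V = V₀ + V₁`:
`α`, `β`, `V₁`, `b₁` are real functions of bounded variation on the line, `α`, `β` are bounded below
by positive constants, `b₀ ∈ L¹ ∩ L²`, and `V₀` is a finite signed Borel measure. -/
structure Coefficients where
  α : ℝ → ℝ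
  β : ℝ → ℝ
  V₁ : ℝ → ℝ
  b₀ : ℝ → ℝ
  b₁ : ℝ → ℝ
  V₀ : SignedMeasure ℝ
  α_bv : BoundedVariationOn α univ
  β_bv : BoundedVariationOn β univ
  V₁_bv : BoundedVariationOn V₁ univ
  b₁_bv : BoundedVariationOn b₁ univ
  α_inf_pos : ∃ m : ℝ, 0 < m ∧ ∀ x, m ≤ α x
  β_inf_pos : ∃ m : ℝ, 0 < m ∧ ∀ x, m ≤ β x
  b₀_memLp_one : MemLp b₀ 1 volume
  b₀_memLp_two : MemLp b₀ 2 volume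

/-- The full magnetic potential `b = b₀ + b₁`. -/
def Coefficients.b (c : Coefficients) (x : ℝ) : ℝ := c.b₀ x + c.b₁ x

/-- The total variation norm `‖df‖ = |df|(ℝ)` of the distributional derivative `df` of a function
`f` of bounded variation. -/
def derivNorm {f : ℝ → ℝ} (hf : BoundedVariationOn f univ) : ℝ≥0∞ :=
  hf.vectorMeasure.variation univ

/-- Freezing a function of locally bounded variation outside `[p, q]` gives a function of bounded
variation. -/
theorem boundedVariationOn_freeze {f : ℝ → ℂ} (hf : LocallyBoundedVariationOn f univ) (p q : ℝ) :
    BoundedVariationOn (fun x => f (max p (min q x))) univ := by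
  have h1 : BoundedVariationOn f (univ ∩ Icc p (max p q)) := hf p (max p q) trivial trivial
  have hmono : MonotoneOn (fun x : ℝ => max p (min q x)) univ := fun x _ y _ hxy =>
    max_le_max le_rfl (min_le_min le_rfl hxy)
  have hmaps : MapsTo (fun x : ℝ => max p (min q x)) univ (univ ∩ Icc p (max p q)) := fun x _ =>
    ⟨trivial, le_max_left _ _, max_le_max le_rfl (min_le_left _ _)⟩
  exact ne_top_of_le_ne_top h1
    (eVariationOn.comp_le_of_monotoneOn f (fun x : ℝ => max p (min q x)) hmono hmaps)

/-- The restriction to the bounded open interval `(p, q)` of the distributional derivative `df` of a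
function `f` of locally bounded variation: the complex measure on `(p, q)` with
`df (x, y] = f(y+) - f(x+)` for `p < x ≤ y < q`. -/
def localDeriv {f : ℝ → ℂ} (hf : LocallyBoundedVariationOn f univ) (p q : ℝ) :
    VectorMeasure ℝ ℂ :=
  (boundedVariationOn_freeze hf p q).vectorMeasure.restrict (Ioo p q)

/-- `u'` is the weak (distributional) derivative of `u` on the line. -/
def HasWeakDeriv (u u' : ℝ → ℂ) : Prop :=
  ∀ φ : ℝ → ℝ, ContDiff ℝ ∞ φ → HasCompactSupport φ →
    ∫ x, ((deriv φ x : ℝ) : ℂ) * u x = -∫ x, ((φ x : ℝ) : ℂ) * u' x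

/-- The graph of `P(h)`: `c.IsImage h u g` says that `u ∈ 𝒟` and `P(h) u = g`.  That is,
* `u ∈ H¹(ℝ)`, with weak derivative `u'` and continuous representative `uc`;
* `-h² α u' - i h b u = -h (h α u' + i b u)` has a representative `f` that is (essentially) bounded
  and has locally bounded variation;
* `β df + h β b Dₓ u + uc V = g dx` as measures on bounded Borel sets `A`, where `g ∈ L²(ℝ)`. -/
def Coefficients.IsImage (c : Coefficients) (h : ℝ) (u g : L2) : Prop :=
  ∃ (u' uc f : ℝ → ℂ) (hf : LocallyBoundedVariationOn f univ),
    MemLp u' 2 volume ∧ HasWeakDeriv u u' ∧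
    Continuous uc ∧ uc =ᵐ[volume] u ∧
    (∃ K : ℝ, ∀ᵐ x, ‖f x‖ ≤ K) ∧
    (∀ᵐ x, f x = -(h : ℂ) ^ 2 * c.α x * u' x - Complex.I * h * c.b x * u x) ∧
    ∀ p q : ℝ, ∀ A : Set ℝ, A ⊆ Ioo p q → MeasurableSet A →
      (∫ᵛ x in A, c.β x ∂•(localDeriv hf p q))
        + (∫ x in A, (h : ℂ) * c.β x * c.b x * (-Complex.I * u' x))
        + (∫ᵛ x in A, uc x ∂<•c.V₀)
        + (∫ x in A, (c.V₁ x : ℂ) * uc x)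
        = ∫ x in A, g x

/-- `T = (P(h) - z)⁻¹`: the bounded operator `T` on `L²(ℝ)` is the two-sided inverse of
`P(h) - z : 𝒟 → L²(ℝ)`.  So `T v = u` holds exactly when `u ∈ 𝒟` and `P(h) u - z u = v`. -/
def Coefficients.IsResolvent (c : Coefficients) (h : ℝ) (z : ℂ) (T : L2 →L[ℂ] L2) : Prop :=
  ∀ v u : L2, T v = u ↔ c.IsImage h u (v + z • u)

/-- The function `⟨x⟩^{-s} 1_{|x| > R}`, with `⟨x⟩ = (1 + |x|²)^{1/2}`. -/
def exteriorWeight (s R : ℝ) (x : ℝ) : ℂ :=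
  {y : ℝ | R < |y|}.indicator (fun y => (((Real.sqrt (1 + |y| ^ 2)) ^ (-s) : ℝ) : ℂ)) x

theorem exteriorWeight_memLp {s : ℝ} (hs : 1 / 2 < s) (R : ℝ) :
    MemLp (exteriorWeight s R) ∞ (volume : Measure ℝ) := by
  refine memLp_top_of_bound ?_ 1 (Filter.Eventually.of_forall fun x => ?_)
  · refine Measurable.aestronglyMeasurable ?_
    refine Measurable.indicator (by fun_prop) ?_
    exact measurableSet_lt measurable_const (by fun_prop)
  · refine (norm_indicator_le_norm_self _ x).trans ?_
    have h1 : (1 : ℝ) ≤ Real.sqrt (1 + |x| ^ 2) := by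
      rw [Real.one_le_sqrt]; nlinarith [sq_nonneg |x|]
    rw [Complex.norm_real, Real.norm_of_nonneg (by positivity)]
    exact Real.rpow_le_one_of_one_le_of_nonpos h1 (by linarith)

/-- The bounded operator on `L²(ℝ)` of multiplication by `⟨x⟩^{-s} 1_{|x| > R}`. -/
def exteriorWeightOp {s : ℝ} (hs : 1 / 2 < s) (R : ℝ) : L2 →L[ℂ] L2 :=
  (ContinuousLinearMap.mul ℂ ℂ).holderL volume ∞ 2 2 ((exteriorWeight_memLp hs R).toLp _)

end MagneticSchrodinger

end

/-! ### Integration by parts for functions whose derivative is a measure. -/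

noncomputable section

namespace MagneticSchrodinger

open Filter Topology

section Parts

variable {μ ν : Measure ℝ} {p q : ℝ} {κ ψ φ N : ℝ → ℂ}

/-! The resolvent exists because the quadratic form of `P(h)` in L²(β⁻¹dx) is real and satisfies
Gårding's inequality, so that the form of `P(h) - z` is coercive on H¹ whenever Im z ≠ 0
(`exists_shiftedFormOp_coercive`), and because the domain 𝒟 with its equation between measures is
equivalent to the weak equation on H¹ (`isImage_iff`).

For the estimate, let (P - E - iε)u = v with v supported in |x| > R, and put w = hαu' + ibu. Outside
[-R, R] the singular coefficients are absent, and (u, w) solves a first order system whose effective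
potential q = β⁻¹α(E - V₁) + b₁² is at least τ > 0 and has variation bounded uniformly in h. The
energy F = |w|² + q|u|² satisfies dF = |u|² dq - (2/h) Re((v + iεu) w̄)/β dx, with the magnetic
terms cancelled. Since τ|u|² ≤ F, Gronwall's argument with the integrating factor exp(p/τ), where p
dominates the variation of q, bounds F(a) by the integral of the source between a and infinity
(`HalfLineSystem.energy_le`). Integration goes from infinity inwards, where F is small along a
sequence, so nothing is needed about the solution in [-R, R]. As q may jump, increments of F are
compared instead of derivatives, and the errors vanish under refinement of the partition
(`le_of_forall_le_add_mul_increments`).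

The source contains |ε||u||w|. The energy identity `IsImage.energy`, the imaginary part of the form,
gives |ε|∫|u|²/β ≤ ∫|u||v|/β, which involves u only outside [-R, R], because v vanishes inside. The
identity for h(Re w ū)' bounds ∫|w|² by ∫|u|², the source and boundary terms
(`integral_normSq_w_le`). If s² is the supremum of F for |x| > R and γ = ‖v‖ in L¹, this gives s² ≤
(A/h)sγ + L|ε|s². For |ε| ≤ 1/(2L) the last term is absorbed, whence |u| ≤ (C/h)γ outside [-R, R]
(`exists_exterior_bound`). For s > 1/2 the weight is square integrable, and the Cauchy-Schwarz
inequality turns the bound from L¹ to L^∞ into the weighted one. For larger |ε| the bound of the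
resolvent by a multiple of 1/|ε| suffices, since h ≤ h₀. -/

theorem integrable_prod_triangle [SFinite μ] (hκ : IntegrableOn κ (Ioc p q) μ)
    (hψ : IntegrableOn ψ (Ioc p q) volume) :
    Integrable (fun z : ℝ × ℝ => {w : ℝ × ℝ | w.2 ≤ w.1}.indicator (fun w => ψ w.1 * κ w.2) z)
      ((volume.restrict (Ioc p q)).prod (μ.restrict (Ioc p q))) :=
  (Integrable.mul_prod hψ hκ).indicator (measurableSet_le measurable_snd measurable_fst)

theorem triangle_left {y : ℝ} (hy : y ∈ Ioc p q) :
    ∫ x in Ioc p q, {w : ℝ × ℝ | w.2 ≤ w.1}.indicator (fun w => ψ w.1 * κ w.2) (y, x) ∂μ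
      = ψ y * ∫ x in Ioc p y, κ x ∂μ := by
  have h : ∀ x, {w : ℝ × ℝ | w.2 ≤ w.1}.indicator (fun w => ψ w.1 * κ w.2) (y, x)
      = (Iic y).indicator (fun x => ψ y * κ x) x := fun x => by
    by_cases hx : x ≤ y <;> simp [indicator, hx]
  simp_rw [h]
  rw [setIntegral_indicator measurableSet_Iic, ← integral_const_mul]
  congr 2
  ext x; simp only [mem_inter_iff, mem_Ioc, mem_Iic] at hy ⊢
  constructor
  · rintro ⟨⟨h1, h2⟩, h3⟩; exact ⟨h1, h3⟩
  · rintro ⟨h1, h3⟩; exact ⟨⟨h1, h3.trans hy.2⟩, h3⟩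

theorem triangle_right {x : ℝ} (hx : x ∈ Ioc p q) :
    ∫ y in Ioc p q, {w : ℝ × ℝ | w.2 ≤ w.1}.indicator (fun w => ψ w.1 * κ w.2) (y, x)
      = κ x * ∫ y in Ioc x q, ψ y := by
  have h : ∀ y, {w : ℝ × ℝ | w.2 ≤ w.1}.indicator (fun w => ψ w.1 * κ w.2) (y, x)
      = (Ici x).indicator (fun y => κ x * ψ y) y := fun y => by
    by_cases hx : x ≤ y <;> simp [indicator, hx, mul_comm]
  simp_rw [h]
  -- The slice of the triangle is the closed interval [x, q]. The point x may be dropped because the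
  -- inner measure is Lebesgue measure; μ itself is allowed to have atoms.
  rw [setIntegral_indicator measurableSet_Ici, ← integral_const_mul, ← integral_Icc_eq_integral_Ioc]
  congr 2
  ext y; simp only [mem_inter_iff, mem_Ioc, mem_Icc, mem_Ici] at hx ⊢
  constructor
  · rintro ⟨⟨h1, h2⟩, h3⟩; exact ⟨h3, h2⟩
  · rintro ⟨h1, h3⟩; exact ⟨⟨hx.1.trans_le h1, h3⟩, h1⟩

theorem integrableOn_mul_primitive [SFinite μ] (hκ : IntegrableOn κ (Ioc p q) μ)
    (hψ : IntegrableOn ψ (Ioc p q) volume) :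
    IntegrableOn (fun y => ψ y * ∫ x in Ioc p y, κ x ∂μ) (Ioc p q) volume := by
  refine (integrable_prod_triangle hκ hψ).integral_prod_left.congr ?_
  filter_upwards [ae_restrict_mem measurableSet_Ioc] with y hy
  exact triangle_left hy

/-- Fubini's theorem on a triangle. -/
theorem integral_mul_primitive [SFinite μ] (hκ : IntegrableOn κ (Ioc p q) μ)
    (hψ : IntegrableOn ψ (Ioc p q) volume) :
    ∫ y in Ioc p q, ψ y * (∫ x in Ioc p y, κ x ∂μ)
      = ∫ x in Ioc p q, κ x * (∫ y in Ioc x q, ψ y) ∂μ := by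
  have h := integral_integral_swap (f := fun y x =>
    {w : ℝ × ℝ | w.2 ≤ w.1}.indicator (fun w => ψ w.1 * κ w.2) (y, x))
    (integrable_prod_triangle hκ hψ)
  rw [setIntegral_congr_fun measurableSet_Ioc (fun y hy => triangle_left hy),
    setIntegral_congr_fun measurableSet_Ioc (fun x hx => triangle_right hx)] at h
  exact h

theorem continuousOn_of_increments (hψ : IntegrableOn ψ (Ioc p q) volume)
    (hφ : ∀ x ∈ Icc p q, ∀ y ∈ Icc p q, x ≤ y → φ y - φ x = ∫ t in Ioc x y, ψ t) :
    ContinuousOn φ (Icc p q) := by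
  have h1 : ContinuousOn (fun y => φ p + ∫ t in Ioc p y, ψ t) (Icc p q) :=
    continuousOn_const.add (intervalIntegral.continuousOn_primitive
      (by rwa [integrableOn_Icc_iff_integrableOn_Ioc]))
  refine h1.congr fun y hy => ?_
  change φ y = φ p + ∫ t in Ioc p y, ψ t
  rw [← hφ p ⟨le_rfl, hy.1.trans hy.2⟩ y hy hy.1]; ring

theorem integrableOn_mul_of_continuousOn (hκ : IntegrableOn κ (Ioc p q) μ)
    (hφ : ContinuousOn φ (Icc p q)) : IntegrableOn (fun x => κ x * φ x) (Ioc p q) μ := by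
  obtain ⟨K, hK⟩ := isCompact_Icc.exists_bound_of_continuousOn hφ
  refine Integrable.mul_bdd (c := K) hκ ?_ ?_
  · exact (hφ.mono Ioc_subset_Icc_self).aestronglyMeasurable measurableSet_Ioc
  · filter_upwards [ae_restrict_mem measurableSet_Ioc] with x hx
    exact hK x (Ioc_subset_Icc_self hx)

theorem integral_mul_primitive_eq [SFinite μ] (hpq : p ≤ q) (hκ : IntegrableOn κ (Ioc p q) μ)
    (hψ : IntegrableOn ψ (Ioc p q) volume)
    (hφ : ∀ x ∈ Icc p q, ∀ y ∈ Icc p q, x ≤ y → φ y - φ x = ∫ t in Ioc x y, ψ t) :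
    ∫ y in Ioc p q, ψ y * (∫ x in Ioc p y, κ x ∂μ)
      = φ q * (∫ x in Ioc p q, κ x ∂μ) - ∫ x in Ioc p q, κ x * φ x ∂μ := by
  rw [integral_mul_primitive hκ hψ, ← integral_const_mul, ← integral_sub (hκ.const_mul _)
    (integrableOn_mul_of_continuousOn hκ (continuousOn_of_increments hψ hφ))]
  refine setIntegral_congr_fun measurableSet_Ioc fun x hx => ?_
  rw [← hφ x (Ioc_subset_Icc_self hx) q ⟨hpq, le_rfl⟩ hx.2]
  ring

variable [SFinite ν] {κ₁ κ₂ : ℝ → ℂ}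

/-- Integration by parts for a function `N` with `dN = κ₁ dx + κ₂ dν` and an absolutely
continuous function `φ` with `φ' = ψ`. -/
theorem integral_parts (hpq : p ≤ q) (h₁ : IntegrableOn κ₁ (Ioc p q) volume)
    (h₂ : IntegrableOn κ₂ (Ioc p q) ν) (hψ : IntegrableOn ψ (Ioc p q) volume)
    (hφ : ∀ x ∈ Icc p q, ∀ y ∈ Icc p q, x ≤ y → φ y - φ x = ∫ t in Ioc x y, ψ t)
    (hN : ∀ x ∈ Icc p q, ∀ y ∈ Icc p q, x ≤ y →
      N y - N x = (∫ t in Ioc x y, κ₁ t) + ∫ t in Ioc x y, κ₂ t ∂ν) :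
    IntegrableOn (fun y => ψ y * N y) (Ioc p q) volume ∧
    (∫ y in Ioc p q, ψ y * N y) + (∫ x in Ioc p q, κ₁ x * φ x) + (∫ x in Ioc p q, κ₂ x * φ x ∂ν)
      = N q * φ q - N p * φ p := by
  have hp : p ∈ Icc p q := ⟨le_rfl, hpq⟩
  have hq : q ∈ Icc p q := ⟨hpq, le_rfl⟩
  -- Replacing N by N(p) plus two primitives reduces everything to Fubini's theorem on a triangle,
  -- so that N may jump.
  have e : EqOn (fun y => ψ y * N p + ψ y * (∫ x in Ioc p y, κ₁ x)
      + ψ y * (∫ x in Ioc p y, κ₂ x ∂ν)) (fun y => ψ y * N y) (Ioc p q) := fun y hy => by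
    have := hN p hp y (Ioc_subset_Icc_self hy) hy.1.le
    beta_reduce
    rw [eq_add_of_sub_eq this]; ring
  have i1 := hψ.mul_const (N p)
  have i2 : Integrable _ _ := integrableOn_mul_primitive h₁ hψ
  have i3 : Integrable _ _ := integrableOn_mul_primitive h₂ hψ
  have i4 := (i1.fun_add i2).fun_add i3
  refine ⟨IntegrableOn.congr_fun i4 e measurableSet_Ioc, ?_⟩
  rw [← setIntegral_congr_fun measurableSet_Ioc e, integral_add (i1.fun_add i2) i3,
    integral_add i1 i2, integral_mul_primitive_eq hpq h₁ hψ hφ,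
    integral_mul_primitive_eq hpq h₂ hψ hφ, integral_mul_const, ← hφ p hp q hq hpq]
  linear_combination φ q * (-hN p hp q hq hpq)

end Parts

theorem exists_norm_lt_of_integrableOn_Ioi {E : Type*} [NormedAddCommGroup E] {g : ℝ → E} {a : ℝ}
    (hg : IntegrableOn g (Ioi a) volume) {δ : ℝ} (hδ : 0 < δ) (X : ℝ) :
    ∃ x, X < x ∧ a < x ∧ ‖g x‖ < δ := by
  by_contra! h
  have h1 : IntegrableOn (fun _ : ℝ => δ) (Ioi (max a X)) volume := by
    refine Integrable.mono' (hg.mono_set (Ioi_subset_Ioi (le_max_left a X))).norm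
      aestronglyMeasurable_const ?_
    filter_upwards [ae_restrict_mem measurableSet_Ioi] with x hx
    rw [Real.norm_of_nonneg hδ.le]
    exact h x ((le_max_right _ _).trans_lt hx) ((le_max_left _ _).trans_lt hx)
  rw [integrableOn_const_iff] at h1
  simp [hδ.ne'] at h1

/-- An integrable function need not tend to zero, but it cannot stay above a positive constant on a
half line. Vanishing along a sequence is enough to remove boundary terms at infinity. -/
theorem exists_seq_tendsto_of_integrableOn_Ioi {E : Type*} [NormedAddCommGroup E] {g : ℝ → E}
    {a : ℝ} (hg : IntegrableOn g (Ioi a) volume) :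
    ∃ x : ℕ → ℝ, Tendsto x atTop atTop ∧ (∀ n, a < x n) ∧
      Tendsto (fun n => g (x n)) atTop (𝓝 0) := by
  choose x hx hx' hgx using fun n : ℕ =>
    exists_norm_lt_of_integrableOn_Ioi hg (Nat.one_div_pos_of_nat (α := ℝ) (n := n)) n
  refine ⟨x, tendsto_atTop_mono (fun n => (hx n).le) tendsto_natCast_atTop_atTop, hx', ?_⟩
  exact squeeze_zero_norm (fun n => (hgx n).le) tendsto_one_div_add_atTop_nhds_zero_nat

theorem exists_seq_tendsto_of_integrable {E : Type*} [NormedAddCommGroup E] {g : ℝ → E}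
    (hg : Integrable g volume) :
    (∃ x : ℕ → ℝ, Tendsto x atTop atTop ∧ Tendsto (fun n => g (x n)) atTop (𝓝 0)) ∧
    ∃ x : ℕ → ℝ, Tendsto x atTop atBot ∧ Tendsto (fun n => g (x n)) atTop (𝓝 0) := by
  constructor
  · obtain ⟨x, h1, -, h2⟩ := exists_seq_tendsto_of_integrableOn_Ioi (a := 0) hg.integrableOn
    exact ⟨x, h1, h2⟩
  · obtain ⟨x, h1, -, h2⟩ := exists_seq_tendsto_of_integrableOn_Ioi (a := 0)
      (g := fun x => g (-x)) hg.comp_neg.integrableOn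
    exact ⟨fun n => -x n, tendsto_neg_atTop_atBot.comp h1, h2⟩

/-- Integration by parts on the whole line. -/
theorem integral_parts_univ {ν : Measure ℝ} [SFinite ν] {κ₁ κ₂ ψ φ N : ℝ → ℂ}
    (h₁ : ∀ p q, IntegrableOn κ₁ (Ioc p q) volume) (h₂ : ∀ p q, IntegrableOn κ₂ (Ioc p q) ν)
    (hψ : ∀ p q, IntegrableOn ψ (Ioc p q) volume)
    (hφ : ∀ x y, x ≤ y → φ y - φ x = ∫ t in Ioc x y, ψ t)
    (hN : ∀ x y, x ≤ y → N y - N x = (∫ t in Ioc x y, κ₁ t) + ∫ t in Ioc x y, κ₂ t ∂ν)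
    (hNφ : Integrable (fun x => N x * φ x) volume) (hψN : Integrable (fun x => ψ x * N x) volume)
    (h₁φ : Integrable (fun x => κ₁ x * φ x) volume) (h₂φ : Integrable (fun x => κ₂ x * φ x) ν) :
    (∫ y, ψ y * N y) + (∫ x, κ₁ x * φ x) + (∫ x, κ₂ x * φ x ∂ν) = 0 := by
  -- The boundary terms are values of the integrable function Nφ, so they vanish along suitable
  -- sequences of endpoints.
  obtain ⟨⟨x, hx, hx0⟩, ⟨y, hy, hy0⟩⟩ := exists_seq_tendsto_of_integrable hNφ
  have t1 := (aecover_Ioc (μ := volume) hy hx).integral_tendsto_of_countably_generated hψN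
  have t2 := (aecover_Ioc (μ := volume) hy hx).integral_tendsto_of_countably_generated h₁φ
  have t3 := (aecover_Ioc (μ := ν) hy hx).integral_tendsto_of_countably_generated h₂φ
  refine tendsto_nhds_unique ((t1.add t2).add t3) ?_
  have t4 := hx0.sub hy0
  rw [sub_zero] at t4
  refine t4.congr' ?_
  filter_upwards [hx.eventually_ge_atTop 0, hy.eventually_le_atBot 0] with n hn hn'
  exact (integral_parts (hn'.trans hn) (h₁ _ _) (h₂ _ _) (hψ _ _)
    (fun x _ y _ h => hφ x y h) (fun x _ y _ h => hN x y h)).2.symm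

end MagneticSchrodinger

end

/-! ### The lemma of du Bois-Reymond and continuous representatives of H¹ functions. -/

noncomputable section

namespace MagneticSchrodinger

open Filter Topology

/-- A smooth compactly supported function of zero mean has a smooth compactly supported
primitive. -/
theorem exists_primitive_of_integral_eq_zero {ψ : ℝ → ℝ} (hψ : ContDiff ℝ ∞ ψ)
    (hs : HasCompactSupport ψ) (h0 : ∫ x, ψ x = 0) :
    ∃ Φ : ℝ → ℝ, ContDiff ℝ ∞ Φ ∧ HasCompactSupport Φ ∧ deriv Φ = ψ := by
  obtain ⟨r, hr⟩ := hs.isCompact.isBounded.subset_closedBall 0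
  have hout : ∀ x, r < |x| → ψ x = 0 := fun x hx => by
    by_contra h
    have := hr (subset_tsupport _ h)
    rw [mem_closedBall_zero_iff, Real.norm_eq_abs] at this
    exact absurd this (not_le.2 hx)
  have hint : Integrable ψ := hψ.continuous.integrable_of_hasCompactSupport hs
  have hd : ∀ x, HasDerivAt (fun x => ∫ t in Iic x, ψ t) (ψ x) x := fun x => by
    have h1 : (fun x => ∫ t in Iic x, ψ t) = fun x => (∫ t in Iic 0, ψ t) + ∫ t in (0)..x, ψ t := by
      ext y
      rw [← intervalIntegral.integral_Iic_sub_Iic hint.integrableOn hint.integrableOn]; ring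
    rw [h1]
    exact (intervalIntegral.integral_hasDerivAt_right hint.intervalIntegrable
      hψ.continuous.stronglyMeasurable.stronglyMeasurableAtFilter
      hψ.continuous.continuousAt).const_add _
  have hderiv : deriv (fun x => ∫ t in Iic x, ψ t) = ψ := funext fun x => (hd x).deriv
  refine ⟨fun x => ∫ t in Iic x, ψ t, ?_, ?_, hderiv⟩
  · rw [contDiff_infty_iff_deriv, hderiv]
    exact ⟨fun x => (hd x).differentiableAt, hψ⟩
  · refine HasCompactSupport.intro (isCompact_closedBall (0 : ℝ) (|r|)) fun x hx => ?_
    rw [mem_closedBall_zero_iff, Real.norm_eq_abs, not_le] at hx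
    have hrx : r < |x| := (le_abs_self r).trans_lt hx
    -- To the right of the support the primitive equals the total integral, which is zero; to the
    -- left its integrand vanishes.
    rcases le_total 0 x with h | h
    · rw [abs_of_nonneg h] at hrx hx
      rw [setIntegral_eq_integral_of_forall_compl_eq_zero, h0]
      intro y hy
      rw [mem_Iic, not_le] at hy
      exact hout y ((hrx.trans hy).trans_le (le_abs_self y))
    · rw [abs_of_nonpos h] at hrx hx
      refine setIntegral_eq_zero_of_forall_eq_zero fun y hy => hout y ?_
      rw [mem_Iic] at hy
      exact (hrx.trans_le (neg_le_neg hy)).trans_le (neg_le_abs y)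

/-- The lemma of du Bois-Reymond. -/
theorem ae_eq_const_of_weakDeriv_eq_zero {g : ℝ → ℂ} (hg : LocallyIntegrable g volume)
    (h : ∀ φ : ℝ → ℝ, ContDiff ℝ ∞ φ → HasCompactSupport φ → ∫ x, ((deriv φ x : ℝ) : ℂ) * g x = 0) :
    ∃ c : ℂ, ∀ᵐ x, g x = c := by
  let η₀ : ContDiffBump (0 : ℝ) := ⟨1, 2, one_pos, one_lt_two⟩
  let η : ℝ → ℝ := η₀.normed volume
  have hη : ContDiff ℝ ∞ η := η₀.contDiff_normed
  have hηs : HasCompactSupport η := η₀.hasCompactSupport_normed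
  have hη1 : ∫ x, η x = 1 := η₀.integral_normed
  -- For every test function ψ, the difference ψ - (∫ψ)η has mean zero and is therefore the
  -- derivative of a test function. Hence ∫ψg = (∫ψ)(∫ηg), which identifies the constant.
  refine ⟨∫ x, η x • g x, ?_⟩
  have hi : ∀ ψ : ℝ → ℝ, ContDiff ℝ ∞ ψ → HasCompactSupport ψ →
      Integrable (fun x => ψ x • g x) volume := fun ψ h1 h2 =>
    hg.integrable_smul_left_of_hasCompactSupport h1.continuous h2
  refine ae_eq_of_integral_contDiff_smul_eq hg (locallyIntegrable_const _) fun ψ hψ hψs => ?_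
  have hψi : Integrable ψ := hψ.continuous.integrable_of_hasCompactSupport hψs
  have hηi : Integrable η := hη.continuous.integrable_of_hasCompactSupport hηs
  obtain ⟨Φ, hΦ, hΦs, hΦd⟩ := exists_primitive_of_integral_eq_zero
    (ψ := fun x => ψ x - (∫ y, ψ y) * η x) (hψ.sub (contDiff_const.mul hη))
    (hψs.sub hηs.mul_left)
    (by rw [integral_sub hψi (hηi.const_mul _), integral_const_mul, hη1, mul_one, sub_self])
  have h1 := h Φ hΦ hΦs
  rw [hΦd] at h1
  have h2 : ∀ x, ((ψ x - (∫ y, ψ y) * η x : ℝ) : ℂ) * g x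
      = ψ x • g x - (∫ y, ψ y) • (η x • g x) := fun x => by
    simp only [Complex.real_smul]; push_cast; ring
  simp_rw [h2] at h1
  rw [integral_sub (hi ψ hψ hψs) ((hi η hη hηs).fun_smul _), integral_smul, sub_eq_zero] at h1
  rw [h1, integral_smul_const]

theorem integrableOn_Ioc_of_memLp_two {u : ℝ → ℂ} (hu : MemLp u 2 volume) (p q : ℝ) :
    IntegrableOn u (Ioc p q) volume :=
  (hu.locallyIntegrable (by norm_num)).integrableOn_isCompact isCompact_Icc
    |>.mono_set Ioc_subset_Icc_self

theorem deriv_increments {φ : ℝ → ℝ} (hφ : ContDiff ℝ ∞ φ) {x y : ℝ} (h : x ≤ y) :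
    ((φ y : ℝ) : ℂ) - φ x = ∫ t in Ioc x y, ((deriv φ t : ℝ) : ℂ) := by
  rw [integral_complex_ofReal, ← intervalIntegral.integral_of_le h,
    intervalIntegral.integral_deriv_eq_sub (fun t _ => (hφ.differentiable (by simp)) t)
      ((hφ.continuous_deriv (by simp)).intervalIntegrable _ _)]
  push_cast; rfl

/-- A function with the increments of `∫ κ₁ dx + ∫ κ₂ dν` satisfies `N' = κ₁ dx + κ₂ dν` in the
sense of distributions. -/
theorem integral_deriv_mul_of_increments {ν : Measure ℝ} [SFinite ν] {κ₁ κ₂ N : ℝ → ℂ}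
    (h₁ : ∀ p q, IntegrableOn κ₁ (Ioc p q) volume) (h₂ : ∀ p q, IntegrableOn κ₂ (Ioc p q) ν)
    (hN : ∀ x y, x ≤ y → N y - N x = (∫ t in Ioc x y, κ₁ t) + ∫ t in Ioc x y, κ₂ t ∂ν)
    {φ : ℝ → ℝ} (hφ : ContDiff ℝ ∞ φ) (hs : HasCompactSupport φ) :
    (∫ x, ((deriv φ x : ℝ) : ℂ) * N x)
      = - ((∫ x, κ₁ x * ((φ x : ℝ) : ℂ)) + ∫ x, κ₂ x * ((φ x : ℝ) : ℂ) ∂ν) := by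
  obtain ⟨r, hr⟩ := hs.isCompact.isBounded.subset_closedBall 0
  -- The margin 1 makes φ vanish at both ends of the interval, so that integration by parts leaves
  -- no boundary term.
  have hsub : tsupport φ ⊆ Ioc (-(|r| + 1)) (|r| + 1) := fun x hx => by
    have := hr hx
    rw [mem_closedBall_zero_iff, Real.norm_eq_abs] at this
    have h1 := le_abs_self r
    have h2 := abs_le.1 this
    constructor <;> linarith [h2.1, h2.2]
  have hφ0 : ∀ x, x ∉ Ioc (-(|r| + 1)) (|r| + 1) → φ x = 0 := fun x hx =>
    image_eq_zero_of_notMem_tsupport fun h => hx (hsub h)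
  have hd0 : ∀ x, x ∉ Ioc (-(|r| + 1)) (|r| + 1) → deriv φ x = 0 := fun x hx =>
    image_eq_zero_of_notMem_tsupport fun h => hx (hsub (tsupport_deriv_subset h))
  have hφr : φ (|r| + 1) = 0 := image_eq_zero_of_notMem_tsupport fun h => by
    have := hr h
    rw [mem_closedBall_zero_iff, Real.norm_eq_abs, abs_of_nonneg (by positivity)] at this
    linarith [le_abs_self r]
  have hφl : φ (-(|r| + 1)) = 0 := hφ0 _ fun h => lt_irrefl _ h.1
  have hc : Continuous fun x => ((deriv φ x : ℝ) : ℂ) :=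
    Complex.continuous_ofReal.comp (hφ.continuous_deriv (by simp))
  have key := (integral_parts (N := N) (φ := fun x => ((φ x : ℝ) : ℂ))
    (p := -(|r| + 1)) (q := |r| + 1) (by linarith [abs_nonneg r]) (h₁ _ _) (h₂ _ _)
    (ψ := fun x => ((deriv φ x : ℝ) : ℂ))
    (hc.locallyIntegrable.integrableOn_isCompact isCompact_Icc |>.mono_set Ioc_subset_Icc_self)
    (fun x _ y _ h => deriv_increments hφ h) (fun x _ y _ h => hN x y h)).2
  simp only [hφr, hφl, Complex.ofReal_zero, mul_zero, sub_zero] at key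
  rw [setIntegral_eq_integral_of_forall_compl_eq_zero (fun x hx => by simp [hd0 x hx]),
    setIntegral_eq_integral_of_forall_compl_eq_zero (fun x hx => by simp [hφ0 x hx]),
    setIntegral_eq_integral_of_forall_compl_eq_zero (fun x hx => by simp [hφ0 x hx])] at key
  linear_combination key

/-- A continuous representative `v` of `u`, all of whose increments are integrals of `u'`. -/
structure IsRep (u u' v : ℝ → ℂ) : Prop where
  continuous : Continuous v
  ae_eq : v =ᵐ[volume] u
  increments : ∀ x y, x ≤ y → v y - v x = ∫ t in Ioc x y, u' t

theorem continuous_of_increments {u' v : ℝ → ℂ} (h' : ∀ p q, IntegrableOn u' (Ioc p q) volume)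
    (hv : ∀ x y, x ≤ y → v y - v x = ∫ t in Ioc x y, u' t) : Continuous v := by
  rw [continuous_iff_continuousAt]
  intro x
  exact (continuousOn_of_increments (h' (x - 1) (x + 1)) fun a _ b _ h => hv a b h).continuousAt
    (Icc_mem_nhds (by linarith) (by linarith))

/-- The primitive F of u' also has weak derivative u', so u - F is almost everywhere a constant, and
F plus this constant is the representative. -/
theorem HasWeakDeriv.exists_isRep {u u' : ℝ → ℂ} (hu : MemLp u 2 volume) (hu' : MemLp u' 2 volume)
    (h : HasWeakDeriv u u') : ∃ v, IsRep u u' v := by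
  let F : ℝ → ℂ := fun x => ∫ t in (0)..x, u' t
  have hli : ∀ p q, IntegrableOn u' (Ioc p q) volume := integrableOn_Ioc_of_memLp_two hu'
  have hF : ∀ x y, x ≤ y → F y - F x = ∫ t in Ioc x y, u' t := fun x y hxy => by
    rw [intervalIntegral.integral_interval_sub_left, intervalIntegral.integral_of_le hxy] <;>
    exact ⟨hli _ _, hli _ _⟩
  have hFc : Continuous F := continuous_of_increments hli hF
  have hul := hu.locallyIntegrable (by norm_num)
  obtain ⟨c, hc⟩ := ae_eq_const_of_weakDeriv_eq_zero (g := fun x => u x - F x)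
    (hul.sub hFc.locallyIntegrable) fun φ hφ hφs => by
      have h1 := integral_deriv_mul_of_increments (ν := 0) (κ₂ := 0) (N := F) hli
        (fun _ _ => integrableOn_zero) (fun x y hxy => by simpa using hF x y hxy) hφ hφs
      have hdc : Continuous (deriv φ) := hφ.continuous_deriv (by simp)
      have i1 := hul.integrable_smul_left_of_hasCompactSupport hdc hφs.deriv
      have i2 := hFc.locallyIntegrable (μ := volume)
        |>.integrable_smul_left_of_hasCompactSupport hdc hφs.deriv
      simp only [Complex.real_smul] at i1 i2
      simp_rw [mul_sub]
      rw [integral_sub i1 i2, h φ hφ hφs, h1]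
      simp [mul_comm]
  refine ⟨fun x => c + F x, continuous_const.add hFc, ?_, fun x y hxy => by rw [← hF x y hxy]; ring⟩
  filter_upwards [hc] with x hx
  rw [← hx]; ring

theorem IsRep.unique {u u' v w : ℝ → ℂ} (hv : IsRep u u' v) (hw : Continuous w)
    (hwu : w =ᵐ[volume] u) : w = v :=
  (hw.ae_eq_iff_eq volume hv.continuous).1 (hwu.trans hv.ae_eq.symm)

theorem IsRep.memLp {u u' v : ℝ → ℂ} (hv : IsRep u u' v) (hu : MemLp u 2 volume) :
    MemLp v 2 volume := hu.ae_eq hv.ae_eq.symm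

theorem conj_increments {u' v : ℝ → ℂ} (hv : ∀ x y, x ≤ y → v y - v x = ∫ t in Ioc x y, u' t) :
    ∀ x y, x ≤ y → (starRingEnd ℂ) (v y) - (starRingEnd ℂ) (v x)
      = ∫ t in Ioc x y, (starRingEnd ℂ) (u' t) := fun x y hxy => by
  rw [integral_conj, ← hv x y hxy, map_sub]

theorem IntegrableOn.conj {μ : Measure ℝ} {f : ℝ → ℂ} {s : Set ℝ} (hf : IntegrableOn f s μ) :
    IntegrableOn (fun x => (starRingEnd ℂ) (f x)) s μ :=
  (LinearIsometryEquiv.integrable_comp_iff (Complex.conjLIE)).2 hf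

theorem integrable_mul_of_memLp_two {μ : Measure ℝ} {f g : ℝ → ℂ} (hf : MemLp f 2 μ)
    (hg : MemLp g 2 μ) : Integrable (fun x => f x * g x) μ :=
  hf.integrable_mul hg

theorem memLp_two_conj {μ : Measure ℝ} {f : ℝ → ℂ} (hf : MemLp f 2 μ) :
    MemLp (fun x => (starRingEnd ℂ) (f x)) 2 μ :=
  hf.of_le (Complex.continuous_conj.comp_aestronglyMeasurable hf.1) (by simp)

/-- The derivative of |v|² is 2 Re(u' v̄), and |v|² is small along a sequence tending to -∞; Young's
inequality does the rest. The free parameter δ is what lets Gårding's inequality absorb singular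
terms. -/
theorem IsRep.norm_sq_le {u u' v : ℝ → ℂ} (hv : IsRep u u' v) (hu : MemLp u 2 volume)
    (hu' : MemLp u' 2 volume) {δ : ℝ} (hδ : 0 < δ) (x : ℝ) :
    ‖v x‖ ^ 2 ≤ δ * (∫ t, ‖u' t‖ ^ 2) + δ⁻¹ * ∫ t, ‖u t‖ ^ 2 := by
  have hv2 := hv.memLp hu
  have e : ∫ t, ‖u t‖ ^ 2 = ∫ t, ‖v t‖ ^ 2 := integral_congr_ae
    (by filter_upwards [hv.ae_eq] with t ht; rw [ht])
  rw [e]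
  have i1 : Integrable (fun t => ‖u' t‖ ^ 2) := (memLp_two_iff_integrable_sq_norm hu'.1).1 hu'
  have i2 : Integrable (fun t => ‖v t‖ ^ 2) := (memLp_two_iff_integrable_sq_norm hv2.1).1 hv2
  have i3 : Integrable (fun t => δ * ‖u' t‖ ^ 2 + δ⁻¹ * ‖v t‖ ^ 2) :=
    (i1.const_mul _).add (i2.const_mul _)
  have hli := integrableOn_Ioc_of_memLp_two hu'
  have key : ∀ y, y ≤ x → ‖v x‖ ^ 2 - ‖v y‖ ^ 2 ≤ ∫ t, (δ * ‖u' t‖ ^ 2 + δ⁻¹ * ‖v t‖ ^ 2) := by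
    intro y hy
    obtain ⟨-, h⟩ := integral_parts (ν := 0) (κ₂ := 0) (κ₁ := u') (N := v)
      (φ := fun t => (starRingEnd ℂ) (v t)) (ψ := fun t => (starRingEnd ℂ) (u' t)) hy (hli _ _)
      integrableOn_zero (IntegrableOn.conj (hli _ _)) (fun a _ b _ h => conj_increments hv.increments a b h)
      (fun a _ b _ h => by simpa using hv.increments a b h)
    simp only [Measure.restrict_zero, integral_zero_measure, add_zero, Complex.mul_conj] at h
    have h2 : ((‖v x‖ ^ 2 - ‖v y‖ ^ 2 : ℝ) : ℂ)
        = (∫ t in Ioc y x, (starRingEnd ℂ) (u' t) * v t)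
          + ∫ t in Ioc y x, u' t * (starRingEnd ℂ) (v t) := by
      rw [h]; simp [Complex.normSq_eq_norm_sq]
    have i4 : Integrable (fun t => ‖u' t‖ * ‖v t‖) := hu'.norm.integrable_mul hv2.norm
    have h3 : ‖((‖v x‖ ^ 2 - ‖v y‖ ^ 2 : ℝ) : ℂ)‖ ≤ 2 * ∫ t, ‖u' t‖ * ‖v t‖ := by
      rw [h2, two_mul]
      refine (norm_add_le _ _).trans (add_le_add ?_ ?_) <;>
      · refine (norm_integral_le_integral_norm _).trans ?_
        simp only [norm_mul, RCLike.norm_conj]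
        exact setIntegral_le_integral i4 (Eventually.of_forall fun t => by positivity)
    rw [Complex.norm_real] at h3
    refine (le_abs_self _).trans (h3.trans ?_)
    rw [← integral_const_mul]
    refine integral_mono (i4.const_mul _) i3 fun t => ?_
    -- Young's inequality 2|u'||v| ≤ δ|u'|² + δ⁻¹|v|², by completing the square.
    have h4 : 0 ≤ δ⁻¹ * (δ * ‖u' t‖ - ‖v t‖) ^ 2 := by positivity
    have h5 : δ⁻¹ * (δ * ‖u' t‖ - ‖v t‖) ^ 2
        = δ * ‖u' t‖ ^ 2 + δ⁻¹ * ‖v t‖ ^ 2 - 2 * (‖u' t‖ * ‖v t‖) := by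
      field_simp; ring
    simp only
    linarith
  rw [← integral_const_mul, ← integral_const_mul, ← integral_add (i1.const_mul _) (i2.const_mul _)]
  obtain ⟨-, y, hy, hy0⟩ := exists_seq_tendsto_of_integrable i2
  refine le_of_tendsto (f := fun n => ‖v x‖ ^ 2 - ‖v (y n)‖ ^ 2) (x := atTop) ?_ ?_
  · simpa using tendsto_const_nhds.sub hy0
  · filter_upwards [hy.eventually_le_atBot x] with n hn using key _ hn

end MagneticSchrodinger

end

/-! ### Vector measures: polar decomposition, densities, division by a positive function. -/

noncomputable section

namespace MagneticSchrodinger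

open Filter Topology VectorMeasure

/-- The sign in the polar decomposition of a signed measure. -/
theorem exists_sign_setIntegral_eq (V : SignedMeasure ℝ) :
    ∃ σ : ℝ → ℝ, Measurable σ ∧ (∀ x, |σ x| = 1) ∧
      ∀ (u : ℝ → ℂ) (A : Set ℝ), MeasurableSet A → Integrable u V.totalVariation →
        ∫ᵛ x in A, u x ∂<•V = ∫ x in A, (σ x : ℂ) * u x ∂V.totalVariation := by
  classical
  set j := V.toJordanDecomposition with hj
  -- The set s is null for the positive part and its complement is null for the negative part, so
  -- the sign is -1 on s and 1 off s.
  obtain ⟨s, hs, hps, hns⟩ := j.mutuallySingular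
  have hV : V = j.posPart.toSignedMeasure - j.negPart.toSignedMeasure :=
    V.toSignedMeasure_toJordanDecomposition.symm
  have hσm : Measurable (fun x => if x ∈ s then (-1 : ℝ) else 1) :=
    Measurable.ite hs measurable_const measurable_const
  refine ⟨fun x => if x ∈ s then -1 else 1, hσm, fun x => by
    by_cases hx : x ∈ s <;> simp [hx], fun u A hA hu => ?_⟩
  have htv : V.totalVariation = j.posPart + j.negPart := rfl
  rw [htv] at hu ⊢
  have hup := hu.left_of_add_measure
  have hun := hu.right_of_add_measure
  have hpA : j.posPart.toSignedMeasure.Integrable u := by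
    simpa [VectorMeasure.Integrable] using hup
  have hnA : j.negPart.toSignedMeasure.Integrable u := by
    simpa [VectorMeasure.Integrable] using hun
  have hσu : Integrable (fun x => (((if x ∈ s then (-1 : ℝ) else 1) : ℝ) : ℂ) * u x)
      (j.posPart + j.negPart) := by
    refine hu.bdd_mul (c := 1) (Complex.measurable_ofReal.comp hσm).aestronglyMeasurable ?_
    exact Eventually.of_forall fun x => by by_cases hx : x ∈ s <;> simp [hx]
  rw [hV, restrict_sub, integral_sub_vectorMeasure hpA.restrict hnA.restrict,
    setIntegral_toSignedMeasure hA, setIntegral_toSignedMeasure hA, Measure.restrict_add,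
    integral_add_measure hσu.left_of_add_measure.restrict hσu.right_of_add_measure.restrict,
    sub_eq_add_neg, ← MeasureTheory.integral_neg]
  congr 1
  · refine integral_congr_ae (ae_restrict_of_ae ?_)
    have : ∀ᵐ x ∂j.posPart, x ∉ s := measure_eq_zero_iff_ae_notMem.1 hps
    filter_upwards [this] with x hx
    simp [hx]
  · refine integral_congr_ae (ae_restrict_of_ae ?_)
    have : ∀ᵐ x ∂j.negPart, x ∉ sᶜ := measure_eq_zero_iff_ae_notMem.1 hns
    filter_upwards [this] with x hx
    simp [not_not.1 hx]

theorem isFiniteMeasure_variation_signed (V : SignedMeasure ℝ) : IsFiniteMeasure V.variation := by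
  rw [← SignedMeasure.totalVariation_eq_variation]
  unfold SignedMeasure.totalVariation
  infer_instance

/-- The variation is at most the sum of those of the real and imaginary parts, and these are signed
measures, for which the Jordan decomposition gives finiteness. -/
theorem isFiniteMeasure_variation (μ : VectorMeasure ℝ ℂ) : IsFiniteMeasure μ.variation := by
  let r : SignedMeasure ℝ := μ.mapRange Complex.reAddGroupHom Complex.continuous_re
  let i : SignedMeasure ℝ := μ.mapRange Complex.imAddGroupHom Complex.continuous_im
  have h : μ.variation ≤ r.variation + i.variation := by
    refine variation_le_of_forall_enorm_le fun A hA => ?_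
    refine le_trans ?_ (add_le_add (enorm_measure_le_variation r A) (enorm_measure_le_variation i A))
    have h1 : μ A = ((r A : ℝ) : ℂ) + ((i A : ℝ) : ℂ) * Complex.I := (Complex.re_add_im _).symm
    rw [h1]
    refine (enorm_add_le _ _).trans ?_
    simp [← ofReal_norm]
  have := isFiniteMeasure_variation_signed r
  have := isFiniteMeasure_variation_signed i
  exact isFiniteMeasure_of_le _ h

instance (μ : VectorMeasure ℝ ℂ) : IsFiniteMeasure μ.variation := isFiniteMeasure_variation μ

theorem vectorIntegral_simpleFunc {μ : Measure ℝ} {κ : ℝ → ℂ} (hκ : Integrable κ μ)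
    (s : SimpleFunc ℝ ℝ) : ∫ᵛ x, s x ∂•(μ.withDensityᵥ κ) = ∫ x, (s x : ℂ) * κ x ∂μ := by
  classical
  induction s using SimpleFunc.induction with
  | const c hs =>
    rename_i A
    rw [SimpleFunc.coe_piecewise, SimpleFunc.coe_const, SimpleFunc.coe_const, Function.const_zero,
      piecewise_eq_indicator, VectorMeasure.integral_indicator hs]
    have h : ∀ x, ((A.indicator (Function.const ℝ c) x : ℝ) : ℂ) * κ x
        = A.indicator (fun x => (c : ℂ) * κ x) x := fun x => by
      by_cases hx : x ∈ A <;> simp [hx]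
    simp_rw [h]
    rw [MeasureTheory.integral_indicator hs, MeasureTheory.integral_const_mul]
    simp only [Function.const_apply]
    rw [VectorMeasure.integral_const, restrict_apply_univ, withDensityᵥ_apply hκ hs]
    simp
  | @add f g _ hf hg =>
    have hb : ∀ f : SimpleFunc ℝ ℝ, Integrable (fun x => (f x : ℂ) * κ x) μ := fun f => by
      obtain ⟨C, hC⟩ := f.exists_forall_norm_le
      exact hκ.bdd_mul (c := C)
        (Complex.measurable_ofReal.comp f.measurable).aestronglyMeasurable
        (Eventually.of_forall fun x => by simpa using hC x)
    have hi : ∀ f : SimpleFunc ℝ ℝ, (μ.withDensityᵥ κ).Integrable f := fun f =>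
      f.integrable_of_isFiniteMeasure
    rw [SimpleFunc.coe_add, VectorMeasure.integral_add (hi f) (hi g), hf, hg,
      ← MeasureTheory.integral_add (hb f) (hb g)]
    refine integral_congr_ae (Eventually.of_forall fun x => ?_)
    simp only [Pi.add_apply]; push_cast; ring

/-- Integration of a bounded function against a vector measure with a density. -/
theorem vectorIntegral_withDensityᵥ {μ : Measure ℝ} {κ : ℝ → ℂ} (hκ : Integrable κ μ)
    {β : ℝ → ℝ} (hβ : Measurable β) {K : ℝ} (hK : ∀ x, |β x| ≤ K) :
    ∫ᵛ x, β x ∂•(μ.withDensityᵥ κ) = ∫ x, (β x : ℂ) * κ x ∂μ := by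
  have hs := hβ.stronglyMeasurable
  have hK0 : 0 ≤ K := (abs_nonneg _).trans (hK 0)
  -- Uniformly bounded simple functions approximate β, and dominated convergence applies to both
  -- integrals.
  have t1 : Tendsto (fun n => ∫ᵛ x, hs.approxBounded K n x ∂•(μ.withDensityᵥ κ)) atTop
      (𝓝 (∫ᵛ x, β x ∂•(μ.withDensityᵥ κ))) := by
    refine tendsto_integral_filter_of_norm_le_const ?_ ⟨K, ?_⟩ ?_
    · exact Eventually.of_forall fun n => (SimpleFunc.measurable _).aestronglyMeasurable
    · exact Eventually.of_forall fun n => Eventually.of_forall fun x =>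
        hs.norm_approxBounded_le hK0 n x
    · exact Eventually.of_forall fun x => hs.tendsto_approxBounded_of_norm_le (hK x)
  have t2 : Tendsto (fun n => ∫ x, (hs.approxBounded K n x : ℂ) * κ x ∂μ) atTop
      (𝓝 (∫ x, (β x : ℂ) * κ x ∂μ)) := by
    refine tendsto_integral_of_dominated_convergence (fun x => K * ‖κ x‖) (fun n => ?_)
      (hκ.norm.const_mul K) (fun n => Eventually.of_forall fun x => ?_)
      (Eventually.of_forall fun x => ?_)
    · exact (Complex.measurable_ofReal.comp (SimpleFunc.measurable _)).aestronglyMeasurable.mul hκ.1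
    · rw [norm_mul, Complex.norm_real]
      exact mul_le_mul_of_nonneg_right (hs.norm_approxBounded_le hK0 n x) (norm_nonneg _)
    · exact ((Complex.continuous_ofReal.tendsto _).comp
        (hs.tendsto_approxBounded_of_norm_le (hK x))).mul_const _
  simp_rw [vectorIntegral_simpleFunc hκ] at t1
  exact tendsto_nhds_unique t1 t2

theorem restrict_withDensityᵥ_eq {μ : Measure ℝ} {κ : ℝ → ℂ} (hκ : Integrable κ μ) {A : Set ℝ}
    (hA : MeasurableSet A) : (μ.withDensityᵥ κ).restrict A = (μ.restrict A).withDensityᵥ κ := by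
  ext B hB
  rw [VectorMeasure.restrict_apply _ hA hB, withDensityᵥ_apply hκ (hB.inter hA),
    withDensityᵥ_apply hκ.restrict hB, Measure.restrict_restrict hB]

theorem setVectorIntegral_withDensityᵥ {μ : Measure ℝ} {κ : ℝ → ℂ} (hκ : Integrable κ μ)
    {β : ℝ → ℝ} (hβ : Measurable β) {K : ℝ} (hK : ∀ x, |β x| ≤ K) {A : Set ℝ}
    (hA : MeasurableSet A) :
    ∫ᵛ x in A, β x ∂•(μ.withDensityᵥ κ) = ∫ x in A, (β x : ℂ) * κ x ∂μ := by
  rw [restrict_withDensityᵥ_eq hκ hA, vectorIntegral_withDensityᵥ hκ.restrict hβ hK]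

theorem integrable_bounded (μ : VectorMeasure ℝ ℂ) {β : ℝ → ℝ} (hβ : Measurable β) {K : ℝ}
    (hK : ∀ x, |β x| ≤ K) : μ.Integrable β :=
  MeasureTheory.Integrable.of_bound hβ.aestronglyMeasurable K (Eventually.of_forall hK)

/-- The variation of βμ is β|μ|, and a strictly positive density annihilates no nonzero measure.
This permits division of the equation between measures by β, even where a jump of β meets an atom of
df. -/
theorem vectorMeasure_eq_zero_of_integral_eq_zero {μ : VectorMeasure ℝ ℂ} {β : ℝ → ℝ}
    (hβ : Measurable β) {K : ℝ} (hK : ∀ x, |β x| ≤ K) (hpos : ∀ x, 0 < β x)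
    (h : ∀ A, MeasurableSet A → ∫ᵛ x in A, β x ∂•μ = 0) : μ = 0 := by
  have hi := integrable_bounded μ hβ hK
  have h0 : μ.withDensity β (ContinuousLinearMap.lsmul ℝ ℝ) = 0 := by
    ext A hA
    rw [VectorMeasure.withDensity_apply hi, h A hA, zero_apply]
  have h1 := variation_withDensity (μ := μ) (f := β) (B := ContinuousLinearMap.lsmul ℝ ℝ) hi
    (fun x y => by simp)
  rw [h0, variation_zero, variation_transpose_lsmul] at h1
  have h2 : μ.variation = 0 := by
    have h3 := withDensity_absolutelyContinuous' (μ := μ.variation) (f := fun x => ‖β x‖ₑ)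
      (by fun_prop) (Eventually.of_forall fun x => by simpa using (hpos x).ne')
    rw [← h1] at h3
    exact Measure.absolutelyContinuous_zero_iff.1 h3
  ext A hA
  have h4 := enorm_measure_le_variation μ A
  rw [h2] at h4
  simpa using h4

theorem vectorMeasure_ext_Ioc {μ ν : VectorMeasure ℝ ℂ}
    (h : ∀ x y, x ≤ y → μ (Ioc x y) = ν (Ioc x y)) : μ = ν := by
  refine ext_of_generateFrom {S : Set ℝ | ∃ l u, l < u ∧ Ioc l u = S} ?_
    (BorelSpace.measurable_eq.trans (borel_eq_generateFrom_Ioc ℝ))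
    (by simpa using isPiSystem_Ioc (id : ℝ → ℝ) id) ?_
  · rintro _ ⟨l, u, hlu, rfl⟩
    exact h l u hlu.le
  -- The π-system of bounded intervals does not contain the line, so equality of total masses is
  -- obtained by exhaustion.
  · have hm : Monotone fun n : ℕ => Ioc (-(n : ℝ)) n := fun a b hab => by
      have : (a : ℝ) ≤ b := by exact_mod_cast hab
      exact Ioc_subset_Ioc (by linarith) this
    have hU : ⋃ n : ℕ, Ioc (-(n : ℝ)) n = univ := by
      refine eq_univ_of_forall fun x => mem_iUnion.2 ?_
      obtain ⟨n, hn⟩ := exists_nat_gt |x|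
      exact ⟨n, by linarith [neg_abs_le x], (le_abs_self x).trans hn.le⟩
    have t1 := tendsto_vectorMeasure_iUnion_atTop_nat (v := μ) hm fun n => measurableSet_Ioc
    have t2 := tendsto_vectorMeasure_iUnion_atTop_nat (v := ν) hm fun n => measurableSet_Ioc
    rw [hU] at t1 t2
    refine tendsto_nhds_unique t1 (t2.congr fun n => ?_)
    exact (h _ _ (by linarith [n.cast_nonneg (α := ℝ)])).symm

end MagneticSchrodinger

end

/-! ### Functions described by their increments, and their distributional derivatives. -/

noncomputable section

namespace MagneticSchrodinger

open Filter Topology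

section Increments

variable {ν : Measure ℝ} {κ₁ κ₂ f : ℝ → ℂ}

/-- The function `f` has the increments of the measure `κ₁ dx + κ₂ dν`. -/
def HasIncrements (ν : Measure ℝ) (κ₁ κ₂ f : ℝ → ℂ) : Prop :=
  ∀ x y, x ≤ y → f y - f x = (∫ t in Ioc x y, κ₁ t) + ∫ t in Ioc x y, κ₂ t ∂ν

theorem norm_setIntegral_Ioc_le {μ : Measure ℝ} {κ : ℝ → ℂ} {a b : ℝ}
    (h : IntegrableOn κ (Ioc a b) μ) {x y : ℝ} (hx : a ≤ x) (hxy : x ≤ y) (hy : y ≤ b) :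
    ‖∫ t in Ioc x y, κ t ∂μ‖ ≤ (∫ t in Ioc a y, ‖κ t‖ ∂μ) - ∫ t in Ioc a x, ‖κ t‖ ∂μ := by
  refine (norm_integral_le_integral_norm _).trans (le_of_eq ?_)
  rw [eq_sub_iff_add_eq, add_comm, ← setIntegral_union (Ioc_disjoint_Ioc_of_le le_rfl)
    measurableSet_Ioc (IntegrableOn.mono_set h.norm (Ioc_subset_Ioc_right (hxy.trans hy)))
    (IntegrableOn.mono_set h.norm (Ioc_subset_Ioc hx hy)), Ioc_union_Ioc_eq_Ioc hx hxy]

/-- The increments of f are dominated by those of the monotone function G, the mass of |κ₁|dx +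
|κ₂|dν on (a, y]. -/
theorem HasIncrements.locallyBoundedVariationOn (hf : HasIncrements ν κ₁ κ₂ f)
    (h₁ : ∀ p q, IntegrableOn κ₁ (Ioc p q) volume) (h₂ : ∀ p q, IntegrableOn κ₂ (Ioc p q) ν) :
    LocallyBoundedVariationOn f univ := by
  intro a b _ _
  let G : ℝ → ℝ := fun y => (∫ t in Ioc a y, ‖κ₁ t‖) + ∫ t in Ioc a y, ‖κ₂ t‖ ∂ν
  have hG : ∀ x ∈ Icc a b, ∀ y ∈ Icc a b, x ≤ y → ‖f y - f x‖ ≤ G y - G x := by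
    intro x hx y hy hxy
    rw [hf x y hxy]
    refine (norm_add_le _ _).trans ?_
    have e1 := norm_setIntegral_Ioc_le (h₁ a b) hx.1 hxy hy.2
    have e2 := norm_setIntegral_Ioc_le (h₂ a b) hx.1 hxy hy.2
    simp only [G]
    linarith
  have hmono : MonotoneOn G (Icc a b) := fun x hx y hy hxy => by
    have := (norm_nonneg _).trans (hG x hx y hy hxy)
    linarith
  rw [univ_inter]
  have hB : BoundedVariationOn G (Icc a b) := by
    rcases le_or_gt a b with hab | hab
    · have := hmono.locallyBoundedVariationOn a b (left_mem_Icc.2 hab) (right_mem_Icc.2 hab)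
      rwa [inter_self] at this
    · rw [Icc_eq_empty (not_le.2 hab)]
      exact BoundedVariationOn.of_subsingleton subsingleton_empty
  refine ne_top_of_le_ne_top hB (iSup_mono fun p => Finset.sum_le_sum fun i _ => ?_)
  rw [edist_dist, edist_dist, dist_eq_norm, Real.dist_eq]
  refine ENNReal.ofReal_le_ofReal ((hG _ (p.2.2.2 i) _ (p.2.2.2 (i + 1))
    (p.2.2.1 (Nat.le_succ i))).trans (le_abs_self _))

theorem tendsto_setIntegral_Ioc_right {μ : Measure ℝ} {κ : ℝ → ℂ} {x : ℝ}
    (h : IntegrableOn κ (Ioc x (x + 1)) μ) :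
    Tendsto (fun y => ∫ t in Ioc x y, κ t ∂μ) (𝓝[>] x) (𝓝 0) := by
  have h1 : Tendsto (fun y => ∫ t in Ioc x (x + 1), (Iic y).indicator κ t ∂μ) (𝓝[>] x)
      (𝓝 (∫ t in Ioc x (x + 1), (0 : ℂ) ∂μ)) := by
    refine tendsto_integral_filter_of_dominated_convergence (fun t => ‖κ t‖)
      (Eventually.of_forall fun y => h.1.indicator measurableSet_Iic)
      (Eventually.of_forall fun y => Eventually.of_forall fun t => norm_indicator_le_norm_self _ _)
      h.norm ?_
    filter_upwards [ae_restrict_mem measurableSet_Ioc] with t ht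
    refine tendsto_const_nhds.congr' ?_
    filter_upwards [Ioo_mem_nhdsGT ht.1] with y hy
    rw [indicator_of_notMem]
    simpa using hy.2
  rw [integral_zero] at h1
  refine h1.congr' ?_
  filter_upwards [Ioo_mem_nhdsGT (show x < x + 1 by linarith)] with y hy
  rw [setIntegral_indicator measurableSet_Iic]
  congr 2
  ext t
  simp only [mem_inter_iff, mem_Ioc, mem_Iic]
  constructor
  · rintro ⟨⟨h1, -⟩, h2⟩; exact ⟨h1, h2⟩
  · rintro ⟨h1, h2⟩; exact ⟨⟨h1, h2.trans hy.2.le⟩, h2⟩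

/-- The intervals (x, y] decrease to the empty set as y decreases to x. Thus f coincides with its
right limits, the values that the derivative measure of a half-open interval sees. -/
theorem HasIncrements.tendsto_right (hf : HasIncrements ν κ₁ κ₂ f)
    (h₁ : ∀ p q, IntegrableOn κ₁ (Ioc p q) volume) (h₂ : ∀ p q, IntegrableOn κ₂ (Ioc p q) ν)
    (x : ℝ) : Tendsto f (𝓝[>] x) (𝓝 (f x)) := by
  have h := ((tendsto_setIntegral_Ioc_right (h₁ x (x + 1))).add
    (tendsto_setIntegral_Ioc_right (h₂ x (x + 1)))).const_add (f x)
  rw [add_zero, add_zero] at h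
  refine h.congr' ?_
  filter_upwards [self_mem_nhdsWithin] with y hy
  rw [← hf x y (le_of_lt hy)]; ring

/-- Either the clamp is constant just to the right of x, or it is the identity there. In both cases
freezing preserves right continuity. -/
theorem clamp_tendsto_right (p q x : ℝ) :
    (∀ᶠ y in 𝓝[>] x, max p (min q y) = max p (min q x)) ∨
      Tendsto (fun y => max p (min q y)) (𝓝[>] x) (𝓝[>] (max p (min q x))) := by
  by_cases h : x < q ∧ p ≤ x
  · right
    have e : max p (min q x) = x := by rw [min_eq_right h.1.le, max_eq_right h.2]
    rw [e]
    refine tendsto_id.congr' ?_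
    filter_upwards [Ioo_mem_nhdsGT h.1] with y hy
    rw [min_eq_right hy.2.le, max_eq_right (h.2.trans hy.1.le), id]
  · left
    rw [not_and_or, not_lt, not_le] at h
    rcases h with h | h
    · filter_upwards [self_mem_nhdsWithin] with y hy
      rw [min_eq_left h, min_eq_left (h.trans (le_of_lt hy))]
    · filter_upwards [Ioo_mem_nhdsGT h] with y hy
      rw [max_eq_left ((min_le_right _ _).trans h.le), max_eq_left ((min_le_right _ _).trans hy.2.le)]

theorem Ioc_clamp (p q x y : ℝ) :
    Ioc (max p (min q x)) (max p (min q y)) = Ioc x y ∩ Ioc p q := by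
  ext t
  simp only [mem_Ioc, mem_inter_iff, max_lt_iff, min_lt_iff, le_max_iff, le_min_iff]
  constructor
  · rintro ⟨⟨h1, h2⟩, h3⟩
    have h4 : t ≤ q ∧ t ≤ y := h3.resolve_left (not_le.2 h1)
    exact ⟨⟨h2.resolve_left (not_lt.2 h4.1), h4.2⟩, h1, h4.1⟩
  · rintro ⟨⟨h1, h2⟩, h3, h4⟩
    exact ⟨⟨h3, Or.inr h1⟩, Or.inr ⟨h4, h2⟩⟩

theorem withDensity_add_apply {μ ν : Measure ℝ} {κ₁ κ₂ : ℝ → ℂ} {I A : Set ℝ}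
    (h₁ : IntegrableOn κ₁ I μ) (h₂ : IntegrableOn κ₂ I ν) (hA : MeasurableSet A) :
    ((μ.restrict I).withDensityᵥ κ₁ + (ν.restrict I).withDensityᵥ κ₂) A
      = (∫ t in A ∩ I, κ₁ t ∂μ) + ∫ t in A ∩ I, κ₂ t ∂ν := by
  rw [_root_.add_apply, withDensityᵥ_apply h₁ hA, withDensityᵥ_apply h₂ hA,
    Measure.restrict_restrict hA, Measure.restrict_restrict hA]

theorem vectorIntegral_withDensity_add {μ ν : Measure ℝ} {κ₁ κ₂ : ℝ → ℂ} {I A : Set ℝ}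
    (h₁ : IntegrableOn κ₁ I μ) (h₂ : IntegrableOn κ₂ I ν) (hA : MeasurableSet A)
    {β : ℝ → ℝ} (hβ : Measurable β) {K : ℝ} (hK : ∀ x, |β x| ≤ K) :
    ∫ᵛ x in A, β x ∂•((μ.restrict I).withDensityᵥ κ₁ + (ν.restrict I).withDensityᵥ κ₂)
      = (∫ x in A ∩ I, (β x : ℂ) * κ₁ x ∂μ) + ∫ x in A ∩ I, (β x : ℂ) * κ₂ x ∂ν := by
  rw [VectorMeasure.restrict_add, VectorMeasure.integral_add_vectorMeasure
    (integrable_bounded _ hβ hK) (integrable_bounded _ hβ hK),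
    setVectorIntegral_withDensityᵥ h₁ hβ hK hA, setVectorIntegral_withDensityᵥ h₂ hβ hK hA,
    Measure.restrict_restrict hA, Measure.restrict_restrict hA]

/-- By right continuity both measures give (x, y] the increment of the frozen function, and such
intervals determine a measure. -/
theorem HasIncrements.vectorMeasure_freeze (hf : HasIncrements ν κ₁ κ₂ f)
    (h₁ : ∀ p q, IntegrableOn κ₁ (Ioc p q) volume) (h₂ : ∀ p q, IntegrableOn κ₂ (Ioc p q) ν)
    (hbv : LocallyBoundedVariationOn f univ) (p q : ℝ) :
    (boundedVariationOn_freeze hbv p q).vectorMeasure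
      = (volume.restrict (Ioc p q)).withDensityᵥ κ₁ + (ν.restrict (Ioc p q)).withDensityᵥ κ₂ := by
  have hr : ∀ x, Function.rightLim (fun x => f (max p (min q x))) x = f (max p (min q x)) := by
    intro x
    refine rightLim_eq_of_tendsto ?_
    rcases clamp_tendsto_right p q x with h | h
    · exact tendsto_const_nhds.congr' (h.mono fun y hy => by simp only [hy])
    · exact (hf.tendsto_right h₁ h₂ _).comp h
  refine vectorMeasure_ext_Ioc fun x y hxy => ?_
  rw [BoundedVariationOn.vectorMeasure_Ioc _ hxy, hr, hr,
    hf _ _ (max_le_max le_rfl (min_le_min le_rfl hxy)), Ioc_clamp,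
    withDensity_add_apply (h₁ p q) (h₂ p q) measurableSet_Ioc]

theorem localDeriv_restrict (hbv : LocallyBoundedVariationOn f univ) (p q : ℝ) {A : Set ℝ}
    (hA : MeasurableSet A) : (localDeriv hbv p q).restrict A
      = (boundedVariationOn_freeze hbv p q).vectorMeasure.restrict (A ∩ Ioo p q) := by
  rw [localDeriv, VectorMeasure.restrict_restrict _ hA measurableSet_Ioo, inter_comm]

/-- The distributional derivative of a function with the increments of `κ₁ dx + κ₂ dν`. -/
theorem HasIncrements.integral_localDeriv (hf : HasIncrements ν κ₁ κ₂ f)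
    (h₁ : ∀ p q, IntegrableOn κ₁ (Ioc p q) volume) (h₂ : ∀ p q, IntegrableOn κ₂ (Ioc p q) ν)
    (hbv : LocallyBoundedVariationOn f univ) {p q : ℝ} {A : Set ℝ} (hA : MeasurableSet A)
    (hApq : A ⊆ Ioo p q) {β : ℝ → ℝ} (hβ : Measurable β) {K : ℝ} (hK : ∀ x, |β x| ≤ K) :
    ∫ᵛ x in A, β x ∂•(localDeriv hbv p q)
      = (∫ x in A, (β x : ℂ) * κ₁ x) + ∫ x in A, (β x : ℂ) * κ₂ x ∂ν := by
  rw [localDeriv_restrict hbv p q hA, inter_eq_left.2 hApq, hf.vectorMeasure_freeze h₁ h₂ hbv,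
    vectorIntegral_withDensity_add (h₁ p q) (h₂ p q) hA hβ hK,
    inter_eq_left.2 (hApq.trans Ioo_subset_Ioc_self)]

theorem rightLim_freeze (hbv : LocallyBoundedVariationOn f univ) {p q x : ℝ} (hp : p < x)
    (hq : x < q) : Function.rightLim (fun x => f (max p (min q x))) x = f.rightLim x := by
  have h := (boundedVariationOn_freeze hbv p q).tendsto_rightLim x
  refine (rightLim_eq_of_tendsto (h.congr' ?_)).symm
  filter_upwards [Ioo_mem_nhdsGT hq] with y hy
  rw [min_eq_right hy.2.le, max_eq_right (hp.trans hy.1).le]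

theorem rightLim_ae_eq (hbv : LocallyBoundedVariationOn f univ) : f.rightLim =ᵐ[volume] f := by
  filter_upwards [hbv.ae_differentiableAt] with x hx
  exact rightLim_eq_of_tendsto (hx.continuousAt.tendsto.mono_left nhdsWithin_le_nhds)

/-- Dividing the equation by β identifies df with κ₁dx + κ₂dν on bounded open intervals, and df(x,
y] is the increment of the right limits of f, whatever values f takes at its jumps. -/
theorem hasIncrements_rightLim (hbv : LocallyBoundedVariationOn f univ)
    (h₁ : ∀ p q, IntegrableOn κ₁ (Ioc p q) volume) (h₂ : ∀ p q, IntegrableOn κ₂ (Ioc p q) ν)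
    {β : ℝ → ℝ} (hβ : Measurable β) {K : ℝ} (hK : ∀ x, |β x| ≤ K) (hpos : ∀ x, 0 < β x)
    (h : ∀ p q : ℝ, ∀ A : Set ℝ, A ⊆ Ioo p q → MeasurableSet A →
      ∫ᵛ x in A, β x ∂•(localDeriv hbv p q)
        = (∫ x in A, (β x : ℂ) * κ₁ x) + ∫ x in A, (β x : ℂ) * κ₂ x ∂ν) :
    HasIncrements ν κ₁ κ₂ f.rightLim := by
  intro x y hxy
  -- Enlarging the interval puts (x, y] inside an open interval, to which the local derivative is
  -- restricted, and keeps both endpoints away from the freezing.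
  have i₁ := (h₁ (x - 1) (y + 1)).mono_set Ioo_subset_Ioc_self
  have i₂ := (h₂ (x - 1) (y + 1)).mono_set Ioo_subset_Ioc_self
  have key : localDeriv hbv (x - 1) (y + 1) - ((volume.restrict (Ioo (x - 1) (y + 1))).withDensityᵥ
      κ₁ + (ν.restrict (Ioo (x - 1) (y + 1))).withDensityᵥ κ₂) = 0 := by
    refine vectorMeasure_eq_zero_of_integral_eq_zero hβ hK hpos fun A hA => ?_
    rw [VectorMeasure.restrict_sub, VectorMeasure.integral_sub_vectorMeasure
      (integrable_bounded _ hβ hK) (integrable_bounded _ hβ hK),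
      vectorIntegral_withDensity_add i₁ i₂ hA hβ hK, localDeriv_restrict hbv _ _ hA,
      ← h (x - 1) (y + 1) (A ∩ Ioo (x - 1) (y + 1)) inter_subset_right (hA.inter measurableSet_Ioo),
      localDeriv_restrict hbv _ _ (hA.inter measurableSet_Ioo), inter_assoc, inter_self, sub_self]
  have hsub : Ioc x y ⊆ Ioo (x - 1) (y + 1) := fun t ht => ⟨by linarith [ht.1], by linarith [ht.2]⟩
  have h3 : localDeriv hbv (x - 1) (y + 1) (Ioc x y) = f.rightLim y - f.rightLim x := by
    rw [localDeriv, VectorMeasure.restrict_eq_self _ measurableSet_Ioo measurableSet_Ioc hsub,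
      BoundedVariationOn.vectorMeasure_Ioc _ hxy, rightLim_freeze hbv (by linarith) (by linarith),
      rightLim_freeze hbv (by linarith) (by linarith)]
  rw [← h3, sub_eq_zero.1 key, withDensity_add_apply i₁ i₂ measurableSet_Ioc,
    inter_eq_left.2 hsub]

end Increments

theorem measurable_of_boundedVariationOn {f : ℝ → ℝ} (hf : BoundedVariationOn f univ) :
    Measurable f := by
  obtain ⟨p, q, hp, hq, rfl⟩ := hf.locallyBoundedVariationOn.exists_monotoneOn_sub_monotoneOn
  exact (monotoneOn_univ.1 hp).measurable.sub (monotoneOn_univ.1 hq).measurable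

theorem exists_bound_of_boundedVariationOn {f : ℝ → ℝ} (hf : BoundedVariationOn f univ) :
    ∃ K, ∀ x, |f x| ≤ K := by
  refine ⟨|f 0| + (eVariationOn f univ).toReal, fun x => ?_⟩
  have h := hf.dist_le (mem_univ x) (mem_univ 0)
  rw [Real.dist_eq] at h
  linarith [abs_sub_abs_le_abs_sub (f x) (f 0)]

end MagneticSchrodinger

end

/-! ### The equation P(h)u = g in integrated form. -/

noncomputable section

namespace MagneticSchrodinger

open Filter Topology

section Bounded

variable {μ : Measure ℝ} {a : ℝ → ℝ} {f : ℝ → ℂ} {K : ℝ}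

theorem memLp_two_bounded_mul (ha : AEStronglyMeasurable a μ) (hK : ∀ x, |a x| ≤ K)
    (hf : MemLp f 2 μ) : MemLp (fun x => (a x : ℂ) * f x) 2 μ :=
  hf.of_le_mul (c := K) ((Complex.continuous_ofReal.comp_aestronglyMeasurable ha).mul hf.1)
    (Eventually.of_forall fun x => by
      rw [norm_mul, Complex.norm_real]
      exact mul_le_mul_of_nonneg_right (hK x) (norm_nonneg _))

theorem memLp_two_mul_bounded {v : ℝ → ℂ} (ha : MemLp a 2 μ) (hv : Continuous v)
    (hK : ∀ x, ‖v x‖ ≤ K) : MemLp (fun x => (a x : ℂ) * v x) 2 μ :=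
  ha.of_le_mul (c := K) ((Complex.continuous_ofReal.comp_aestronglyMeasurable ha.1).mul
    hv.aestronglyMeasurable) (Eventually.of_forall fun x => by
      rw [norm_mul, Complex.norm_real, mul_comm]
      exact mul_le_mul_of_nonneg_right (hK x) (norm_nonneg _))

end Bounded

theorem IsRep.exists_bound {u u' v : ℝ → ℂ} (hv : IsRep u u' v) (hu : MemLp u 2 volume)
    (hu' : MemLp u' 2 volume) : ∃ K, ∀ x, ‖v x‖ ≤ K :=
  ⟨_, fun x => Real.le_sqrt_of_sq_le (hv.norm_sq_le hu hu' one_pos x)⟩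

namespace Coefficients

variable (c : Coefficients)

/-- The total variation of the measure `V₀`. -/
def absV₀ : Measure ℝ := c.V₀.totalVariation

instance : IsFiniteMeasure c.absV₀ := by
  unfold absV₀ SignedMeasure.totalVariation
  infer_instance

/-- The sign of the measure `V₀`. -/
def signV₀ : ℝ → ℝ := (exists_sign_setIntegral_eq c.V₀).choose

theorem measurable_signV₀ : Measurable c.signV₀ := (exists_sign_setIntegral_eq c.V₀).choose_spec.1

theorem abs_signV₀ (x : ℝ) : |c.signV₀ x| = 1 :=
  (exists_sign_setIntegral_eq c.V₀).choose_spec.2.1 x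

theorem setIntegral_V₀ {u : ℝ → ℂ} (hu : Integrable u c.absV₀) {A : Set ℝ} (hA : MeasurableSet A) :
    ∫ᵛ x in A, u x ∂<•c.V₀ = ∫ x in A, (c.signV₀ x : ℂ) * u x ∂c.absV₀ :=
  (exists_sign_setIntegral_eq c.V₀).choose_spec.2.2 u A hA hu

theorem measurable_α : Measurable c.α := measurable_of_boundedVariationOn c.α_bv
theorem measurable_β : Measurable c.β := measurable_of_boundedVariationOn c.β_bv
theorem measurable_V₁ : Measurable c.V₁ := measurable_of_boundedVariationOn c.V₁_bv
theorem measurable_b₁ : Measurable c.b₁ := measurable_of_boundedVariationOn c.b₁_bv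

theorem β_pos (x : ℝ) : 0 < c.β x := by
  obtain ⟨m, hm, h⟩ := c.β_inf_pos
  exact hm.trans_le (h x)

theorem α_pos (x : ℝ) : 0 < c.α x := by
  obtain ⟨m, hm, h⟩ := c.α_inf_pos
  exact hm.trans_le (h x)

theorem exists_bound_inv_β : ∃ K, ∀ x, |(c.β x)⁻¹| ≤ K := by
  obtain ⟨m, hm, h⟩ := c.β_inf_pos
  refine ⟨m⁻¹, fun x => ?_⟩
  rw [abs_of_pos (inv_pos.2 (c.β_pos x))]
  exact inv_anti₀ hm (h x)

/-- The two parts of b use different properties of v: b₀ is square integrable and needs v bounded,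
while b₁ is bounded and needs v square integrable. -/
theorem memLp_b_mul {v : ℝ → ℂ} (hv : MemLp v 2 volume) (hc : Continuous v) {K : ℝ}
    (hK : ∀ x, ‖v x‖ ≤ K) : MemLp (fun x => (c.b x : ℂ) * v x) 2 volume := by
  obtain ⟨K₁, hK₁⟩ := exists_bound_of_boundedVariationOn c.b₁_bv
  have h1 := memLp_two_mul_bounded c.b₀_memLp_two hc hK
  have h2 := memLp_two_bounded_mul c.measurable_b₁.aestronglyMeasurable hK₁ hv
  refine (h1.add h2).ae_eq (Eventually.of_forall fun x => ?_)
  simp [Coefficients.b, add_mul]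

/-- The density of the absolutely continuous part of the measure `df` in `P(h) u = g`. -/
def density (h : ℝ) (v u' g : ℝ → ℂ) (x : ℝ) : ℂ :=
  (g x - c.V₁ x * v x) / c.β x + Complex.I * h * c.b x * u' x

/-- The density with respect to `|V₀|` of the remaining part of `df` in `P(h) u = g`. -/
def singularDensity (v : ℝ → ℂ) (x : ℝ) : ℂ := -(c.signV₀ x * v x / c.β x)

theorem integrable_bounded_mul_continuous {a : ℝ → ℝ} (ha : Measurable a) {K₁ K : ℝ}
    (hK₁ : ∀ x, |a x| ≤ K₁) {v : ℝ → ℂ} (hv : Continuous v) (hK : ∀ x, ‖v x‖ ≤ K) :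
    Integrable (fun x => (a x : ℂ) * v x) c.absV₀ :=
  Integrable.of_bound ((Complex.measurable_ofReal.comp ha).mul hv.measurable).aestronglyMeasurable
    (K₁ * K) (Eventually.of_forall fun x => by
      rw [norm_mul, Complex.norm_real]
      exact mul_le_mul (hK₁ x) (hK x) (norm_nonneg _) ((abs_nonneg _).trans (hK₁ x)))

theorem integrable_singularDensity {v : ℝ → ℂ} (hv : Continuous v) {K : ℝ} (hK : ∀ x, ‖v x‖ ≤ K) :
    Integrable (c.singularDensity v) c.absV₀ := by
  obtain ⟨Kβ, hKβ⟩ := c.exists_bound_inv_β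
  have h := c.integrable_bounded_mul_continuous (a := fun x => -(c.signV₀ x) * (c.β x)⁻¹)
    (c.measurable_signV₀.neg.mul c.measurable_β.inv) (K₁ := Kβ) (fun x => by
      rw [abs_mul, abs_neg, c.abs_signV₀, one_mul]; exact hKβ x) hv hK
  refine h.congr (Eventually.of_forall fun x => ?_)
  simp only [singularDensity]
  push_cast
  ring

/-- The density splits into a square integrable and an integrable part. -/
theorem exists_density_split {h : ℝ} {v u' g : ℝ → ℂ} (hv : MemLp v 2 volume)
    (hu' : MemLp u' 2 volume) (hg : MemLp g 2 volume) :
    ∃ d₁ d₂ : ℝ → ℂ, Integrable d₁ volume ∧ MemLp d₂ 2 volume ∧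
      ∀ x, c.density h v u' g x = d₁ x + d₂ x := by
  obtain ⟨Kβ, hKβ⟩ := c.exists_bound_inv_β
  obtain ⟨KV, hKV⟩ := exists_bound_of_boundedVariationOn c.V₁_bv
  obtain ⟨Kb, hKb⟩ := exists_bound_of_boundedVariationOn c.b₁_bv
  -- Only b₀u', a product of two square integrable functions, is merely integrable; the other terms
  -- are bounded multiples of square integrable functions.
  have e0 : MemLp (fun x => (c.b₀ x : ℂ)) 2 volume := c.b₀_memLp_two.ofReal
  have e1 : Integrable (fun x => (Complex.I * h) * ((c.b₀ x : ℂ) * u' x)) volume :=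
    (e0.integrable_mul hu').const_mul _
  have e2 := memLp_two_bounded_mul c.measurable_b₁.aestronglyMeasurable hKb hu'
  have e3 := hg.sub (memLp_two_bounded_mul c.measurable_V₁.aestronglyMeasurable hKV hv)
  have e4 := memLp_two_bounded_mul (a := fun x => (c.β x)⁻¹)
    c.measurable_β.inv.aestronglyMeasurable hKβ e3
  refine ⟨_, _, e1, e4.add (e2.const_mul (Complex.I * h)), fun x => ?_⟩
  simp only [density, b, Pi.add_apply, Pi.sub_apply]
  push_cast
  ring

theorem integrableOn_density {h : ℝ} {v u' g : ℝ → ℂ} (hv : MemLp v 2 volume)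
    (hu' : MemLp u' 2 volume) (hg : MemLp g 2 volume) (p q : ℝ) :
    IntegrableOn (c.density h v u' g) (Ioc p q) volume := by
  obtain ⟨d₁, d₂, h1, h2, hd⟩ := c.exists_density_split (h := h) hv hu' hg
  rw [show c.density h v u' g = d₁ + d₂ from funext hd]
  exact h1.integrableOn.add (integrableOn_Ioc_of_memLp_two h2 p q)

/-- The equation `P(h) u = g` in integrated form. -/
structure IsSolution (h : ℝ) (u g : L2) (u' v f : ℝ → ℂ) : Prop where
  memLp_deriv : MemLp u' 2 volume
  isRep : IsRep u u' v
  ae_eq : ∀ᵐ x, f x = -(h : ℂ) ^ 2 * c.α x * u' x - Complex.I * h * c.b x * v x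
  increments : HasIncrements c.absV₀ (c.density h v u' g) (c.singularDensity v) f

namespace IsSolution

variable {c} {h : ℝ} {u g : L2} {u' v f : ℝ → ℂ} (S : c.IsSolution h u g u' v f)
include S

theorem memLp_rep : MemLp v 2 volume := S.isRep.memLp (Lp.memLp u)

theorem exists_bound_rep : ∃ K, ∀ x, ‖v x‖ ≤ K := S.isRep.exists_bound (Lp.memLp u) S.memLp_deriv

theorem integrableOn_density (p q : ℝ) : IntegrableOn (c.density h v u' g) (Ioc p q) volume :=
  c.integrableOn_density S.memLp_rep S.memLp_deriv (Lp.memLp g) p q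

theorem integrable_singularDensity : Integrable (c.singularDensity v) c.absV₀ := by
  obtain ⟨K, hK⟩ := S.exists_bound_rep
  exact c.integrable_singularDensity S.isRep.continuous hK

theorem memLp : MemLp f 2 volume := by
  obtain ⟨K, hK⟩ := S.exists_bound_rep
  obtain ⟨Kα, hKα⟩ := exists_bound_of_boundedVariationOn c.α_bv
  have h1 := memLp_two_bounded_mul c.measurable_α.aestronglyMeasurable hKα S.memLp_deriv
  have h2 := c.memLp_b_mul S.memLp_rep S.isRep.continuous hK
  refine ((h1.const_mul (-(h : ℂ) ^ 2)).sub (h2.const_mul (Complex.I * h))).ae_eq ?_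
  filter_upwards [S.ae_eq] with x hx
  rw [hx]
  simp only [Pi.sub_apply]
  ring

/-- Increments of f over intervals of length at most one are uniformly bounded, since the density is
a sum of an L¹ and an L² function and the singular part is finite. As f is in L², every unit
interval contains a point where |f| is controlled. -/
theorem exists_bound : ∃ K, ∀ x, ‖f x‖ ≤ K := by
  obtain ⟨d₁, d₂, h1, h2, hd⟩ := c.exists_density_split (h := h) S.memLp_rep S.memLp_deriv
    (Lp.memLp g)
  have hs := S.integrable_singularDensity
  have i2 : Integrable (fun t => ‖d₂ t‖ ^ 2) := (memLp_two_iff_integrable_sq_norm h2.1).1 h2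
  have if2 : Integrable (fun t => ‖f t‖ ^ 2) := (memLp_two_iff_integrable_sq_norm S.memLp.1).1 S.memLp
  have hvol : ∀ x y : ℝ, x ≤ y → y ≤ x + 1 → ‖f y - f x‖ ≤ (∫ t, ‖d₁ t‖) + (1 + ∫ t, ‖d₂ t‖ ^ 2)
      + ∫ t, ‖c.singularDensity v t‖ ∂c.absV₀ := by
    intro x y hxy hyx
    rw [S.increments x y hxy]
    refine (norm_add_le _ _).trans (add_le_add ?_ ?_)
    · have h2' := integrableOn_Ioc_of_memLp_two h2 x y
      rw [setIntegral_congr_fun measurableSet_Ioc (fun t _ => hd t),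
        integral_add h1.integrableOn h2']
      refine (norm_add_le _ _).trans (add_le_add ?_ ?_)
      · exact (norm_integral_le_integral_norm _).trans
          (setIntegral_le_integral h1.norm (Eventually.of_forall fun _ => norm_nonneg _))
      · refine (norm_integral_le_integral_norm _).trans ?_
        calc ∫ t in Ioc x y, ‖d₂ t‖ ≤ ∫ t in Ioc x y, (1 + ‖d₂ t‖ ^ 2) := by
              refine integral_mono h2'.norm (Integrable.add (by simp) i2.integrableOn) fun t => ?_
              simp only
              nlinarith [sq_nonneg (‖d₂ t‖ - 1)]
          _ ≤ 1 + ∫ t, ‖d₂ t‖ ^ 2 := by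
              rw [integral_add (by simp) i2.integrableOn]
              refine add_le_add ?_
                (setIntegral_le_integral i2 (Eventually.of_forall fun _ => by positivity))
              rw [setIntegral_const, smul_eq_mul, mul_one, measureReal_def, Real.volume_Ioc,
                ENNReal.toReal_ofReal (by linarith)]
              linarith
    · exact (norm_integral_le_integral_norm _).trans
        (setIntegral_le_integral hs.norm (Eventually.of_forall fun _ => norm_nonneg _))
  have hpt : ∀ x : ℝ, ∃ y, x ≤ y ∧ y ≤ x + 1 ∧ ‖f y‖ ^ 2 ≤ (∫ t, ‖f t‖ ^ 2) + 1 := by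
    intro x
    by_contra! hcon
    have e1 : ∫ t in Ioc x (x + 1), ((∫ t, ‖f t‖ ^ 2) + 1) ≤ ∫ t in Ioc x (x + 1), ‖f t‖ ^ 2 :=
      setIntegral_mono_on (by simp) if2.integrableOn measurableSet_Ioc
        fun t ht => (hcon t ht.1.le ht.2).le
    have e2 : ∫ t in Ioc x (x + 1), ‖f t‖ ^ 2 ≤ ∫ t, ‖f t‖ ^ 2 :=
      setIntegral_le_integral if2 (Eventually.of_forall fun _ => by positivity)
    rw [setIntegral_const, measureReal_def, Real.volume_Ioc] at e1
    simp only [add_sub_cancel_left, ENNReal.ofReal_one, ENNReal.toReal_one, one_smul] at e1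
    linarith
  refine ⟨Real.sqrt ((∫ t, ‖f t‖ ^ 2) + 1) + ((∫ t, ‖d₁ t‖) + (1 + ∫ t, ‖d₂ t‖ ^ 2)
      + ∫ t, ‖c.singularDensity v t‖ ∂c.absV₀), fun x => ?_⟩
  obtain ⟨y, hxy, hyx, hy⟩ := hpt x
  have e3 := hvol x y hxy hyx
  have e4 : ‖f y‖ ≤ Real.sqrt ((∫ t, ‖f t‖ ^ 2) + 1) := Real.le_sqrt_of_sq_le hy
  have e5 : ‖f x‖ ≤ ‖f y‖ + ‖f y - f x‖ := by
    have := norm_sub_le (f y) (f y - f x)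
    rwa [sub_sub_cancel] at this
  exact e5.trans (add_le_add e4 e3)

end IsSolution

theorem mul_densities (h : ℝ) (v u' g : ℝ → ℂ) (x : ℝ) :
    (c.β x : ℂ) * c.density h v u' g x
      = g x - (h * c.β x * c.b x * (-Complex.I * u' x)) - c.V₁ x * v x ∧
    (c.β x : ℂ) * c.singularDensity v x = -(c.signV₀ x * v x) := by
  have hβ : (c.β x : ℂ) ≠ 0 := by exact_mod_cast (c.β_pos x).ne'
  constructor
  · simp only [density]; field_simp; ring
  · simp only [singularDensity]; field_simp

/-- The term-by-term form of the equation of measures in `IsImage`. -/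
theorem measure_equation {h : ℝ} {v u' : ℝ → ℂ} {g : L2} (hv : MemLp v 2 volume)
    (hu' : MemLp u' 2 volume) (hc : Continuous v) {K : ℝ} (hK : ∀ x, ‖v x‖ ≤ K) {p q : ℝ}
    {A : Set ℝ} (hApq : A ⊆ Ioo p q) (hA : MeasurableSet A) (J : ℂ) :
    (J + (∫ x in A, (h : ℂ) * c.β x * c.b x * (-Complex.I * u' x))
        + (∫ᵛ x in A, v x ∂<•c.V₀) + (∫ x in A, (c.V₁ x : ℂ) * v x) = ∫ x in A, g x) ↔
      J = (∫ x in A, (c.β x : ℂ) * c.density h v u' g x)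
        + ∫ x in A, (c.β x : ℂ) * c.singularDensity v x ∂c.absV₀ := by
  obtain ⟨KV, hKV⟩ := exists_bound_of_boundedVariationOn c.V₁_bv
  obtain ⟨Kβ, hKβ⟩ := exists_bound_of_boundedVariationOn c.β_bv
  have hsub : A ⊆ Ioc p q := hApq.trans Ioo_subset_Ioc_self
  have i1 : IntegrableOn (fun x => g x) A volume :=
    (integrableOn_Ioc_of_memLp_two (Lp.memLp g) p q).mono_set hsub
  have i2 : IntegrableOn (fun x => (c.V₁ x : ℂ) * v x) A volume := (integrableOn_Ioc_of_memLp_two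
    (memLp_two_bounded_mul c.measurable_V₁.aestronglyMeasurable hKV hv) p q).mono_set hsub
  have i3 : IntegrableOn (fun x => (c.β x : ℂ) * c.density h v u' g x) A volume := by
    refine Integrable.bdd_mul (c := Kβ)
      ((c.integrableOn_density hv hu' (Lp.memLp g) p q).mono_set hsub)
      (Complex.measurable_ofReal.comp c.measurable_β).aestronglyMeasurable
      (Eventually.of_forall fun x => by simpa using hKβ x)
  have i4 : IntegrableOn (fun x => (h : ℂ) * c.β x * c.b x * (-Complex.I * u' x)) A volume := by
    refine IntegrableOn.congr_fun ((i1.sub i2).sub i3) (fun x _ => ?_) hA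
    simp only [Pi.sub_apply, (c.mul_densities h v u' g x).1]
    ring
  have iv : Integrable v c.absV₀ := Integrable.of_bound hc.aestronglyMeasurable K
    (Eventually.of_forall hK)
  have e1 : ∫ x in A, (c.β x : ℂ) * c.density h v u' g x = (∫ x in A, g x)
      - (∫ x in A, (h : ℂ) * c.β x * c.b x * (-Complex.I * u' x))
      - ∫ x in A, (c.V₁ x : ℂ) * v x := by
    rw [← integral_sub i1 i4, ← integral_sub (i1.fun_sub i4) i2]
    exact integral_congr_ae (Eventually.of_forall fun x => (c.mul_densities h v u' g x).1)
  have e2 : ∫ x in A, (c.β x : ℂ) * c.singularDensity v x ∂c.absV₀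
      = -∫ᵛ x in A, v x ∂<•c.V₀ := by
    rw [c.setIntegral_V₀ iv hA, ← integral_neg]
    exact integral_congr_ae (Eventually.of_forall fun x => (c.mul_densities h v u' g x).2)
  rw [e1, e2]
  constructor <;> intro H <;> linear_combination H

variable {c}

theorem IsSolution.isImage {h : ℝ} {u g : L2} {u' v f : ℝ → ℂ} (S : c.IsSolution h u g u' v f)
    (hw : HasWeakDeriv u u') : c.IsImage h u g := by
  obtain ⟨Kβ, hKβ⟩ := exists_bound_of_boundedVariationOn c.β_bv
  obtain ⟨K, hK⟩ := S.exists_bound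
  obtain ⟨Kv, hKv⟩ := S.exists_bound_rep
  have i₂ : ∀ p q, IntegrableOn (c.singularDensity v) (Ioc p q) c.absV₀ := fun p q =>
    S.integrable_singularDensity.integrableOn
  have hbv := S.increments.locallyBoundedVariationOn S.integrableOn_density i₂
  refine ⟨u', v, f, hbv, S.memLp_deriv, hw, S.isRep.continuous, S.isRep.ae_eq,
    ⟨K, Eventually.of_forall hK⟩, ?_, fun p q A hApq hA => ?_⟩
  · filter_upwards [S.ae_eq, S.isRep.ae_eq] with x hx hx'
    rw [hx, hx']
  · rw [c.measure_equation S.memLp_rep S.memLp_deriv S.isRep.continuous hKv hApq hA]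
    exact S.increments.integral_localDeriv S.integrableOn_density i₂ hbv hA hApq c.measurable_β hKβ

/-- The flux f is replaced by its right limits. They agree with f almost everywhere, because a
function of locally bounded variation is almost everywhere differentiable, and their increments are
the masses of df. -/
theorem IsImage.exists_isSolution {h : ℝ} {u g : L2} (H : c.IsImage h u g) :
    ∃ u' v f : ℝ → ℂ, HasWeakDeriv u u' ∧ c.IsSolution h u g u' v f := by
  obtain ⟨Kβ, hKβ⟩ := exists_bound_of_boundedVariationOn c.β_bv
  obtain ⟨u', v, f, hbv, hu', hw, hv, hvu, -, hfe, heq⟩ := H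
  obtain ⟨v', hv'⟩ := hw.exists_isRep (Lp.memLp u) hu'
  obtain rfl := hv'.unique hv hvu
  obtain ⟨Kv, hKv⟩ := hv'.exists_bound (Lp.memLp u) hu'
  have hv2 := hv'.memLp (Lp.memLp u)
  refine ⟨u', v, f.rightLim, hw, hu', hv', ?_, ?_⟩
  · filter_upwards [hfe, rightLim_ae_eq hbv, hvu] with x h1 h2 h3
    rw [h2, h1, h3]
  · refine hasIncrements_rightLim hbv (c.integrableOn_density hv2 hu' (Lp.memLp g))
      (fun p q => (c.integrable_singularDensity hv hKv).integrableOn) c.measurable_β hKβ c.β_pos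
      fun p q A hApq hA => ?_
    exact (c.measure_equation hv2 hu' hv hKv hApq hA _).1 (heq p q A hApq hA)

end Coefficients

end MagneticSchrodinger

end

/-! ### Multiplication operators, the Hilbert space H¹ and the Lax-Milgram theorem. -/

noncomputable section

namespace MagneticSchrodinger

open Filter Topology

section L2Operators

variable {μ : Measure ℝ}

theorem L2_inner_eq (f g : Lp ℂ 2 μ) : inner ℂ f g = ∫ x, (starRingEnd ℂ) (f x) * g x ∂μ := by
  rw [L2.inner_def]
  exact integral_congr_ae (Eventually.of_forall fun x => by simp [RCLike.inner_apply, mul_comm])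

theorem L2_norm_sq_eq (f : Lp ℂ 2 μ) : ‖f‖ ^ 2 = ∫ x, ‖f x‖ ^ 2 ∂μ := by
  have h : ((‖f‖ ^ 2 : ℝ) : ℂ) = ((∫ x, ‖f x‖ ^ 2 ∂μ : ℝ) : ℂ) := by
    rw [← integral_complex_ofReal]
    have h1 := inner_self_eq_norm_sq_to_K (𝕜 := ℂ) f
    rw [L2_inner_eq] at h1
    push_cast
    refine h1.symm.trans (integral_congr_ae (Eventually.of_forall fun x => ?_))
    simp only [Complex.conj_mul']
  exact_mod_cast h

/-- Multiplication by a bounded measurable real function, as an operator on `L²`. -/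
def mulOp {a : ℝ → ℝ} (ha : AEStronglyMeasurable a μ) {K : ℝ} (hK : ∀ x, |a x| ≤ K) :
    Lp ℂ 2 μ →L[ℂ] Lp ℂ 2 μ :=
  LinearMap.mkContinuous
    { toFun := fun f => (memLp_two_bounded_mul ha hK (Lp.memLp f)).toLp _
      map_add' := fun f g => by
        rw [← MemLp.toLp_add]
        refine MemLp.toLp_congr _ _ ?_
        filter_upwards [Lp.coeFn_add f g] with x hx
        rw [hx, Pi.add_apply, Pi.add_apply, mul_add]
      map_smul' := fun z f => by
        rw [RingHom.id_apply, ← MemLp.toLp_const_smul]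
        refine MemLp.toLp_congr _ _ ?_
        filter_upwards [Lp.coeFn_smul z f] with x hx
        rw [hx, Pi.smul_apply, Pi.smul_apply, smul_eq_mul, smul_eq_mul, mul_left_comm] }
    K fun f => by
      refine Lp.norm_le_mul_norm_of_ae_le_mul ?_
      filter_upwards [(memLp_two_bounded_mul ha hK (Lp.memLp f)).coeFn_toLp] with x hx
      simp only [LinearMap.coe_mk, AddHom.coe_mk, hx, norm_mul, Complex.norm_real]
      exact mul_le_mul_of_nonneg_right (hK x) (norm_nonneg _)

theorem mulOp_coeFn {a : ℝ → ℝ} (ha : AEStronglyMeasurable a μ) {K : ℝ} (hK : ∀ x, |a x| ≤ K)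
    (f : Lp ℂ 2 μ) : mulOp ha hK f =ᵐ[μ] fun x => (a x : ℂ) * f x :=
  (memLp_two_bounded_mul ha hK (Lp.memLp f)).coeFn_toLp

end L2Operators

section Sobolev

/-- The pair `(φ', φ)` for a test function `φ`. -/
def testPair (φ : {φ : ℝ → ℝ // ContDiff ℝ ∞ φ ∧ HasCompactSupport φ}) : WithLp 2 (L2 × L2) :=
  WithLp.toLp 2
    (MemLp.toLp (fun x => ((deriv φ.1 x : ℝ) : ℂ))
      ((Complex.continuous_ofReal.comp (φ.2.1.continuous_deriv (by simp))).memLp_of_hasCompactSupport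
        (φ.2.2.deriv.comp_left Complex.ofReal_zero)),
    MemLp.toLp (fun x => ((φ.1 x : ℝ) : ℂ))
      ((Complex.continuous_ofReal.comp φ.2.1.continuous).memLp_of_hasCompactSupport
        (φ.2.2.comp_left Complex.ofReal_zero)))

/-- The Sobolev space `H¹(ℝ)`, as the space of pairs `(u, u')`. -/
def H1 : Submodule ℂ (WithLp 2 (L2 × L2)) :=
  ⨅ φ, (innerSL ℂ (testPair φ)).ker

theorem inner_testPair (φ : {φ : ℝ → ℝ // ContDiff ℝ ∞ φ ∧ HasCompactSupport φ})
    (p : WithLp 2 (L2 × L2)) : inner ℂ (testPair φ) p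
      = (∫ x, ((deriv φ.1 x : ℝ) : ℂ) * p.fst x) + ∫ x, ((φ.1 x : ℝ) : ℂ) * p.snd x := by
  rw [WithLp.prod_inner_apply, L2_inner_eq, L2_inner_eq]
  congr 1
  · refine integral_congr_ae ?_
    filter_upwards [MemLp.coeFn_toLp (f := fun x => ((deriv φ.1 x : ℝ) : ℂ))
      ((Complex.continuous_ofReal.comp (φ.2.1.continuous_deriv (by simp))).memLp_of_hasCompactSupport
        (φ.2.2.deriv.comp_left Complex.ofReal_zero))] with x hx
    simp only [testPair, WithLp.ofLp_toLp] at hx ⊢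
    rw [hx, Complex.conj_ofReal]
    rfl
  · refine integral_congr_ae ?_
    filter_upwards [MemLp.coeFn_toLp (f := fun x => ((φ.1 x : ℝ) : ℂ))
      ((Complex.continuous_ofReal.comp φ.2.1.continuous).memLp_of_hasCompactSupport
        (φ.2.2.comp_left Complex.ofReal_zero))] with x hx
    simp only [testPair, WithLp.ofLp_toLp] at hx ⊢
    rw [hx, Complex.conj_ofReal]
    rfl

theorem mem_H1_iff {p : WithLp 2 (L2 × L2)} : p ∈ H1 ↔ HasWeakDeriv p.fst p.snd := by
  simp only [H1, Submodule.mem_iInf, LinearMap.mem_ker, HasWeakDeriv]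
  constructor
  · intro h φ h1 h2
    have := h ⟨φ, h1, h2⟩
    rw [ContinuousLinearMap.coe_coe, innerSL_apply_apply, inner_testPair] at this
    exact eq_neg_of_add_eq_zero_left this
  · intro h φ
    rw [ContinuousLinearMap.coe_coe, innerSL_apply_apply, inner_testPair, h φ.1 φ.2.1 φ.2.2,
      neg_add_cancel]

instance : CompleteSpace H1 := by
  have h : IsClosed (H1 : Set (WithLp 2 (L2 × L2))) := by
    rw [H1, Submodule.coe_iInf]
    exact isClosed_iInter fun φ => (innerSL ℂ (testPair φ)).isClosed_ker
  exact h.completeSpace_coe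

namespace H1

/-- The embedding `H¹ → L²`. -/
def toL2 : H1 →L[ℂ] L2 := (WithLp.fstL 2 ℂ L2 L2).comp H1.subtypeL

/-- The weak derivative `H¹ → L²`. -/
def derivL2 : H1 →L[ℂ] L2 := (WithLp.sndL 2 ℂ L2 L2).comp H1.subtypeL

theorem hasWeakDeriv (U : H1) : HasWeakDeriv (toL2 U) (derivL2 U) := mem_H1_iff.1 U.2

theorem norm_sq (U : H1) : ‖U‖ ^ 2 = ‖toL2 U‖ ^ 2 + ‖derivL2 U‖ ^ 2 :=
  WithLp.prod_norm_sq_eq_of_L2 (U : WithLp 2 (L2 × L2))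

/-- The continuous representative of an element of `H¹`. -/
def rep (U : H1) : ℝ → ℂ :=
  ((hasWeakDeriv U).exists_isRep (Lp.memLp _) (Lp.memLp _)).choose

theorem isRep (U : H1) : IsRep (toL2 U) (derivL2 U) (rep U) :=
  ((hasWeakDeriv U).exists_isRep (Lp.memLp _) (Lp.memLp _)).choose_spec

theorem rep_eq {U : H1} {w : ℝ → ℂ} (hw : Continuous w) (h : w =ᵐ[volume] toL2 U) : rep U = w :=
  ((isRep U).unique hw h).symm

theorem rep_add (U W : H1) : rep (U + W) = rep U + rep W := by
  refine rep_eq ((isRep U).continuous.add (isRep W).continuous) ?_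
  rw [map_add]
  filter_upwards [Lp.coeFn_add (toL2 U) (toL2 W), (isRep U).ae_eq, (isRep W).ae_eq] with x h1 h2 h3
  rw [h1, Pi.add_apply, Pi.add_apply, h2, h3]

theorem rep_smul (z : ℂ) (U : H1) : rep (z • U) = z • rep U := by
  refine rep_eq ((isRep U).continuous.const_smul z) ?_
  rw [map_smul]
  filter_upwards [Lp.coeFn_smul z (toL2 U), (isRep U).ae_eq] with x h1 h2
  rw [h1, Pi.smul_apply, Pi.smul_apply, h2]

theorem norm_rep_sq_le (U : H1) {δ : ℝ} (hδ : 0 < δ) (x : ℝ) :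
    ‖rep U x‖ ^ 2 ≤ δ * ‖derivL2 U‖ ^ 2 + δ⁻¹ * ‖toL2 U‖ ^ 2 := by
  rw [L2_norm_sq_eq, L2_norm_sq_eq]
  exact (isRep U).norm_sq_le (Lp.memLp _) (Lp.memLp _) hδ x

theorem norm_rep_le (U : H1) (x : ℝ) : ‖rep U x‖ ≤ ‖U‖ := by
  refine (sq_le_sq₀ (norm_nonneg _) (norm_nonneg _)).1 ?_
  have := norm_rep_sq_le U one_pos x
  rw [norm_sq]
  linarith

variable {μ : Measure ℝ}

/-- The operator `u ↦ k u` from `H¹` to `L²(μ)` for a multiplier `k ∈ L²(μ)`. -/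
def mulRep {k : ℝ → ℝ} (hk : MemLp k 2 μ) : H1 →L[ℂ] Lp ℂ 2 μ :=
  LinearMap.mkContinuous
    { toFun := fun U =>
        (memLp_two_mul_bounded hk (isRep U).continuous (norm_rep_le U)).toLp _
      map_add' := fun U W => by
        rw [← MemLp.toLp_add]
        refine MemLp.toLp_congr _ _ (Eventually.of_forall fun x => ?_)
        simp [rep_add, mul_add]
      map_smul' := fun z U => by
        rw [RingHom.id_apply, ← MemLp.toLp_const_smul]
        refine MemLp.toLp_congr _ _ (Eventually.of_forall fun x => ?_)
        simp [rep_smul, mul_left_comm] }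
    ‖hk.toLp k‖ fun U => by
      rw [mul_comm]
      refine Lp.norm_le_mul_norm_of_ae_le_mul ?_
      filter_upwards [(memLp_two_mul_bounded hk (isRep U).continuous (norm_rep_le U)).coeFn_toLp,
        hk.coeFn_toLp] with x hx hx'
      simp only [LinearMap.coe_mk, AddHom.coe_mk, hx, hx', norm_mul, Complex.norm_real]
      rw [mul_comm]
      exact mul_le_mul_of_nonneg_right (norm_rep_le U x) (norm_nonneg _)

theorem mulRep_coeFn {k : ℝ → ℝ} (hk : MemLp k 2 μ) (U : H1) :
    mulRep hk U =ᵐ[μ] fun x => (k x : ℂ) * rep U x :=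
  (memLp_two_mul_bounded hk (isRep U).continuous (norm_rep_le U)).coeFn_toLp

/-- The supremum of u is kept instead of the H¹ norm, because it can be bounded with an arbitrarily
small share of ‖u'‖. -/
theorem norm_mulRep_le {k : ℝ → ℝ} (hk : MemLp k 2 μ) (U : H1) {s : ℝ}
    (hs : ∀ x, ‖rep U x‖ ≤ s) : ‖mulRep hk U‖ ≤ s * ‖hk.toLp k‖ := by
  refine Lp.norm_le_mul_norm_of_ae_le_mul ?_
  filter_upwards [mulRep_coeFn hk U, hk.coeFn_toLp] with x hx hx'
  rw [hx, hx', norm_mul, Complex.norm_real, mul_comm]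
  exact mul_le_mul_of_nonneg_right (hs x) (norm_nonneg _)

theorem exists_of_hasWeakDeriv {u : L2} {u' : ℝ → ℂ} (hu' : MemLp u' 2 volume)
    (h : HasWeakDeriv u u') : ∃ U : H1, toL2 U = u ∧ derivL2 U =ᵐ[volume] u' := by
  refine ⟨⟨WithLp.toLp 2 (u, hu'.toLp u'), mem_H1_iff.2 fun φ h1 h2 => ?_⟩, rfl, hu'.coeFn_toLp⟩
  refine (h φ h1 h2).trans ?_
  congr 1
  refine integral_congr_ae ?_
  filter_upwards [hu'.coeFn_toLp] with x hx
  exact congrArg _ hx.symm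

theorem exists_of_testFunction {φ : ℝ → ℝ} (hφ : ContDiff ℝ ∞ φ) (hs : HasCompactSupport φ) :
    ∃ U : H1, (rep U = fun x => (φ x : ℂ)) ∧
      derivL2 U =ᵐ[volume] fun x => ((deriv φ x : ℝ) : ℂ) := by
  have hc : Continuous fun x => ((φ x : ℝ) : ℂ) := Complex.continuous_ofReal.comp hφ.continuous
  have hm : MemLp (fun x => ((φ x : ℝ) : ℂ)) 2 volume :=
    hc.memLp_of_hasCompactSupport (hs.comp_left Complex.ofReal_zero)
  have hd : Continuous fun x => ((deriv φ x : ℝ) : ℂ) :=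
    Complex.continuous_ofReal.comp (hφ.continuous_deriv (by simp))
  have hm' : MemLp (fun x => ((deriv φ x : ℝ) : ℂ)) 2 volume :=
    hd.memLp_of_hasCompactSupport (hs.deriv.comp_left Complex.ofReal_zero)
  obtain ⟨U, h1, h2⟩ := exists_of_hasWeakDeriv (u := hm.toLp _) hm' fun ψ hψ hψs => by
    have h := integral_deriv_mul_of_increments (ν := 0) (κ₂ := 0)
      (integrableOn_Ioc_of_memLp_two hm') (fun _ _ => integrableOn_zero)
      (fun x y hxy => by simpa using deriv_increments hφ hxy) hψ hψs
    simp only [integral_zero_measure, add_zero] at h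
    have e : ∫ x, ((deriv ψ x : ℝ) : ℂ) * hm.toLp _ x = ∫ x, ((deriv ψ x : ℝ) : ℂ) * (φ x : ℂ) :=
      integral_congr_ae (by filter_upwards [hm.coeFn_toLp] with x hx; rw [hx])
    rw [e, h]
    simp_rw [mul_comm]
  refine ⟨U, rep_eq hc ?_, h2⟩
  rw [h1]
  exact hm.coeFn_toLp.symm

end H1

end Sobolev

/-- The Lax-Milgram theorem for a bounded operator whose quadratic form is bounded below in absolute
value. -/
theorem exists_equiv_of_coercive {H : Type*} [NormedAddCommGroup H] [InnerProductSpace ℂ H]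
    [CompleteSpace H] (A : H →L[ℂ] H) {κ : ℝ} (hκ : 0 < κ)
    (h : ∀ u, κ * ‖u‖ ^ 2 ≤ ‖inner ℂ u (A u)‖) : ∃ e : H ≃L[ℂ] H, ∀ u, e u = A u := by
  have hb : ∀ u, κ * ‖u‖ ≤ ‖A u‖ := fun u => by
    rcases eq_or_ne u 0 with rfl | hu
    · simp
    · have h1 : 0 < ‖u‖ := norm_pos_iff.2 hu
      have h2 := (h u).trans (norm_inner_le_norm u (A u))
      nlinarith
  have hanti : AntilipschitzWith (κ⁻¹).toNNReal A := by
    refine ContinuousLinearMap.antilipschitz_of_bound A fun x => ?_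
    rw [Real.coe_toNNReal _ (inv_pos.2 hκ).le, inv_mul_eq_div, le_div_iff₀ hκ, mul_comm]
    exact hb x
  have hker : A.ker = ⊥ := LinearMap.ker_eq_bot.2 hanti.injective
  have hclosed : IsClosed (A.range : Set H) := hanti.isClosed_range A.uniformContinuous
  have hrange : A.range = ⊤ := by
    have := hclosed.completeSpace_coe
    -- The range is closed, so it suffices that its orthogonal complement is trivial: a vector w in
    -- it is orthogonal to Aw, and coercivity gives w = 0.
    rw [← A.range.orthogonal_orthogonal, Submodule.eq_top_iff']
    intro v w hw
    have h0 : inner ℂ (A w) w = 0 := hw _ ⟨w, rfl⟩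
    have h1 := h w
    rw [← inner_conj_symm, h0, map_zero, norm_zero] at h1
    have h2 : ‖w‖ ^ 2 = 0 := le_antisymm (by nlinarith) (by positivity)
    have h3 : w = 0 := by simpa using h2
    rw [h3, inner_zero_left]
  exact ⟨ContinuousLinearEquiv.ofBijective A hker hrange, fun u => rfl⟩

end MagneticSchrodinger

end

/-! ### The weak formulation of the equation on H¹. -/

noncomputable section

namespace MagneticSchrodinger

open Filter Topology

open scoped InnerProduct

theorem exists_hasIncrements {ν : Measure ℝ} {κ₁ κ₂ : ℝ → ℂ}
    (h₁ : ∀ p q, IntegrableOn κ₁ (Ioc p q) volume) (h₂ : ∀ p q, IntegrableOn κ₂ (Ioc p q) ν) :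
    ∃ N, HasIncrements ν κ₁ κ₂ N := by
  refine ⟨fun x => (∫ t in (0)..x, κ₁ t) + ∫ t in (0)..x, κ₂ t ∂ν, fun x y hxy => ?_⟩
  rw [add_sub_add_comm, intervalIntegral.integral_interval_sub_left ⟨h₁ _ _, h₁ _ _⟩ ⟨h₁ _ _, h₁ _ _⟩,
    intervalIntegral.integral_interval_sub_left ⟨h₂ _ _, h₂ _ _⟩ ⟨h₂ _ _, h₂ _ _⟩,
    intervalIntegral.integral_of_le hxy, intervalIntegral.integral_of_le hxy]

/-- Integration by parts against φ(y) = y, with ψ = 1, includes the integrability of ψN = N. -/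
theorem HasIncrements.locallyIntegrable {ν : Measure ℝ} [SFinite ν] {κ₁ κ₂ N : ℝ → ℂ}
    (hN : HasIncrements ν κ₁ κ₂ N)
    (h₁ : ∀ p q, IntegrableOn κ₁ (Ioc p q) volume) (h₂ : ∀ p q, IntegrableOn κ₂ (Ioc p q) ν) :
    LocallyIntegrable N volume := by
  intro x
  refine ⟨Ioc (x - 1) (x + 1), Ioc_mem_nhds (by linarith) (by linarith), ?_⟩
  have h := (integral_parts (N := N) (ψ := fun _ => 1) (φ := fun y : ℝ => (y : ℂ))
    (show x - 1 ≤ x + 1 by linarith) (h₁ _ _) (h₂ _ _) (by simp) (fun a _ b _ hab => by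
      rw [setIntegral_const, measureReal_def, Real.volume_Ioc,
        ENNReal.toReal_ofReal (sub_nonneg.2 hab)]
      simp) (fun a _ b _ hab => hN a b hab)).1
  simpa using h

namespace Coefficients

variable (c : Coefficients)

theorem exists_bound_V₁_div_β : ∃ K, ∀ x, |c.V₁ x * (c.β x)⁻¹| ≤ K := by
  obtain ⟨K₁, h₁⟩ := c.exists_bound_inv_β
  obtain ⟨K₂, h₂⟩ := exists_bound_of_boundedVariationOn c.V₁_bv
  refine ⟨K₂ * K₁, fun x => ?_⟩
  rw [abs_mul]
  exact mul_le_mul (h₂ x) (h₁ x) (abs_nonneg _) ((abs_nonneg _).trans (h₂ x))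

/-- Multiplication by `α`. -/
def mulα : L2 →L[ℂ] L2 := mulOp c.measurable_α.aestronglyMeasurable
  (exists_bound_of_boundedVariationOn c.α_bv).choose_spec

/-- Multiplication by `β⁻¹`. -/
def mulInvβ : L2 →L[ℂ] L2 := mulOp c.measurable_β.inv.aestronglyMeasurable
  c.exists_bound_inv_β.choose_spec

/-- Multiplication by `V₁ β⁻¹`. -/
def mulV₁ : L2 →L[ℂ] L2 :=
  mulOp (c.measurable_V₁.mul c.measurable_β.inv).aestronglyMeasurable
    c.exists_bound_V₁_div_β.choose_spec

/-- Multiplication by `b₁`. -/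
def mulb₁ : L2 →L[ℂ] L2 := mulOp c.measurable_b₁.aestronglyMeasurable
  (exists_bound_of_boundedVariationOn c.b₁_bv).choose_spec

/-- The operator `u ↦ b u` from `H¹` to `L²`. -/
def mulb : H1 →L[ℂ] L2 := H1.mulRep c.b₀_memLp_two + c.mulb₁ ∘L H1.toL2

theorem memLp_sign_div : MemLp (fun x => c.signV₀ x * (c.β x)⁻¹) 2 c.absV₀ := by
  obtain ⟨K, hK⟩ := c.exists_bound_inv_β
  refine MemLp.of_bound (c.measurable_signV₀.mul c.measurable_β.inv).aestronglyMeasurable K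
    (Eventually.of_forall fun x => ?_)
  rw [Real.norm_eq_abs, abs_mul, c.abs_signV₀, one_mul]
  exact hK x

/-- The restriction map `H¹ → L²(|V₀|)`. -/
def trace : H1 →L[ℂ] Lp ℂ 2 c.absV₀ := H1.mulRep (memLp_const (1 : ℝ))

/-- The operator `u ↦ (sign V₀) β⁻¹ u` from `H¹` to `L²(|V₀|)`. -/
def mulSign : H1 →L[ℂ] Lp ℂ 2 c.absV₀ := H1.mulRep c.memLp_sign_div

/-- The operator on `H¹` representing the quadratic form of `P(h)` in `L²(β⁻¹ dx)`. -/
def formOp (h : ℝ) : H1 →L[ℂ] H1 :=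
  -- The weight β⁻¹ of the inner product cancels the factor β in the differential terms; only the
  -- potentials retain β⁻¹.
  (H1.derivL2)† ∘L ((h : ℂ) ^ 2 • (c.mulα ∘L H1.derivL2) + (Complex.I * h) • c.mulb)
    - (Complex.I * h) • ((c.mulb)† ∘L H1.derivL2)
    + (H1.toL2)† ∘L c.mulV₁ ∘L H1.toL2 + (c.trace)† ∘L c.mulSign

theorem inner_formOp (h : ℝ) (Φ U : H1) : inner ℂ Φ (c.formOp h U)
    = (h : ℂ) ^ 2 * inner ℂ (H1.derivL2 Φ) (c.mulα (H1.derivL2 U))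
      + Complex.I * h * inner ℂ (H1.derivL2 Φ) (c.mulb U)
      - Complex.I * h * inner ℂ (c.mulb Φ) (H1.derivL2 U)
      + inner ℂ (H1.toL2 Φ) (c.mulV₁ (H1.toL2 U)) + inner ℂ (c.trace Φ) (c.mulSign U) := by
  have e : inner ℂ Φ ((Complex.I * h) • ContinuousLinearMap.adjoint c.mulb (H1.derivL2 U))
      = Complex.I * h * inner ℂ (c.mulb Φ) (H1.derivL2 U) :=
    (inner_smul_right (𝕜 := ℂ) (E := H1) _ _ _).trans
      (by rw [ContinuousLinearMap.adjoint_inner_right])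
  simp only [formOp, _root_.add_apply, _root_.sub_apply, _root_.smul_apply,
    ContinuousLinearMap.comp_apply, inner_add_right, inner_sub_right,
    ContinuousLinearMap.adjoint_inner_right, inner_smul_right]
  rw [e]

theorem mulb_coeFn (U : H1) : c.mulb U =ᵐ[volume] fun x => (c.b x : ℂ) * H1.rep U x := by
  have h := Lp.coeFn_add (H1.mulRep c.b₀_memLp_two U) (c.mulb₁ (H1.toL2 U))
  filter_upwards [h, H1.mulRep_coeFn c.b₀_memLp_two U, mulOp_coeFn
    c.measurable_b₁.aestronglyMeasurable (exists_bound_of_boundedVariationOn c.b₁_bv).choose_spec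
    (H1.toL2 U), (H1.isRep U).ae_eq] with x h1 h2 h3 h4
  have h5 : c.mulb U x = (H1.mulRep c.b₀_memLp_two U + c.mulb₁ (H1.toL2 U) : L2) x := rfl
  rw [h5, h1, Pi.add_apply, h2, mulb₁, h3, h4, b]
  push_cast
  ring

theorem L2_integrable_conj_mul {μ : Measure ℝ} (f g : Lp ℂ 2 μ) :
    Integrable (fun x => (starRingEnd ℂ) (f x) * g x) μ :=
  integrable_mul_of_memLp_two (memLp_two_conj (Lp.memLp f)) (Lp.memLp g)

/-- The weak equation tested with Φ is exactly the integration by parts identity for the flux f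
against the conjugate of Φ. This common form serves both implications between the weak and the
integrated equation. -/
theorem inner_formOp_sub (h : ℝ) (Φ U : H1) (g : L2) :
    inner ℂ Φ (c.formOp h U) - inner ℂ (H1.toL2 Φ) (c.mulInvβ g)
      = -((∫ x, (starRingEnd ℂ) (H1.derivL2 Φ x) *
            (-(h : ℂ) ^ 2 * c.α x * H1.derivL2 U x - Complex.I * h * c.b x * H1.rep U x))
          + (∫ x, c.density h (H1.rep U) (H1.derivL2 U) g x * (starRingEnd ℂ) (H1.rep Φ x))
          + ∫ x, c.singularDensity (H1.rep U) x * (starRingEnd ℂ) (H1.rep Φ x) ∂c.absV₀) ∧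
    Integrable (fun x => c.density h (H1.rep U) (H1.derivL2 U) g x * (starRingEnd ℂ) (H1.rep Φ x))
      volume ∧
    Integrable (fun x => c.singularDensity (H1.rep U) x * (starRingEnd ℂ) (H1.rep Φ x))
      c.absV₀ := by
  have rΦ := (H1.isRep Φ).ae_eq
  have rU := (H1.isRep U).ae_eq
  have eα := mulOp_coeFn c.measurable_α.aestronglyMeasurable
    (exists_bound_of_boundedVariationOn c.α_bv).choose_spec (H1.derivL2 U)
  have eV := mulOp_coeFn (c.measurable_V₁.mul c.measurable_β.inv).aestronglyMeasurable
    c.exists_bound_V₁_div_β.choose_spec (H1.toL2 U)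
  have eg := mulOp_coeFn c.measurable_β.inv.aestronglyMeasurable
    c.exists_bound_inv_β.choose_spec g
  have i1 := L2_integrable_conj_mul (H1.derivL2 Φ) (c.mulα (H1.derivL2 U))
  have i2 := L2_integrable_conj_mul (H1.derivL2 Φ) (c.mulb U)
  have i3 := L2_integrable_conj_mul (c.mulb Φ) (H1.derivL2 U)
  have i4 := L2_integrable_conj_mul (H1.toL2 Φ) (c.mulV₁ (H1.toL2 U))
  have i5 := L2_integrable_conj_mul (H1.toL2 Φ) (c.mulInvβ g)
  have i6 := L2_integrable_conj_mul (c.trace Φ) (c.mulSign U)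
  have i7 : Integrable (fun x => (starRingEnd ℂ) (H1.toL2 Φ x) * c.mulInvβ g x
      - (starRingEnd ℂ) (H1.toL2 Φ x) * c.mulV₁ (H1.toL2 U) x) := Integrable.sub i5 i4
  have eD : (fun x => c.density h (H1.rep U) (H1.derivL2 U) g x * (starRingEnd ℂ) (H1.rep Φ x))
      =ᵐ[volume] fun x => (starRingEnd ℂ) (H1.toL2 Φ x) * c.mulInvβ g x
        - (starRingEnd ℂ) (H1.toL2 Φ x) * c.mulV₁ (H1.toL2 U) x
        + Complex.I * h * ((starRingEnd ℂ) (c.mulb Φ x) * H1.derivL2 U x) := by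
    filter_upwards [rΦ, rU, eV, eg, c.mulb_coeFn Φ] with x h1 h2 h3 h4 h5
    rw [h5, mulInvβ, h4, mulV₁, h3, density, ← h1, ← h2, map_mul, Complex.conj_ofReal]
    simp only [Pi.mul_apply, Pi.inv_apply]
    push_cast
    ring
  have eS : (fun x => c.singularDensity (H1.rep U) x * (starRingEnd ℂ) (H1.rep Φ x))
      =ᵐ[c.absV₀] fun x => -((starRingEnd ℂ) (c.trace Φ x) * c.mulSign U x) := by
    filter_upwards [H1.mulRep_coeFn (memLp_const (1 : ℝ)) Φ, H1.mulRep_coeFn c.memLp_sign_div U]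
      with x h1 h2
    rw [mulSign, h2, trace, h1, singularDensity, map_mul, Complex.conj_ofReal]
    push_cast
    ring
  have eF : (fun x => (starRingEnd ℂ) (H1.derivL2 Φ x) *
      (-(h : ℂ) ^ 2 * c.α x * H1.derivL2 U x - Complex.I * h * c.b x * H1.rep U x))
      =ᵐ[volume] fun x => -((h : ℂ) ^ 2 * ((starRingEnd ℂ) (H1.derivL2 Φ x) *
        c.mulα (H1.derivL2 U) x)) - Complex.I * h * ((starRingEnd ℂ) (H1.derivL2 Φ x) *
        c.mulb U x) := by
    filter_upwards [eα, c.mulb_coeFn U] with x h1 h2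
    rw [h2, mulα, h1]
    ring
  refine ⟨?_, (Integrable.add i7 (i3.const_mul _)).congr eD.symm, i6.neg.congr eS.symm⟩
  rw [integral_congr_ae eD, integral_congr_ae eS, integral_congr_ae eF, inner_formOp,
    integral_sub (i1.const_mul _).fun_neg (i2.const_mul _), integral_neg, integral_const_mul,
    integral_const_mul, integral_add i7 (i3.const_mul _), integral_sub i5 i4,
    integral_const_mul, integral_neg, ← L2_inner_eq, ← L2_inner_eq, ← L2_inner_eq, ← L2_inner_eq,
    ← L2_inner_eq, ← L2_inner_eq]
  ring

variable {c}

theorem IsSolution.congr_deriv {h : ℝ} {u g : L2} {u' u'' v f : ℝ → ℂ}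
    (S : c.IsSolution h u g u' v f) (e : u'' =ᵐ[volume] u') : c.IsSolution h u g u'' v f where
  memLp_deriv := S.memLp_deriv.ae_eq e.symm
  isRep := ⟨S.isRep.continuous, S.isRep.ae_eq, fun x y hxy => by
    rw [S.isRep.increments x y hxy]
    exact integral_congr_ae (ae_restrict_of_ae e.symm)⟩
  ae_eq := by
    filter_upwards [S.ae_eq, e] with x h1 h2
    rw [h1, h2]
  increments := fun x y hxy => by
    rw [S.increments x y hxy]
    congr 1
    refine integral_congr_ae (ae_restrict_of_ae ?_)
    filter_upwards [e] with x hx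
    rw [density, density, hx]

/-- Integration by parts of f against the conjugate of Φ on the whole line. No boundary term
survives because f and Φ are both in L². -/
theorem IsSolution.formOp_eq {h : ℝ} {U : H1} {g : L2} {f : ℝ → ℂ}
    (S : c.IsSolution h (H1.toL2 U) g (H1.derivL2 U) (H1.rep U) f) :
    c.formOp h U = ContinuousLinearMap.adjoint H1.toL2 (c.mulInvβ g) := by
  refine ext_inner_left ℂ fun Φ => ?_
  rw [ContinuousLinearMap.adjoint_inner_right, ← sub_eq_zero]
  obtain ⟨h1, h2, h3⟩ := c.inner_formOp_sub h Φ U g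
  have hΦ := (H1.isRep Φ).memLp (Lp.memLp _)
  rw [h1, neg_eq_zero, ← integral_parts_univ (N := f) (φ := fun x => (starRingEnd ℂ) (H1.rep Φ x))
    S.integrableOn_density
    (fun p q => S.integrable_singularDensity.integrableOn)
    (integrableOn_Ioc_of_memLp_two (memLp_two_conj (Lp.memLp (H1.derivL2 Φ))))
    (conj_increments (H1.isRep Φ).increments) S.increments
    (integrable_mul_of_memLp_two S.memLp (memLp_two_conj hΦ))
    (integrable_mul_of_memLp_two (memLp_two_conj (Lp.memLp (H1.derivL2 Φ))) S.memLp) h2 h3]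
  congr 2
  refine integral_congr_ae ?_
  filter_upwards [S.ae_eq] with x hx
  rw [hx]

/-- Let N be any function with the increments prescribed by the equation. Testing the weak equation
shows that the flux F of U and N have the same weak derivative, so F = C + N almost everywhere, and
C + N is the required representative. -/
theorem exists_isSolution_of_formOp_eq {h : ℝ} {U : H1} {g : L2}
    (H : c.formOp h U = ContinuousLinearMap.adjoint H1.toL2 (c.mulInvβ g)) :
    ∃ f, c.IsSolution h (H1.toL2 U) g (H1.derivL2 U) (H1.rep U) f := by
  have hU := (H1.isRep U).memLp (Lp.memLp _)
  have h₁ := c.integrableOn_density (h := h) hU (Lp.memLp (H1.derivL2 U)) (Lp.memLp g)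
  have h₂ := c.integrable_singularDensity (H1.isRep U).continuous (H1.norm_rep_le U)
  obtain ⟨N, hN⟩ := exists_hasIncrements h₁ fun p q => h₂.integrableOn
  set F : ℝ → ℂ := fun x => -(h : ℂ) ^ 2 * c.α x * H1.derivL2 U x
    - Complex.I * h * c.b x * H1.rep U x with hF
  have hF2 : MemLp F 2 volume := by
    obtain ⟨Kα, hKα⟩ := exists_bound_of_boundedVariationOn c.α_bv
    have e1 := memLp_two_bounded_mul c.measurable_α.aestronglyMeasurable hKα
      (Lp.memLp (H1.derivL2 U))
    have e2 := c.memLp_b_mul hU (H1.isRep U).continuous (H1.norm_rep_le U)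
    refine ((e1.const_mul (-(h : ℂ) ^ 2)).sub (e2.const_mul (Complex.I * h))).ae_eq
      (Eventually.of_forall fun x => ?_)
    simp only [Pi.sub_apply, hF]
    ring
  have hFl : LocallyIntegrable F volume := hF2.locallyIntegrable (by norm_num)
  have hNl := hN.locallyIntegrable h₁ fun p q => h₂.integrableOn
  obtain ⟨C, hC⟩ := ae_eq_const_of_weakDeriv_eq_zero (g := fun x => F x - N x) (hFl.sub hNl)
    fun φ hφ hs => by
      have hdc : Continuous (deriv φ) := hφ.continuous_deriv (by simp)
      have i1 := hFl.integrable_smul_left_of_hasCompactSupport hdc hs.deriv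
      have i2 := hNl.integrable_smul_left_of_hasCompactSupport hdc hs.deriv
      simp only [Complex.real_smul] at i1 i2
      simp_rw [mul_sub]
      rw [integral_sub i1 i2, integral_deriv_mul_of_increments h₁ (fun p q => h₂.integrableOn) hN
        hφ hs, sub_neg_eq_add]
      obtain ⟨Φ, hΦ, hΦ'⟩ := H1.exists_of_testFunction hφ hs
      have key := (c.inner_formOp_sub h Φ U g).1
      rw [H, ContinuousLinearMap.adjoint_inner_right, sub_self, eq_comm, neg_eq_zero, hΦ] at key
      simp only [Complex.conj_ofReal] at key
      rw [← key, add_assoc]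
      congr 1
      refine integral_congr_ae ?_
      filter_upwards [hΦ'] with x hx
      rw [hx, Complex.conj_ofReal]
  refine ⟨fun x => C + N x, Lp.memLp _, H1.isRep U, ?_, fun x y hxy => ?_⟩
  · filter_upwards [hC] with x hx
    rw [← hx, hF]
    ring
  · rw [← hN x y hxy]
    ring

/-- The weak formulation of the equation `P(h) u = g`. -/
theorem isImage_iff {h : ℝ} {u g : L2} :
    c.IsImage h u g ↔ ∃ U : H1, H1.toL2 U = u ∧ c.formOp h U = ContinuousLinearMap.adjoint H1.toL2 (c.mulInvβ g) := by
  constructor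
  · intro H
    obtain ⟨u', v, f, hw, S⟩ := H.exists_isSolution
    obtain ⟨U, rfl, hU⟩ := H1.exists_of_hasWeakDeriv S.memLp_deriv hw
    refine ⟨U, rfl, ?_⟩
    obtain rfl := H1.rep_eq S.isRep.continuous S.isRep.ae_eq
    exact (S.congr_deriv hU).formOp_eq
  · rintro ⟨U, rfl, hU⟩
    obtain ⟨f, S⟩ := exists_isSolution_of_formOp_eq hU
    exact S.isImage (H1.hasWeakDeriv U)

end Coefficients

end MagneticSchrodinger

end

/-! ### Gårding's inequality, existence of the resolvent and the energy identity. -/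

noncomputable section

namespace MagneticSchrodinger

open Filter Topology

theorem L2_integrable_norm_sq {μ : Measure ℝ} (f : Lp ℂ 2 μ) :
    Integrable (fun x => ‖f x‖ ^ 2) μ :=
  (memLp_two_iff_integrable_sq_norm (Lp.memLp f).1).1 (Lp.memLp f)

theorem L2_integrable_bounded_mul_norm_sq {μ : Measure ℝ} {a : ℝ → ℝ}
    (ha : AEStronglyMeasurable a μ) {K : ℝ} (hK : ∀ x, |a x| ≤ K) (f : Lp ℂ 2 μ) :
    Integrable (fun x => a x * ‖f x‖ ^ 2) μ :=
  (L2_integrable_norm_sq f).bdd_mul (c := K) ha (Eventually.of_forall hK)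

theorem inner_mulOp_self {μ : Measure ℝ} {a : ℝ → ℝ} (ha : AEStronglyMeasurable a μ) {K : ℝ}
    (hK : ∀ x, |a x| ≤ K) (f : Lp ℂ 2 μ) :
    inner ℂ f (mulOp ha hK f) = ((∫ x, a x * ‖f x‖ ^ 2 ∂μ : ℝ) : ℂ) := by
  rw [L2_inner_eq, ← integral_complex_ofReal]
  refine integral_congr_ae ?_
  filter_upwards [mulOp_coeFn ha hK f] with x hx
  rw [hx, mul_left_comm, Complex.conj_mul']
  push_cast
  ring

namespace Coefficients

variable (c : Coefficients)

theorem inner_mulInvβ_self (u : L2) :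
    inner ℂ u (c.mulInvβ u) = ((∫ x, (c.β x)⁻¹ * ‖u x‖ ^ 2 : ℝ) : ℂ) :=
  inner_mulOp_self _ _ u

theorem integrable_inv_β_mul (u : L2) : Integrable (fun x => (c.β x)⁻¹ * ‖u x‖ ^ 2) :=
  L2_integrable_bounded_mul_norm_sq c.measurable_β.inv.aestronglyMeasurable
    c.exists_bound_inv_β.choose_spec u

theorem le_integral_inv_β {K : ℝ} (hK : ∀ x, c.β x ≤ K) (u : L2) :
    K⁻¹ * ‖u‖ ^ 2 ≤ ∫ x, (c.β x)⁻¹ * ‖u x‖ ^ 2 := by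
  rw [L2_norm_sq_eq, ← integral_const_mul]
  exact integral_mono ((L2_integrable_norm_sq u).const_mul _) (c.integrable_inv_β_mul u) fun x =>
    mul_le_mul_of_nonneg_right (inv_anti₀ (c.β_pos x) (hK x)) (by positivity)

theorem norm_inner_mulInvβ_le (u v : L2) :
    ‖inner ℂ u (c.mulInvβ v)‖ ≤ ∫ x, (c.β x)⁻¹ * (‖u x‖ * ‖v x‖) := by
  rw [L2_inner_eq]
  refine (norm_integral_le_integral_norm _).trans (le_of_eq (integral_congr_ae ?_))
  filter_upwards [mulOp_coeFn c.measurable_β.inv.aestronglyMeasurable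
    c.exists_bound_inv_β.choose_spec v] with x hx
  rw [mulInvβ, hx, norm_mul, norm_mul, Complex.norm_real, RCLike.norm_conj, Pi.inv_apply,
    Real.norm_of_nonneg (inv_pos.2 (c.β_pos x)).le]
  ring

/-- All coefficients are real, and the two magnetic terms combine into ih(ζ - ζ̄), which is real. -/
theorem formOp_im (h : ℝ) (U : H1) : (inner ℂ U (c.formOp h U)).im = 0 := by
  have e1 : (inner ℂ (H1.derivL2 U) (c.mulα (H1.derivL2 U)) : ℂ).im = 0 := by
    rw [mulα, inner_mulOp_self, Complex.ofReal_im]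
  have e2 : (inner ℂ (H1.toL2 U) (c.mulV₁ (H1.toL2 U)) : ℂ).im = 0 := by
    rw [mulV₁, inner_mulOp_self, Complex.ofReal_im]
  have e3 : (inner ℂ (c.trace U) (c.mulSign U) : ℂ).im = 0 := by
    rw [L2_inner_eq]
    have : ∫ x, (starRingEnd ℂ) (c.trace U x) * c.mulSign U x ∂c.absV₀
        = ((∫ x, c.signV₀ x * (c.β x)⁻¹ * ‖H1.rep U x‖ ^ 2 ∂c.absV₀ : ℝ) : ℂ) := by
      rw [← integral_complex_ofReal]
      refine integral_congr_ae ?_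
      filter_upwards [H1.mulRep_coeFn (memLp_const (1 : ℝ)) U, H1.mulRep_coeFn c.memLp_sign_div U]
        with x h1 h2
      rw [mulSign, h2, trace, h1, map_mul, Complex.conj_ofReal]
      push_cast
      rw [← Complex.conj_mul']
      ring
    rw [this, Complex.ofReal_im]
  have e4 : (inner ℂ (c.mulb U) (H1.derivL2 U) : ℂ)
      = (starRingEnd ℂ) (inner ℂ (H1.derivL2 U) (c.mulb U)) := (inner_conj_symm _ _).symm
  rw [inner_formOp, e4]
  simp only [Complex.add_im, Complex.sub_im, Complex.mul_im, e1, e2, e3, Complex.mul_re,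
    Complex.I_re, Complex.I_im, Complex.ofReal_re, Complex.ofReal_im, Complex.conj_re,
    Complex.conj_im, sq]
  ring

theorem formOp_re (h : ℝ) (U : H1) : (inner ℂ U (c.formOp h U)).re
    = h ^ 2 * (∫ x, c.α x * ‖H1.derivL2 U x‖ ^ 2)
      - 2 * h * (inner ℂ (H1.derivL2 U) (c.mulb U) : ℂ).im
      + (inner ℂ (H1.toL2 U) (c.mulV₁ (H1.toL2 U)) : ℂ).re
      + (inner ℂ (c.trace U) (c.mulSign U) : ℂ).re := by
  have e4 : (inner ℂ (c.mulb U) (H1.derivL2 U) : ℂ)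
      = (starRingEnd ℂ) (inner ℂ (H1.derivL2 U) (c.mulb U)) := (inner_conj_symm _ _).symm
  rw [inner_formOp, e4, mulα, inner_mulOp_self]
  simp only [Complex.add_re, Complex.sub_re, Complex.mul_im, Complex.mul_re,
    Complex.I_re, Complex.I_im, Complex.ofReal_re, Complex.ofReal_im, Complex.conj_re,
    Complex.conj_im, sq]
  ring

/-- Gårding's inequality for the quadratic form of `P(h)`. -/
theorem exists_formOp_ge {h : ℝ} (hh : 0 < h) : ∃ κ C : ℝ, 0 < κ ∧ 0 ≤ C ∧ ∀ U : H1,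
    κ * ‖H1.derivL2 U‖ ^ 2 - C * ‖H1.toL2 U‖ ^ 2 ≤ (inner ℂ U (c.formOp h U)).re := by
  obtain ⟨m, hm, hα⟩ := c.α_inf_pos
  set B := ‖c.b₀_memLp_two.toLp c.b₀‖ with hB
  set K := ‖c.mulb₁‖ with hK
  set KV := ‖c.mulV₁‖ with hKV
  set T := ‖(memLp_const (1 : ℝ) : MemLp (fun _ : ℝ => (1 : ℝ)) 2 c.absV₀).toLp _‖ *
    ‖c.memLp_sign_div.toLp _‖ with hT
  have hT0 : 0 ≤ T := by positivity
  set G := 8 * B ^ 2 / m + T with hG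
  have hG0 : 0 ≤ G := by positivity
  -- G is the coefficient of the squared supremum of u after Young's inequality. With this δ its
  -- derivative part costs at most h²m/4; the two magnetic terms cost h²m/8 each, which leaves half
  -- of h²m. The added 1 covers G = 0.
  set δ := h ^ 2 * m / (4 * (G + 1)) with hδ
  have hδ0 : 0 < δ := by positivity
  refine ⟨h ^ 2 * m / 2, 8 * K ^ 2 / m + KV + G * δ⁻¹, by positivity, by positivity, fun U => ?_⟩
  set D := ‖H1.derivL2 U‖ with hD
  set n := ‖H1.toL2 U‖ with hn
  set s := Real.sqrt (δ * D ^ 2 + δ⁻¹ * n ^ 2) with hs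
  have hs2 : s ^ 2 = δ * D ^ 2 + δ⁻¹ * n ^ 2 := Real.sq_sqrt (by positivity)
  have hs0 : 0 ≤ s := Real.sqrt_nonneg _
  have hrep : ∀ x, ‖H1.rep U x‖ ≤ s := fun x =>
    Real.le_sqrt_of_sq_le (H1.norm_rep_sq_le U hδ0 x)
  have h1 : m * D ^ 2 ≤ ∫ x, c.α x * ‖H1.derivL2 U x‖ ^ 2 := by
    rw [hD, L2_norm_sq_eq, ← integral_const_mul]
    exact integral_mono ((L2_integrable_norm_sq _).const_mul _)
      (L2_integrable_bounded_mul_norm_sq c.measurable_α.aestronglyMeasurable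
        (exists_bound_of_boundedVariationOn c.α_bv).choose_spec _) fun x =>
      mul_le_mul_of_nonneg_right (hα x) (by positivity)
  have h2 : ‖c.mulb U‖ ≤ s * B + K * n :=
    (norm_add_le _ _).trans (add_le_add (H1.norm_mulRep_le c.b₀_memLp_two U hrep)
      (c.mulb₁.le_opNorm _))
  have h3 : |(inner ℂ (H1.derivL2 U) (c.mulb U) : ℂ).im| ≤ D * (s * B + K * n) :=
    (Complex.abs_im_le_norm _).trans ((norm_inner_le_norm _ _).trans
      (mul_le_mul_of_nonneg_left h2 (norm_nonneg _)))
  have h4 : |(inner ℂ (H1.toL2 U) (c.mulV₁ (H1.toL2 U)) : ℂ).re| ≤ n * (KV * n) :=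
    (Complex.abs_re_le_norm _).trans ((norm_inner_le_norm _ _).trans
      (mul_le_mul_of_nonneg_left (c.mulV₁.le_opNorm _) (norm_nonneg _)))
  have h5 : |(inner ℂ (c.trace U) (c.mulSign U) : ℂ).re| ≤ s ^ 2 * T := by
    refine (Complex.abs_re_le_norm _).trans ((norm_inner_le_norm _ _).trans ?_)
    refine (mul_le_mul (H1.norm_mulRep_le _ U hrep) (H1.norm_mulRep_le _ U hrep) (norm_nonneg _)
      (by positivity)).trans (le_of_eq ?_)
    rw [hT]
    ring
  rw [formOp_re]
  have h3' := (abs_le.1 h3).2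
  have h4' := (abs_le.1 h4).1
  have h5' := (abs_le.1 h5).1
  have h6 : 2 * h * (D * (s * B)) ≤ h ^ 2 * m / 8 * D ^ 2 + 8 * B ^ 2 / m * s ^ 2 := by
    have e : h ^ 2 * m / 8 * D ^ 2 + 8 * B ^ 2 / m * s ^ 2 - 2 * h * (D * (s * B))
      = (h * m * D - 8 * B * s) ^ 2 / (8 * m) := by field_simp; ring
    have : 0 ≤ (h * m * D - 8 * B * s) ^ 2 / (8 * m) := by positivity
    linarith
  have h7 : 2 * h * (D * (K * n)) ≤ h ^ 2 * m / 8 * D ^ 2 + 8 * K ^ 2 / m * n ^ 2 := by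
    have e : h ^ 2 * m / 8 * D ^ 2 + 8 * K ^ 2 / m * n ^ 2 - 2 * h * (D * (K * n))
      = (h * m * D - 8 * K * n) ^ 2 / (8 * m) := by field_simp; ring
    have : 0 ≤ (h * m * D - 8 * K * n) ^ 2 / (8 * m) := by positivity
    linarith
  have h8 : G * s ^ 2 ≤ h ^ 2 * m / 4 * D ^ 2 + G * δ⁻¹ * n ^ 2 := by
    have : G * δ ≤ h ^ 2 * m / 4 := by
      rw [hδ, mul_div_assoc', div_le_div_iff₀ (by positivity) (by norm_num)]
      linarith [show 0 < h ^ 2 * m by positivity]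
    rw [hs2, mul_add, ← mul_assoc, ← mul_assoc]
    exact add_le_add_left (mul_le_mul_of_nonneg_right this (sq_nonneg D)) _
  have h9 := mul_le_mul_of_nonneg_left h1 (sq_nonneg h)
  have h10 := mul_le_mul_of_nonneg_left h3' (show 0 ≤ 2 * h by positivity)
  have h11 : G * s ^ 2 = 8 * B ^ 2 / m * s ^ 2 + T * s ^ 2 := by rw [hG]; ring
  have h12 : 2 * h * (D * (s * B + K * n)) = 2 * h * (D * (s * B)) + 2 * h * (D * (K * n)) := by
    ring
  have h13 : h ^ 2 * m / 8 * D ^ 2 + h ^ 2 * m / 8 * D ^ 2 + h ^ 2 * m / 4 * D ^ 2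
      = h ^ 2 * (m * D ^ 2) - h ^ 2 * m / 2 * D ^ 2 := by ring
  have h14 : (8 * K ^ 2 / m + KV + G * δ⁻¹) * n ^ 2
      = 8 * K ^ 2 / m * n ^ 2 + n * (KV * n) + G * δ⁻¹ * n ^ 2 := by ring
  have h15 : s ^ 2 * T = T * s ^ 2 := mul_comm _ _
  clear_value D n s δ G B K KV T
  linarith

/-- The operator on `H¹` representing the quadratic form of `P(h) - z` in `L²(β⁻¹ dx)`. -/
def shiftedFormOp (h : ℝ) (z : ℂ) : H1 →L[ℂ] H1 :=
  c.formOp h - z • (ContinuousLinearMap.adjoint H1.toL2 ∘L c.mulInvβ ∘L H1.toL2)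

theorem shiftedFormOp_apply (h : ℝ) (z : ℂ) (U : H1) : c.shiftedFormOp h z U
    = c.formOp h U - ContinuousLinearMap.adjoint H1.toL2 (c.mulInvβ (z • H1.toL2 U)) := by
  rw [map_smul, map_smul]
  rfl

theorem inner_shiftedFormOp (h : ℝ) (z : ℂ) (U : H1) : inner ℂ U (c.shiftedFormOp h z U)
    = inner ℂ U (c.formOp h U) - z * ((∫ x, (c.β x)⁻¹ * ‖H1.toL2 U x‖ ^ 2 : ℝ) : ℂ) := by
  rw [shiftedFormOp_apply, inner_sub_right, ContinuousLinearMap.adjoint_inner_right, map_smul,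
    inner_smul_right, inner_mulInvβ_self]

/-- The form of P(h) is real, so the imaginary part controls |Im z| times the weighted norm of u.
The real part and Gårding's inequality then control u'. -/
theorem exists_shiftedFormOp_coercive {h : ℝ} (hh : 0 < h) {z : ℂ} (hz : z.im ≠ 0) :
    ∃ κ : ℝ, 0 < κ ∧ ∀ U, κ * ‖U‖ ^ 2 ≤ ‖inner ℂ U (c.shiftedFormOp h z U)‖ := by
  obtain ⟨κ, C, hκ, hC, hform⟩ := c.exists_formOp_ge hh
  obtain ⟨Kβ, hKβ⟩ := exists_bound_of_boundedVariationOn c.β_bv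
  have hKβ0 : 0 < Kβ := (c.β_pos 0).trans_le ((le_abs_self _).trans (hKβ 0))
  have hz' : 0 < |z.im| := abs_pos.2 hz
  -- The two summands are the constants that bound ‖u'‖² and ‖u‖² by the absolute value of the form.
  set L := (1 + |z.re| / |z.im| + C * Kβ / |z.im|) / κ + Kβ / |z.im| with hL
  have hL0 : 0 < L := by positivity
  refine ⟨L⁻¹, inv_pos.2 hL0, fun U => ?_⟩
  rw [inv_mul_le_iff₀ hL0]
  set N := ‖inner ℂ U (c.shiftedFormOp h z U)‖ with hN
  set w := ∫ x, (c.β x)⁻¹ * ‖H1.toL2 U x‖ ^ 2 with hw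
  have hw0 : Kβ⁻¹ * ‖H1.toL2 U‖ ^ 2 ≤ w :=
    c.le_integral_inv_β (fun x => (le_abs_self _).trans (hKβ x)) _
  have hw0' : 0 ≤ w := le_trans (by positivity) hw0
  have him : |z.im| * w ≤ N := by
    have h1 := Complex.abs_im_le_norm (inner ℂ U (c.shiftedFormOp h z U))
    rw [inner_shiftedFormOp] at h1
    rw [hN, inner_shiftedFormOp]
    refine le_trans (le_of_eq ?_) h1
    rw [Complex.sub_im, formOp_im, zero_sub, abs_neg, Complex.mul_im, Complex.ofReal_re,
      Complex.ofReal_im, mul_zero, zero_add, abs_mul, abs_of_nonneg hw0']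
  have hre : (inner ℂ U (c.formOp h U)).re ≤ N + |z.re| * w := by
    have h1 := (le_abs_self _).trans (Complex.abs_re_le_norm (inner ℂ U (c.shiftedFormOp h z U)))
    rw [← hN, inner_shiftedFormOp, Complex.sub_re, Complex.mul_re, Complex.ofReal_re,
      Complex.ofReal_im, mul_zero, sub_zero] at h1
    nlinarith [mul_le_mul_of_nonneg_right (le_abs_self z.re) hw0']
  have hwN : w ≤ N / |z.im| := by rw [le_div_iff₀ hz', mul_comm]; exact him
  have hn : ‖H1.toL2 U‖ ^ 2 ≤ Kβ * w := by rwa [inv_mul_le_iff₀ hKβ0] at hw0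
  have hn' : ‖H1.toL2 U‖ ^ 2 ≤ Kβ / |z.im| * N := hn.trans (by
    calc Kβ * w ≤ Kβ * (N / |z.im|) := mul_le_mul_of_nonneg_left hwN hKβ0.le
      _ = _ := by ring)
  have hD : κ * ‖H1.derivL2 U‖ ^ 2 ≤ (1 + |z.re| / |z.im| + C * Kβ / |z.im|) * N := by
    have e1 := mul_le_mul_of_nonneg_left hwN (abs_nonneg z.re)
    have e2 := mul_le_mul_of_nonneg_left hn' hC
    calc κ * ‖H1.derivL2 U‖ ^ 2 ≤ N + |z.re| * (N / |z.im|) + C * (Kβ / |z.im| * N) := by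
          linarith [hform U]
      _ = _ := by ring
  have hD' : ‖H1.derivL2 U‖ ^ 2 ≤ (1 + |z.re| / |z.im| + C * Kβ / |z.im|) / κ * N := by
    rw [div_mul_eq_mul_div, le_div_iff₀ hκ, mul_comm]
    exact hD
  rw [H1.norm_sq, hL]
  linarith

/-- The resolvent of `P(h)` exists off the real axis. -/
theorem exists_isResolvent {h : ℝ} (hh : 0 < h) {z : ℂ} (hz : z.im ≠ 0) :
    ∃ T : L2 →L[ℂ] L2, c.IsResolvent h z T := by
  obtain ⟨κ, hκ, hcoer⟩ := c.exists_shiftedFormOp_coercive hh hz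
  obtain ⟨e, he⟩ := exists_equiv_of_coercive _ hκ hcoer
  refine ⟨H1.toL2 ∘L (e.symm : H1 →L[ℂ] H1) ∘L ContinuousLinearMap.adjoint H1.toL2 ∘L c.mulInvβ,
    fun v u => ?_⟩
  rw [isImage_iff]
  have key : ∀ U : H1, c.formOp h U
      = ContinuousLinearMap.adjoint H1.toL2 (c.mulInvβ (v + z • H1.toL2 U)) ↔
      U = e.symm (ContinuousLinearMap.adjoint H1.toL2 (c.mulInvβ v)) := fun U => by
    rw [ContinuousLinearEquiv.eq_symm_apply, he, shiftedFormOp_apply, map_add, map_add,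
      sub_eq_iff_eq_add]
  constructor
  · rintro rfl
    exact ⟨_, rfl, (key _).2 rfl⟩
  · rintro ⟨U, rfl, hU⟩
    rw [(key U).1 hU]
    rfl

variable {c}

/-- The energy identity, from the imaginary part of the quadratic form. -/
theorem IsImage.energy {h : ℝ} {z : ℂ} {u v : L2} (H : c.IsImage h u (v + z • u)) :
    |z.im| * (∫ x, (c.β x)⁻¹ * ‖u x‖ ^ 2) ≤ ∫ x, (c.β x)⁻¹ * (‖u x‖ * ‖v x‖) := by
  obtain ⟨U, rfl, hU⟩ := isImage_iff.1 H
  refine le_trans ?_ (c.norm_inner_mulInvβ_le _ v)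
  -- Pairing the equation with u and taking imaginary parts removes the form of P(h) and leaves Im z
  -- ∫|u|²/β = -Im⟨u, β⁻¹v⟩.
  have h1 := c.formOp_im h U
  rw [hU, ContinuousLinearMap.adjoint_inner_right, map_add, map_smul, inner_add_right,
    inner_smul_right, inner_mulInvβ_self, Complex.add_im, Complex.mul_im, Complex.ofReal_re,
    Complex.ofReal_im, mul_zero, zero_add] at h1
  refine le_trans (le_of_eq ?_) (Complex.abs_im_le_norm _)
  rw [eq_neg_of_add_eq_zero_left h1, abs_neg, abs_mul, abs_of_nonneg (a := ∫ x, _)]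
  exact integral_nonneg fun x => mul_nonneg (inv_pos.2 (c.β_pos x)).le (by positivity)

/-- The energy identity and the Cauchy-Schwarz inequality; the quotient K/m is the price of passing
between L²(β⁻¹dx) and L²(dx). -/
theorem IsResolvent.norm_le {h : ℝ} {z : ℂ} (hz : z.im ≠ 0) {T : L2 →L[ℂ] L2}
    (hT : c.IsResolvent h z T) {m K : ℝ} (hm : 0 < m) (hm' : ∀ x, m ≤ c.β x)
    (hK : ∀ x, c.β x ≤ K) : ‖T‖ ≤ K / (m * |z.im|) := by
  have hz' : 0 < |z.im| := abs_pos.2 hz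
  have hK0 : 0 < K := (c.β_pos 0).trans_le (hK 0)
  refine T.opNorm_le_bound (by positivity) fun v => ?_
  have H := (hT v (T v)).1 rfl
  have h1 := H.energy
  have h2 := mul_le_mul_of_nonneg_left (c.le_integral_inv_β hK (T v)) hz'.le
  have i0 : Integrable fun x => ‖T v x‖ * ‖v x‖ :=
    (Lp.memLp (T v)).norm.integrable_mul (Lp.memLp v).norm
  have h3 : ∫ x, (c.β x)⁻¹ * (‖T v x‖ * ‖v x‖) ≤ m⁻¹ * (‖T v‖ * ‖v‖) := by
    have e1 : ∫ x, (c.β x)⁻¹ * (‖T v x‖ * ‖v x‖) ≤ ∫ x, m⁻¹ * (‖T v x‖ * ‖v x‖) := by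
      refine integral_mono (i0.bdd_mul (c := m⁻¹) c.measurable_β.inv.aestronglyMeasurable
        (Eventually.of_forall fun x => ?_)) (i0.const_mul _) fun x => ?_
      · rw [Real.norm_of_nonneg (inv_pos.2 (c.β_pos x)).le]
        exact inv_anti₀ hm (hm' x)
      · exact mul_le_mul_of_nonneg_right (inv_anti₀ hm (hm' x)) (by positivity)
    refine e1.trans ?_
    rw [integral_const_mul]
    refine mul_le_mul_of_nonneg_left ?_ (inv_pos.2 hm).le
    have e2 := integral_mul_le_Lp_mul_Lq_of_nonneg (μ := (volume : Measure ℝ))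
      Real.HolderConjugate.two_two (f := fun x => ‖T v x‖) (g := fun x => ‖v x‖)
      (Eventually.of_forall fun _ => norm_nonneg _) (Eventually.of_forall fun _ => norm_nonneg _)
      (by simpa using (Lp.memLp (T v)).norm) (by simpa using (Lp.memLp v).norm)
    simp only [Real.rpow_two, ← Real.sqrt_eq_rpow, ← L2_norm_sq_eq,
      Real.sqrt_sq (norm_nonneg _)] at e2
    exact e2
  rcases eq_or_ne (T v) 0 with h0 | h0
  · rw [h0, norm_zero]; positivity
  have h4 : 0 < ‖T v‖ := norm_pos_iff.2 h0
  rw [div_mul_eq_mul_div, le_div_iff₀ (by positivity)]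
  have h5 : |z.im| * (K⁻¹ * ‖T v‖ ^ 2) ≤ m⁻¹ * (‖T v‖ * ‖v‖) := h2.trans (h1.trans h3)
  have h6 : |z.im| * (K⁻¹ * ‖T v‖) ≤ m⁻¹ * ‖v‖ := by
    refine le_of_mul_le_mul_right ?_ h4
    calc _ = |z.im| * (K⁻¹ * ‖T v‖ ^ 2) := by ring
      _ ≤ _ := h5
      _ = _ := by ring
  have h7 := mul_le_mul_of_nonneg_left h6 (show 0 ≤ K * m by positivity)
  field_simp at h7
  linarith

end Coefficients

end MagneticSchrodinger

end

/-! ### Energy estimates for the first order system on a half line. -/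

noncomputable section

namespace MagneticSchrodinger

open Filter Topology

/-- Errors that are products of increments disappear upon refining the partition. -/
theorem le_of_forall_le_add_mul_increments {Φ p G : ℝ → ℝ} {a b C : ℝ} (hab : a ≤ b)
    (H : ∀ x y, a ≤ x → x ≤ y → y ≤ b →
      Φ x ≤ Φ y + C * (p y - p x) * (y - x) + (G y - G x)) :
    Φ a ≤ Φ b + (G b - G a) := by
  -- The inequality is summed over n + 1 equal subintervals. The increments of Φ, p and G telescope,
  -- and the mesh contributes the factor 1/(n + 1) to the error.
  have key : ∀ n : ℕ, Φ a - Φ b - (G b - G a)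
      ≤ C * (p b - p a) * (b - a) * (1 / ((n : ℝ) + 1)) := fun n => by
    have hn : (0 : ℝ) < (n : ℝ) + 1 := by positivity
    set x : ℕ → ℝ := fun i => a + (b - a) * (i / ((n : ℝ) + 1)) with hx
    have hstep : ∀ i : ℕ, x (i + 1) - x i = (b - a) * (1 / ((n : ℝ) + 1)) := fun i => by
      simp only [hx]
      push_cast
      field_simp
      ring
    have h0 : x 0 = a := by simp [hx]
    have h1 : x (n + 1) = b := by
      simp only [hx]
      push_cast
      field_simp
      ring
    have hpos : 0 ≤ (b - a) * (1 / ((n : ℝ) + 1)) := mul_nonneg (by linarith) (by positivity)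
    have hmono : Monotone x := monotone_nat_of_le_succ fun i => by linarith [hstep i]
    have hsum := Finset.sum_le_sum fun i (hi : i ∈ Finset.range (n + 1)) =>
      H (x i) (x (i + 1)) (h0 ▸ hmono (Nat.zero_le i)) (hmono (Nat.le_succ i))
        (h1 ▸ hmono (Nat.succ_le_of_lt (Finset.mem_range.1 hi)))
    simp only [hstep, Finset.sum_add_distrib, ← Finset.sum_mul, ← Finset.mul_sum] at hsum
    rw [Finset.sum_range_sub (fun i => p (x i)), Finset.sum_range_sub (fun i => G (x i)), h0,
      h1] at hsum
    have e := Finset.sum_range_sub' (fun i => Φ (x i)) (n + 1)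
    rw [Finset.sum_sub_distrib, h0, h1] at e
    linarith
  have hlim := (tendsto_one_div_add_atTop_nhds_zero_nat (𝕜 := ℝ)).const_mul
    (C * (p b - p a) * (b - a))
  rw [mul_zero] at hlim
  linarith [ge_of_tendsto' hlim key]

/-- The product rule for functions with absolutely continuous increments. -/
theorem mul_conj_increments {f g κf κg : ℝ → ℂ} {p q : ℝ} (hpq : p ≤ q)
    (hf : IntegrableOn κf (Ioc p q) volume) (hg : IntegrableOn κg (Ioc p q) volume)
    (hf' : ∀ x ∈ Icc p q, ∀ y ∈ Icc p q, x ≤ y → f y - f x = ∫ t in Ioc x y, κf t)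
    (hg' : ∀ x ∈ Icc p q, ∀ y ∈ Icc p q, x ≤ y → g y - g x = ∫ t in Ioc x y, κg t) :
    IntegrableOn (fun t => κf t * (starRingEnd ℂ) (g t) + (starRingEnd ℂ) (κg t) * f t)
      (Ioc p q) volume ∧
    f q * (starRingEnd ℂ) (g q) - f p * (starRingEnd ℂ) (g p)
      = ∫ t in Ioc p q, (κf t * (starRingEnd ℂ) (g t) + (starRingEnd ℂ) (κg t) * f t) := by
  have hgc : ContinuousOn (fun t => (starRingEnd ℂ) (g t)) (Icc p q) :=
    Complex.continuous_conj.comp_continuousOn (continuousOn_of_increments hg hg')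
  obtain ⟨h1, h2⟩ := integral_parts (ν := 0) (κ₂ := 0) (N := f) hpq hf integrableOn_zero
    (IntegrableOn.conj hg) (φ := fun t => (starRingEnd ℂ) (g t)) (fun x hx y hy hxy => by
      rw [← map_sub, hg' x hx y hy hxy, ← integral_conj]) (fun x hx y hy hxy => by
      rw [hf' x hx y hy hxy]
      simp)
  have h3 := integrableOn_mul_of_continuousOn hf hgc
  refine ⟨Integrable.add h3 h1, ?_⟩
  rw [integral_add h3 h1, ← h2]
  simp [add_comm]

theorem re_setIntegral {f : ℝ → ℂ} {s : Set ℝ} (hf : IntegrableOn f s volume) :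
    IntegrableOn (fun t => (f t).re) s volume ∧ ∫ t in s, (f t).re = (∫ t in s, f t).re :=
  ⟨Complex.reCLM.integrable_comp hf, Complex.reCLM.integral_comp_comm hf⟩

/-- The first order system satisfied by `u` and `w = hαu' + ibu` on `[a, ∞)` when `P(h) u = E u + G`
there and there is no singular potential. -/
structure HalfLineSystem (h a : ℝ) (α β b Q : ℝ → ℝ) (u w G : ℝ → ℂ) : Prop where
  integrableOn_u : ∀ y, IntegrableOn (fun t => (w t - Complex.I * b t * u t) / (h * α t)) (Ioc a y)
    volume
  integrableOn_w : ∀ y, IntegrableOn (fun t =>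
    (-(Complex.I * b t * w t / α t) - Q t * u t - G t / β t) / h) (Ioc a y) volume
  increments_u : ∀ x y, a ≤ x → x ≤ y →
    u y - u x = ∫ t in Ioc x y, (w t - Complex.I * b t * u t) / (h * α t)
  increments_w : ∀ x y, a ≤ x → x ≤ y → w y - w x
    = ∫ t in Ioc x y, (-(Complex.I * b t * w t / α t) - Q t * u t - G t / β t) / h

namespace HalfLineSystem

theorem w_density_eq (h : ℝ) (α β b Q : ℝ → ℝ) (u w G : ℝ → ℂ) (t : ℝ) : (-(Complex.I * b t * w t / α t) - Q t * u t - G t / β t) / h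
    = ((h⁻¹ : ℝ) : ℂ) * (-(Complex.I * ((b t * (α t)⁻¹ : ℝ) : ℂ) * w t) - Q t * u t
      - (((β t)⁻¹ : ℝ) : ℂ) * G t) := by
  push_cast
  ring

variable {h a : ℝ} {α β b Q : ℝ → ℝ} {u w G : ℝ → ℂ} (S : HalfLineSystem h a α β b Q u w G)
include S

/-- In 2 Re(u'ū) the magnetic term is the real part of an imaginary multiple of |u|², hence zero. -/
theorem increments_normSq_u {x y : ℝ} (hx : a ≤ x) (hxy : x ≤ y) :
    IntegrableOn (fun t => 2 * (w t * (starRingEnd ℂ) (u t)).re / (h * α t)) (Ioc x y) volume ∧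
    ‖u y‖ ^ 2 - ‖u x‖ ^ 2
      = ∫ t in Ioc x y, 2 * (w t * (starRingEnd ℂ) (u t)).re / (h * α t) := by
  have hi := (S.integrableOn_u y).mono_set (Ioc_subset_Ioc_left hx)
  have hinc := fun s (hs : s ∈ Icc x y) t (_ : t ∈ Icc x y) hst =>
    S.increments_u s t (hx.trans hs.1) hst
  obtain ⟨h1, h2⟩ := mul_conj_increments hxy hi hi hinc hinc
  obtain ⟨h3, h4⟩ := re_setIntegral h1
  rw [← h2, Complex.sub_re, Complex.mul_conj, Complex.mul_conj, Complex.ofReal_re,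
    Complex.ofReal_re, Complex.normSq_eq_norm_sq, Complex.normSq_eq_norm_sq] at h4
  have e : (fun t => ((w t - Complex.I * b t * u t) / (h * α t) * (starRingEnd ℂ) (u t)
      + (starRingEnd ℂ) ((w t - Complex.I * b t * u t) / (h * α t)) * u t).re)
      = fun t => 2 * (w t * (starRingEnd ℂ) (u t)).re / (h * α t) := by
    funext t
    rw [← Complex.ofReal_mul, Complex.add_re, div_mul_eq_mul_div, map_div₀, Complex.conj_ofReal,
      div_mul_eq_mul_div, Complex.div_ofReal_re, Complex.div_ofReal_re, ← add_div]
    congr 1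
    simp only [Complex.mul_re, Complex.mul_im, Complex.sub_re, Complex.sub_im, Complex.I_re,
      Complex.I_im, Complex.ofReal_re, Complex.ofReal_im, Complex.conj_re, Complex.conj_im]
    ring
  rw [e] at h3 h4
  exact ⟨h3, h4.symm⟩

/-- The magnetic term drops out as for |u|². The potential term is written as -αQ times the density
of |u|², so that it cancels against the increment of q|u|² with q = αQ. -/
theorem increments_normSq_w (hα : ∀ t, 0 < α t) {x y : ℝ} (hx : a ≤ x) (hxy : x ≤ y) :
    IntegrableOn (fun t => -(α t * Q t) * (2 * (w t * (starRingEnd ℂ) (u t)).re / (h * α t))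
      - 2 / h * ((G t * (starRingEnd ℂ) (w t)).re / β t)) (Ioc x y) volume ∧
    ‖w y‖ ^ 2 - ‖w x‖ ^ 2
      = ∫ t in Ioc x y, (-(α t * Q t) * (2 * (w t * (starRingEnd ℂ) (u t)).re / (h * α t))
        - 2 / h * ((G t * (starRingEnd ℂ) (w t)).re / β t)) := by
  have hi := (S.integrableOn_w y).mono_set (Ioc_subset_Ioc_left hx)
  have hinc := fun s (hs : s ∈ Icc x y) t (_ : t ∈ Icc x y) hst =>
    S.increments_w s t (hx.trans hs.1) hst
  obtain ⟨h1, h2⟩ := mul_conj_increments hxy hi hi hinc hinc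
  obtain ⟨h3, h4⟩ := re_setIntegral h1
  rw [← h2, Complex.sub_re, Complex.mul_conj, Complex.mul_conj, Complex.ofReal_re,
    Complex.ofReal_re, Complex.normSq_eq_norm_sq, Complex.normSq_eq_norm_sq] at h4
  have e : (fun t => ((-(Complex.I * b t * w t / α t) - Q t * u t - G t / β t) / h *
      (starRingEnd ℂ) (w t) + (starRingEnd ℂ) ((-(Complex.I * b t * w t / α t) - Q t * u t
        - G t / β t) / h) * w t).re)
      = fun t => -(α t * Q t) * (2 * (w t * (starRingEnd ℂ) (u t)).re / (h * α t))
        - 2 / h * ((G t * (starRingEnd ℂ) (w t)).re / β t) := by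
    funext t
    have hαt := (hα t).ne'
    have e1 : α t * Q t * (2 * (w t * (starRingEnd ℂ) (u t)).re / (h * α t))
        = 2 * Q t * (w t * (starRingEnd ℂ) (u t)).re * h⁻¹ := by
      field_simp
    rw [neg_mul, e1, w_density_eq]
    simp only [Complex.mul_re, Complex.mul_im, Complex.sub_re, Complex.sub_im, Complex.I_re,
      Complex.I_im, Complex.ofReal_re, Complex.ofReal_im, Complex.conj_re, Complex.conj_im,
      Complex.neg_re, Complex.neg_im, Complex.add_re, map_mul, map_sub, map_neg]
    ring
  rw [e] at h3 h4
  exact ⟨h3, h4.symm⟩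

/-- The term -ibwū/α from w' cancels the term from the conjugate of u'; what remains exchanges |w|²
for |u|². -/
theorem increments_mul_conj (hh : 0 < h) {x y : ℝ} (hx : a ≤ x) (hxy : x ≤ y) :
    IntegrableOn (fun t => ‖w t‖ ^ 2 / α t - Q t * ‖u t‖ ^ 2
      - (G t * (starRingEnd ℂ) (u t)).re / β t) (Ioc x y) volume ∧
    h * ((w y * (starRingEnd ℂ) (u y)).re - (w x * (starRingEnd ℂ) (u x)).re)
      = ∫ t in Ioc x y, (‖w t‖ ^ 2 / α t - Q t * ‖u t‖ ^ 2
      - (G t * (starRingEnd ℂ) (u t)).re / β t) := by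
  have hiu := (S.integrableOn_u y).mono_set (Ioc_subset_Ioc_left hx)
  have hiw := (S.integrableOn_w y).mono_set (Ioc_subset_Ioc_left hx)
  obtain ⟨h1, h2⟩ := mul_conj_increments hxy hiw hiu
    (fun s hs t _ hst => S.increments_w s t (hx.trans hs.1) hst)
    (fun s hs t _ hst => S.increments_u s t (hx.trans hs.1) hst)
  obtain ⟨h3, h4⟩ := re_setIntegral h1
  rw [← h2, Complex.sub_re] at h4
  have e : (fun t => ((-(Complex.I * b t * w t / α t) - Q t * u t - G t / β t) / h *
      (starRingEnd ℂ) (u t) + (starRingEnd ℂ) ((w t - Complex.I * b t * u t) / (h * α t)) *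
        w t).re)
      = fun t => h⁻¹ * (‖w t‖ ^ 2 / α t - Q t * ‖u t‖ ^ 2
      - (G t * (starRingEnd ℂ) (u t)).re / β t) := by
    funext t
    have e1 : (w t - Complex.I * b t * u t) / (h * α t)
        = ((h⁻¹ * (α t)⁻¹ : ℝ) : ℂ) * (w t - Complex.I * b t * u t) := by
      push_cast
      ring
    rw [e1, w_density_eq, ← Complex.normSq_eq_norm_sq, ← Complex.normSq_eq_norm_sq]
    simp only [Complex.mul_re, Complex.mul_im, Complex.sub_re, Complex.sub_im, Complex.I_re,
      Complex.I_im, Complex.ofReal_re, Complex.ofReal_im, Complex.conj_re, Complex.conj_im,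
      Complex.neg_re, Complex.neg_im, Complex.add_re, map_mul, map_sub, Complex.normSq_apply]
    ring
  rw [e] at h3 h4
  rw [integral_const_mul] at h4
  refine ⟨?_, ?_⟩
  · refine (h3.const_mul h).congr (Eventually.of_forall fun t => ?_)
    field_simp
  · rw [← h4]
    field_simp

/-- The exterior energy estimate. -/
theorem energy_le (hh : 0 < h) {m : ℝ} (hm : 0 < m) (hα : ∀ t, m ≤ α t) {q p : ℝ → ℝ}
    {P τ K Kq : ℝ} (hτ : 0 < τ)
    (hQ : ∀ᵐ t, a < t → α t * Q t = q t)
    (hqp : ∀ x y, a ≤ x → x ≤ y → |q y - q x| ≤ p y - p x)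
    (hp : ∀ x, 0 ≤ p x) (hP : ∀ x, p x ≤ P) (hqτ : ∀ x, a ≤ x → τ ≤ q x)
    (hqK : ∀ x, a ≤ x → q x ≤ Kq)
    (hu : ∀ x, ‖u x‖ ≤ K) (hw : ∀ x, ‖w x‖ ≤ K)
    (iu : IntegrableOn (fun t => ‖u t‖ ^ 2) (Ioi a) volume)
    (iw : IntegrableOn (fun t => ‖w t‖ ^ 2) (Ioi a) volume)
    (iG : IntegrableOn (fun t => (G t * (starRingEnd ℂ) (w t)).re / β t) (Ioi a) volume) :
    ‖w a‖ ^ 2 + q a * ‖u a‖ ^ 2 ≤ Real.exp (P / τ) * (2 / h *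
      ∫ t in Ioi a, |(G t * (starRingEnd ℂ) (w t)).re / β t|) := by
  have hK : 0 ≤ K := (norm_nonneg _).trans (hu 0)
  have hα0 : ∀ t, 0 < α t := fun t => hm.trans_le (hα t)
  set ρ : ℝ → ℝ := fun t => 2 * (w t * (starRingEnd ℂ) (u t)).re / (h * α t) with hρ
  set e : ℝ → ℝ := fun t => (G t * (starRingEnd ℂ) (w t)).re / β t with he
  set F : ℝ → ℝ := fun x => ‖w x‖ ^ 2 + q x * ‖u x‖ ^ 2 with hF
  set L := 2 * (K * K) / (h * m) with hL
  have hρL : ∀ t, |ρ t| ≤ L := fun t => by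
    simp only [hρ, hL]
    rw [abs_div, abs_mul, abs_two, abs_of_pos (mul_pos hh (hα0 t))]
    refine div_le_div₀ (by positivity) (mul_le_mul_of_nonneg_left ?_ (by norm_num))
      (mul_pos hh hm) (mul_le_mul_of_nonneg_left (hα t) hh.le)
    refine (Complex.abs_re_le_norm _).trans ?_
    rw [norm_mul, RCLike.norm_conj]
    exact mul_le_mul (hw t) (hu t) (norm_nonneg _) hK
  have iea : ∀ x y, a ≤ x → IntegrableOn (fun t => |e t|) (Ioc x y) volume := fun x y hx =>
    IntegrableOn.mono_set iG.abs (Ioc_subset_Ioi_self.trans (Ioi_subset_Ioi hx))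
  -- The increment of F is that of |w|², plus q(x) times that of |u|², plus |u(y)|² times that of q.
  -- Freezing q at x in the first two costs at most the product of the increments of p and of the
  -- position; in the third, τ|u|² ≤ F is used.
  have hstep : ∀ x y, a ≤ x → x ≤ y → F x ≤ F y * (1 + (p y - p x) / τ)
      + L * (p y - p x) * (y - x) + 2 / h * ∫ t in Ioc x y, |e t| := by
    intro x y hx hxy
    obtain ⟨hi1, hU⟩ := S.increments_normSq_u hx hxy
    obtain ⟨hi2, hW⟩ := S.increments_normSq_w hα0 hx hxy
    have hΔ : 0 ≤ p y - p x := (abs_nonneg _).trans (hqp x y hx hxy)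
    have hvol : ∫ t in Ioc x y, L * (p y - p x) = L * (p y - p x) * (y - x) := by
      rw [setIntegral_const, measureReal_def, Real.volume_Ioc,
        ENNReal.toReal_ofReal (sub_nonneg.2 hxy), smul_eq_mul, mul_comm]
    have h1 : -(L * (p y - p x) * (y - x)) - 2 / h * ∫ t in Ioc x y, |e t|
        ≤ (∫ t in Ioc x y, (-(α t * Q t) * ρ t - 2 / h * e t)) + q x * ∫ t in Ioc x y, ρ t := by
      have ic : IntegrableOn (fun _ : ℝ => -(L * (p y - p x))) (Ioc x y) volume :=
        integrableOn_const (by simp)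
      rw [← integral_const_mul, ← integral_const_mul (q x), ← hvol, ← integral_neg,
        ← integral_sub ic ((iea x y hx).const_mul _), ← integral_add hi2 (hi1.const_mul _)]
      refine setIntegral_mono_on_ae (Integrable.sub ic ((iea x y hx).const_mul _))
        (Integrable.add hi2 (hi1.const_mul _)) measurableSet_Ioc ?_
      filter_upwards [hQ] with t ht htxy
      rw [ht (hx.trans_lt htxy.1)]
      have e1 : |q t - q x| ≤ p y - p x := (hqp x t hx htxy.1.le).trans
        (by linarith [(abs_nonneg _).trans (hqp t y (hx.trans htxy.1.le) htxy.2)])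
      have e2 : (q t - q x) * ρ t ≤ L * (p y - p x) := by
        refine (le_abs_self _).trans ?_
        rw [abs_mul, mul_comm L]
        exact mul_le_mul e1 (hρL t) (abs_nonneg _) hΔ
      have e3 : 2 / h * e t ≤ 2 / h * |e t| :=
        mul_le_mul_of_nonneg_left (le_abs_self _) (by positivity)
      linarith
    rw [← hW, ← hU] at h1
    have h2 : -((p y - p x) / τ * F y) ≤ (q y - q x) * ‖u y‖ ^ 2 := by
      have e1 := (abs_le.1 (hqp x y hx hxy)).1
      have e2 : τ * ‖u y‖ ^ 2 ≤ F y := by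
        have := mul_le_mul_of_nonneg_right (hqτ y (hx.trans hxy)) (sq_nonneg ‖u y‖)
        simp only [hF]
        nlinarith [sq_nonneg ‖w y‖]
      have e3 : (p y - p x) * ‖u y‖ ^ 2 ≤ (p y - p x) / τ * F y := by
        rw [div_mul_eq_mul_div, le_div_iff₀ hτ, mul_assoc]
        exact mul_le_mul_of_nonneg_left (by linarith) hΔ
      nlinarith [mul_le_mul_of_nonneg_right e1 (sq_nonneg ‖u y‖)]
    simp only [hF] at h2 ⊢
    linarith
  have hF0 : ∀ x, a ≤ x → 0 ≤ F x := fun x hx => by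
    have := hτ.le.trans (hqτ x hx)
    simp only [hF]
    positivity
  have hexp : ∀ x, 1 ≤ Real.exp (p x / τ) ∧ Real.exp (p x / τ) ≤ Real.exp (P / τ) := fun x =>
    ⟨Real.one_le_exp (div_nonneg (hp x) hτ.le),
      Real.exp_le_exp.2 (div_le_div_of_nonneg_right (hP x) hτ.le)⟩
  set I : ℝ := 2 / h * ∫ t in Ioi a, |e t| with hI
  have hmain : ∀ y, a ≤ y → F a ≤ Real.exp (P / τ) * (F y + I) := by
    intro y hay
    -- The integrating factor exp(p/τ) absorbs 1 + (p(z) - p(x))/τ, because 1 + t ≤ exp t, and it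
    -- stays between 1 and exp(P/τ).
    have h1 := le_of_forall_le_add_mul_increments (Φ := fun x => Real.exp (p x / τ) * F x) (p := p)
      (G := fun x => Real.exp (P / τ) * (2 / h * ∫ t in Ioc a x, |e t|))
      (C := Real.exp (P / τ) * L) hay fun x z hx hxz hz => by
        have e1 := hstep x z hx hxz
        have e2 : 1 + (p z - p x) / τ ≤ Real.exp ((p z - p x) / τ) := by
          rw [add_comm]
          exact Real.add_one_le_exp _
        have hΔ : 0 ≤ p z - p x := (abs_nonneg _).trans (hqp x z hx hxz)
        have e3 : (∫ t in Ioc a z, |e t|) - ∫ t in Ioc a x, |e t| = ∫ t in Ioc x z, |e t| := by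
          rw [sub_eq_iff_eq_add, add_comm, ← setIntegral_union (Ioc_disjoint_Ioc_of_le le_rfl)
            measurableSet_Ioc (iea a x le_rfl) (iea x z hx), Ioc_union_Ioc_eq_Ioc hx hxz]
        have e4 : 0 ≤ ∫ t in Ioc x z, |e t| := integral_nonneg fun _ => abs_nonneg _
        have e5 : 0 ≤ L * (p z - p x) * (z - x) + 2 / h * ∫ t in Ioc x z, |e t| := by
          have : 0 ≤ z - x := by linarith
          positivity
        have e6 := mul_le_mul_of_nonneg_left e1 (Real.exp_pos (p x / τ)).le
        have e7 := mul_le_mul_of_nonneg_right (hexp x).2 e5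
        have e8 : Real.exp (p x / τ) * (F z * (1 + (p z - p x) / τ)) ≤ Real.exp (p z / τ) * F z := by
          have : Real.exp (p z / τ) = Real.exp (p x / τ) * Real.exp ((p z - p x) / τ) := by
            rw [← Real.exp_add]
            congr 1
            ring
          rw [this, mul_assoc, mul_comm (F z)]
          exact mul_le_mul_of_nonneg_left
            (mul_le_mul_of_nonneg_right e2 (hF0 z (hx.trans hxz))) (Real.exp_pos _).le
        rw [← mul_sub, ← mul_sub, e3]
        linarith
    simp only [Ioc_self, Measure.restrict_empty, integral_zero_measure, mul_zero, sub_zero] at h1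
    have h2 : ∫ t in Ioc a y, |e t| ≤ ∫ t in Ioi a, |e t| :=
      setIntegral_mono_set iG.abs (Eventually.of_forall fun _ => abs_nonneg _)
        (Eventually.of_forall fun t ht => ht.1)
    have h3 := mul_le_mul_of_nonneg_right (hexp a).1 (hF0 a le_rfl)
    have h4 := mul_le_mul_of_nonneg_right (hexp y).2 (hF0 y hay)
    have h5 := mul_le_mul_of_nonneg_left (mul_le_mul_of_nonneg_left h2
      (show 0 ≤ 2 / h by positivity)) (Real.exp_pos (P / τ)).le
    rw [mul_add]
    linarith
  -- F is dominated by the integrable function |w|² + Kq|u|², so it tends to zero along a sequence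
  -- and only the source remains.
  obtain ⟨x, -, hax, hx0⟩ := exists_seq_tendsto_of_integrableOn_Ioi
    (Integrable.add iw (iu.const_mul Kq))
  have hlim : Tendsto (fun n => Real.exp (P / τ) * ((‖w (x n)‖ ^ 2 + Kq * ‖u (x n)‖ ^ 2) + I)) atTop
      (𝓝 (Real.exp (P / τ) * (0 + I))) := (hx0.add_const I).const_mul _
  rw [zero_add] at hlim
  refine ge_of_tendsto' hlim fun n => (hmain (x n) (hax n).le).trans ?_
  refine mul_le_mul_of_nonneg_left (add_le_add_left ?_ I) (Real.exp_pos _).le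
  exact add_le_add_right (mul_le_mul_of_nonneg_right (hqK _ (hax n).le) (sq_nonneg _)) _

/-- The integral of `|w|²` is controlled by that of `|u|²`. -/
theorem integral_normSq_w_le (hh : 0 < h) {M Kq : ℝ} (hM : 0 < M) (hα : ∀ t, 0 < α t)
    (hα' : ∀ t, α t ≤ M) (hQ : ∀ᵐ t, a < t → Q t ≤ Kq) {X : ℝ}
    (hX : ∀ x, a ≤ x → |(w x * (starRingEnd ℂ) (u x)).re| ≤ X)
    (iu : IntegrableOn (fun t => ‖u t‖ ^ 2) (Ioi a) volume)
    (iw : IntegrableOn (fun t => ‖w t‖ ^ 2) (Ioi a) volume)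
    (iG : IntegrableOn (fun t => (G t * (starRingEnd ℂ) (u t)).re / β t) (Ioi a) volume) :
    ∫ t in Ioi a, ‖w t‖ ^ 2 ≤ M * (2 * h * X + Kq * (∫ t in Ioi a, ‖u t‖ ^ 2)
      + ∫ t in Ioi a, (G t * (starRingEnd ℂ) (u t)).re / β t) := by
  have tend : ∀ {f : ℝ → ℝ}, IntegrableOn f (Ioi a) volume →
      Tendsto (fun n : ℕ => ∫ t in Ioc a (a + n), f t) atTop (𝓝 (∫ t in Ioi a, f t)) := by
    intro f hf
    have h1 := intervalIntegral_tendsto_integral_Ioi a hf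
      (tendsto_atTop_add_const_left atTop a tendsto_natCast_atTop_atTop)
    refine h1.congr fun n => ?_
    rw [intervalIntegral.integral_of_le (by simp)]
  refine le_of_tendsto_of_tendsto' (tend iw)
    ((((tend iu).const_mul Kq).const_add (2 * h * X)).add (tend iG) |>.const_mul M) fun n => ?_
  have han : a ≤ a + n := by simp
  -- The identity for Re(wū) is integrated over (a, a + n]. Its two boundary values are bounded by
  -- X, which is the origin of 2hX.
  obtain ⟨hi, hX'⟩ := S.increments_mul_conj hh le_rfl han
  have ju : IntegrableOn (fun t => ‖u t‖ ^ 2) (Ioc a (a + n)) volume :=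
    iu.mono_set Ioc_subset_Ioi_self
  have jw : IntegrableOn (fun t => ‖w t‖ ^ 2) (Ioc a (a + n)) volume :=
    iw.mono_set Ioc_subset_Ioi_self
  have jG : IntegrableOn (fun t => (G t * (starRingEnd ℂ) (u t)).re / β t) (Ioc a (a + n)) volume :=
    iG.mono_set Ioc_subset_Ioi_self
  have h1 : M⁻¹ * (∫ t in Ioc a (a + n), ‖w t‖ ^ 2) - Kq * (∫ t in Ioc a (a + n), ‖u t‖ ^ 2)
      - ∫ t in Ioc a (a + n), (G t * (starRingEnd ℂ) (u t)).re / β t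
      ≤ ∫ t in Ioc a (a + n), (‖w t‖ ^ 2 / α t - Q t * ‖u t‖ ^ 2
      - (G t * (starRingEnd ℂ) (u t)).re / β t) := by
    have k1 : IntegrableOn (fun t => M⁻¹ * ‖w t‖ ^ 2 - Kq * ‖u t‖ ^ 2) (Ioc a (a + n)) volume :=
      Integrable.sub (jw.const_mul _) (ju.const_mul _)
    rw [← integral_const_mul, ← integral_const_mul, ← integral_sub (jw.const_mul _)
      (ju.const_mul _), ← integral_sub k1 jG]
    refine setIntegral_mono_on_ae (Integrable.sub k1 jG) hi measurableSet_Ioc ?_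
    filter_upwards [hQ] with t ht htm
    have e1 : M⁻¹ * ‖w t‖ ^ 2 ≤ ‖w t‖ ^ 2 / α t := by
      rw [div_eq_inv_mul]
      exact mul_le_mul_of_nonneg_right (inv_anti₀ (hα t) (hα' t)) (sq_nonneg _)
    have e2 := mul_le_mul_of_nonneg_right (ht htm.1) (sq_nonneg ‖u t‖)
    linarith
  rw [← hX'] at h1
  have h2 := (abs_le.1 (hX a le_rfl)).1
  have h3 := (abs_le.1 (hX _ han)).2
  have h4 : M⁻¹ * (∫ t in Ioc a (a + n), ‖w t‖ ^ 2) ≤ 2 * h * X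
      + Kq * (∫ t in Ioc a (a + n), ‖u t‖ ^ 2)
      + ∫ t in Ioc a (a + n), (G t * (starRingEnd ℂ) (u t)).re / β t := by
    nlinarith
  rwa [inv_mul_le_iff₀ hM] at h4

end HalfLineSystem

end MagneticSchrodinger

end

/-! ### The estimate in terms of suprema, and right limits of functions of bounded variation. -/

noncomputable section

namespace MagneticSchrodinger

open Filter Topology

/-- The exterior estimate in terms of the suprema `s`, `σ s` of `|w|`, `|u|` and the `L¹` norm of
the source term. -/
theorem HalfLineSystem.energy_le_of_bound {h a : ℝ} {α β b Q : ℝ → ℝ} {u w v : ℝ → ℂ} {ε : ℝ}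
    (S : HalfLineSystem h a α β b Q u w fun t => v t + Complex.I * ε * u t)
    (hh : 0 < h) {m M : ℝ} (hm : 0 < m) (hα : ∀ t, m ≤ α t) (hα' : ∀ t, α t ≤ M)
    (hβ : ∀ t, m ≤ β t) {q p : ℝ → ℝ}
    {P τ K Kq KQ σ s D γ : ℝ} (hτ : 0 < τ)
    (hQ : ∀ᵐ t, a < t → α t * Q t = q t)
    (hqp : ∀ x y, a ≤ x → x ≤ y → |q y - q x| ≤ p y - p x)
    (hp : ∀ x, 0 ≤ p x) (hP : ∀ x, p x ≤ P) (hqτ : ∀ x, a ≤ x → τ ≤ q x)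
    (hqK : ∀ x, a ≤ x → q x ≤ Kq) (hQK : ∀ᵐ t, a < t → Q t ≤ KQ) (hKQ : 0 ≤ KQ)
    (hu : ∀ x, ‖u x‖ ≤ K) (hw : ∀ x, ‖w x‖ ≤ K)
    (iu : IntegrableOn (fun t => ‖u t‖ ^ 2) (Ioi a) volume)
    (iw : IntegrableOn (fun t => ‖w t‖ ^ 2) (Ioi a) volume)
    (iv : IntegrableOn (fun t => ‖v t‖) (Ioi a) volume)
    (iGw : IntegrableOn (fun t => ((v t + Complex.I * ε * u t) * (starRingEnd ℂ) (w t)).re / β t)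
      (Ioi a) volume)
    (iGu : IntegrableOn (fun t => ((v t + Complex.I * ε * u t) * (starRingEnd ℂ) (u t)).re / β t)
      (Ioi a) volume)
    (hs : 0 ≤ s) (hws : ∀ x, a ≤ x → ‖w x‖ ≤ s) (hus : ∀ x, a ≤ x → ‖u x‖ ≤ σ * s)
    (hD : |ε| * (∫ t in Ioi a, ‖u t‖ ^ 2) ≤ D) (hγ : ∫ t in Ioi a, ‖v t‖ ≤ γ) :
    ‖w a‖ ^ 2 + q a * ‖u a‖ ^ 2 ≤ Real.exp (P / τ) * (2 / (h * m) * (s * γ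
      + (M * (2 * h * σ * s ^ 2 * |ε| + KQ * D + |ε| * (σ * s * γ / m)) + D) / 2)) := by
  have hM : 0 < M := hm.trans_le ((hα 0).trans (hα' 0))
  have hm' := inv_pos.2 hm
  have hσs : 0 ≤ σ * s := (norm_nonneg _).trans (hus a le_rfl)
  have hu0 : 0 ≤ ∫ t in Ioi a, ‖u t‖ ^ 2 := integral_nonneg fun _ => by positivity
  have hβ0 : ∀ t, 0 < β t := fun t => hm.trans_le (hβ t)
  have hβi : ∀ t, (β t)⁻¹ ≤ m⁻¹ := fun t => inv_anti₀ hm (hβ t)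
  have h1 := S.energy_le hh hm hα hτ hQ hqp hp hP hqτ hqK hu hw iu iw iGw
  have h2 := S.integral_normSq_w_le hh hM (fun t => hm.trans_le (hα t)) hα' hQK
    (X := σ * s ^ 2) (fun x hx => by
      refine (Complex.abs_re_le_norm _).trans ?_
      rw [norm_mul, RCLike.norm_conj]
      refine (mul_le_mul (hws x hx) (hus x hx) (norm_nonneg _) hs).trans (le_of_eq ?_)
      ring) iu iw iGu
  have h3 : ∫ t in Ioi a, ((v t + Complex.I * ε * u t) * (starRingEnd ℂ) (u t)).re / β t
      ≤ σ * s * γ / m := by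
    calc _ ≤ ∫ t in Ioi a, m⁻¹ * (σ * s) * ‖v t‖ := by
          refine setIntegral_mono_on iGu (iv.const_mul _) measurableSet_Ioi fun t ht => ?_
          -- The contribution iε|u|² is imaginary, so only v is left in the source paired with u.
          have e1 : ((v t + Complex.I * ε * u t) * (starRingEnd ℂ) (u t)).re
              = (v t * (starRingEnd ℂ) (u t)).re := by
            rw [add_mul, Complex.add_re, mul_assoc (Complex.I * ε), Complex.mul_conj,
              mul_assoc, ← Complex.ofReal_mul, Complex.I_mul_re, Complex.ofReal_im, neg_zero,
              add_zero]
          have e2 : (v t * (starRingEnd ℂ) (u t)).re ≤ ‖v t‖ * (σ * s) := by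
            refine (le_abs_self _).trans ((Complex.abs_re_le_norm _).trans ?_)
            rw [norm_mul, RCLike.norm_conj]
            exact mul_le_mul_of_nonneg_left (hus t (le_of_lt ht)) (norm_nonneg _)
          rw [e1, div_eq_inv_mul]
          calc (β t)⁻¹ * (v t * (starRingEnd ℂ) (u t)).re
              ≤ (β t)⁻¹ * (‖v t‖ * (σ * s)) :=
                mul_le_mul_of_nonneg_left e2 (inv_pos.2 (hβ0 t)).le
            _ ≤ m⁻¹ * (‖v t‖ * (σ * s)) := mul_le_mul_of_nonneg_right (hβi t) (by positivity)
            _ = _ := by ring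
      _ = m⁻¹ * (σ * s) * ∫ t in Ioi a, ‖v t‖ := integral_const_mul _ _
      _ ≤ m⁻¹ * (σ * s) * γ := mul_le_mul_of_nonneg_left hγ (by positivity)
      _ = _ := by ring
  -- Multiplied by |ε|, the integral of |u|² is bounded by D, and the boundary term becomes a
  -- multiple of h|ε|s².
  have h4 : |ε| * ∫ t in Ioi a, ‖w t‖ ^ 2
      ≤ M * (2 * h * σ * s ^ 2 * |ε| + KQ * D + |ε| * (σ * s * γ / m)) := by
    have e1 := mul_le_mul_of_nonneg_left h3 (abs_nonneg ε)
    have e2 := mul_le_mul_of_nonneg_left hD hKQ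
    calc _ ≤ |ε| * (M * (2 * h * (σ * s ^ 2) + KQ * (∫ t in Ioi a, ‖u t‖ ^ 2)
          + ∫ t in Ioi a, ((v t + Complex.I * ε * u t) * (starRingEnd ℂ) (u t)).re / β t)) :=
          mul_le_mul_of_nonneg_left h2 (abs_nonneg ε)
      _ = M * (2 * h * σ * s ^ 2 * |ε| + KQ * (|ε| * ∫ t in Ioi a, ‖u t‖ ^ 2)
          + |ε| * ∫ t in Ioi a, ((v t + Complex.I * ε * u t) * (starRingEnd ℂ) (u t)).re / β t) := by
          ring
      _ ≤ _ := mul_le_mul_of_nonneg_left (by linarith) hM.le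
  have i5 : IntegrableOn (fun t => s * ‖v t‖ + |ε| / 2 * (‖u t‖ ^ 2 + ‖w t‖ ^ 2)) (Ioi a) volume :=
    Integrable.add (iv.const_mul _) ((Integrable.add iu iw).const_mul _)
  have h5 : ∫ t in Ioi a, |((v t + Complex.I * ε * u t) * (starRingEnd ℂ) (w t)).re / β t|
      ≤ m⁻¹ * (s * γ + (M * (2 * h * σ * s ^ 2 * |ε| + KQ * D + |ε| * (σ * s * γ / m)) + D) / 2) := by
    calc _ ≤ ∫ t in Ioi a, m⁻¹ * (s * ‖v t‖ + |ε| / 2 * (‖u t‖ ^ 2 + ‖w t‖ ^ 2)) := by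
          refine setIntegral_mono_on iGw.abs (i5.const_mul _) measurableSet_Ioi fun t ht => ?_
          -- The product |ε||u||w| is split evenly, so that both squares are controlled after
          -- multiplication by |ε|.
          have e2 : |((v t + Complex.I * ε * u t) * (starRingEnd ℂ) (w t)).re|
              ≤ s * ‖v t‖ + |ε| / 2 * (‖u t‖ ^ 2 + ‖w t‖ ^ 2) := by
            refine (Complex.abs_re_le_norm _).trans ?_
            rw [add_mul]
            refine (norm_add_le _ _).trans (add_le_add ?_ ?_)
            · rw [norm_mul, RCLike.norm_conj, mul_comm]
              exact mul_le_mul_of_nonneg_right (hws t (le_of_lt ht)) (norm_nonneg _)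
            · rw [norm_mul, norm_mul, norm_mul, Complex.norm_I, RCLike.norm_conj, one_mul,
                Complex.norm_real, Real.norm_eq_abs, mul_assoc, div_mul_eq_mul_div, mul_div_assoc]
              refine mul_le_mul_of_nonneg_left ?_ (abs_nonneg ε)
              nlinarith [sq_nonneg (‖u t‖ - ‖w t‖)]
          rw [abs_div, abs_of_pos (hβ0 t), div_eq_inv_mul]
          exact mul_le_mul (hβi t) e2 (abs_nonneg _) hm'.le
      _ = m⁻¹ * (s * (∫ t in Ioi a, ‖v t‖) + (|ε| * (∫ t in Ioi a, ‖w t‖ ^ 2)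
            + |ε| * ∫ t in Ioi a, ‖u t‖ ^ 2) / 2) := by
          rw [integral_const_mul, integral_add (iv.const_mul _)
            (Integrable.const_mul (f := fun t => ‖u t‖ ^ 2 + ‖w t‖ ^ 2) (Integrable.add iu iw) _),
            integral_const_mul, integral_const_mul,
            integral_add iu iw]
          ring
      _ ≤ _ := by
          refine mul_le_mul_of_nonneg_left ?_ hm'.le
          have := mul_le_mul_of_nonneg_left hγ hs
          linarith
  refine h1.trans (mul_le_mul_of_nonneg_left ?_ (Real.exp_pos _).le)
  calc _ ≤ 2 / h * (m⁻¹ * (s * γ + (M * (2 * h * σ * s ^ 2 * |ε| + KQ * D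
        + |ε| * (σ * s * γ / m)) + D) / 2)) := mul_le_mul_of_nonneg_left h5 (by positivity)
    _ = _ := by
      rw [← mul_assoc]
      congr 1
      field_simp

section RightLimits

variable {f : ℝ → ℝ}

theorem rightLim_ae_eq_of_boundedVariationOn (hf : BoundedVariationOn f univ) :
    f.rightLim =ᵐ[volume] f := by
  filter_upwards [hf.locallyBoundedVariationOn.ae_differentiableAt] with x hx
  exact rightLim_eq_of_tendsto (hx.continuousAt.tendsto.mono_left nhdsWithin_le_nhds)

/-- A limit from the right lies in any closed set that contains almost all values. -/
theorem mem_of_tendsto_right_of_ae {l : ℝ} {x : ℝ} {s : Set ℝ} (hl : Tendsto f (𝓝[>] x) (𝓝 l))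
    (hs : IsClosed s) (h : ∀ᵐ y, f y ∈ s) : l ∈ s := by
  refine hs.mem_of_frequently_of_tendsto (fun hcon => ?_) hl
  obtain ⟨y, hy, hxy⟩ := mem_nhdsGT_iff_exists_Ioo_subset.1 hcon
  have h0 : volume (Ioo x y) = 0 := measure_mono_null hxy h
  rw [Real.volume_Ioo, ENNReal.ofReal_eq_zero] at h0
  have : x < y := hy
  linarith

/-- The variation of the derivative of `f` on `(-∞, x]`. -/
def cumVariation (hf : BoundedVariationOn f univ) (x : ℝ) : ℝ :=
  (hf.vectorMeasure.variation (Iic x)).toReal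

variable (hf : BoundedVariationOn f univ) {M : ℝ} (hM : derivNorm hf ≤ ENNReal.ofReal M)
include hM

theorem cumVariation_le (hM0 : 0 ≤ M) (x : ℝ) : cumVariation hf x ≤ M :=
  ENNReal.toReal_le_of_le_ofReal hM0 ((measure_mono (subset_univ _)).trans hM)

/-- The mass df(x, y] is the increment of the right limits; the values of f at single points are not
seen by df. -/
theorem abs_rightLim_sub_le {x y : ℝ} (hxy : x ≤ y) :
    |f.rightLim y - f.rightLim x| ≤ cumVariation hf y - cumVariation hf x := by
  have hfin : ∀ s, hf.vectorMeasure.variation s ≠ ⊤ := fun s =>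
    ne_top_of_le_ne_top ENNReal.ofReal_ne_top ((measure_mono (subset_univ s)).trans hM)
  rw [← hf.vectorMeasure_Ioc hxy, ← Real.norm_eq_abs, cumVariation, cumVariation,
    ← Iic_union_Ioc_eq_Iic hxy, measure_union (Iic_disjoint_Ioc le_rfl) measurableSet_Ioc,
    ENNReal.toReal_add (hfin _) (hfin _), add_sub_cancel_left]
  exact VectorMeasure.norm_measure_le_variation (hfin _)

end RightLimits

end MagneticSchrodinger

end

/-! ### The effective potential: positivity, bounds and variation. -/

noncomputable section

namespace MagneticSchrodinger

open Filter Topology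

namespace Coefficients

/-- The bounds on the coefficients, and the positivity for `|x| ≥ R`, that enter the exterior
estimate. -/
structure ExteriorBounds (c : Coefficients) (E Emax m M R τ : ℝ) : Prop where
  m_pos : 0 < m
  τ_pos : 0 < τ
  abs_E : |E| ≤ Emax
  le_α : ∀ x, m ≤ c.α x
  α_le : ∀ x, c.α x ≤ M
  le_β : ∀ x, m ≤ c.β x
  β_le : ∀ x, c.β x ≤ M
  V₁_le : ∀ᵐ x, |c.V₁ x| ≤ M
  b₁_le : ∀ᵐ x, |c.b₁ x| ≤ M
  derivNorm_α : derivNorm c.α_bv ≤ ENNReal.ofReal M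
  derivNorm_β : derivNorm c.β_bv ≤ ENNReal.ofReal M
  derivNorm_V₁ : derivNorm c.V₁_bv ≤ ENNReal.ofReal M
  derivNorm_b₁ : derivNorm c.b₁_bv ≤ ENNReal.ofReal M
  pos : ∀ x, R ≤ |x| → τ ≤ (c.β x)⁻¹ * c.α x * (E - c.V₁ x) + c.b₁ x ^ 2
  absV₀_eq_zero : c.absV₀ (Icc (-R) R)ᶜ = 0
  b₀_eq_zero : ∀ᵐ x, x ∉ Icc (-R) R → c.b₀ x = 0

variable (c : Coefficients)

/-- The right limits of the effective potential `β⁻¹ α (E - V₁) + b₁²`. -/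
def effective (E x : ℝ) : ℝ :=
  (c.β.rightLim x)⁻¹ * c.α.rightLim x * (E - c.V₁.rightLim x) + c.b₁.rightLim x ^ 2

/-- A nondecreasing function that dominates the variation of the effective potential. -/
def effectiveVariation (Emax m M x : ℝ) : ℝ :=
  m⁻¹ ^ 2 * M * (Emax + M) * cumVariation c.β_bv x + m⁻¹ * (Emax + M) * cumVariation c.α_bv x
    + m⁻¹ * M * cumVariation c.V₁_bv x + 2 * M * cumVariation c.b₁_bv x

theorem effective_ae_eq (E : ℝ) : ∀ᵐ x,
    (c.β x)⁻¹ * c.α x * (E - c.V₁ x) + c.b₁ x ^ 2 = c.effective E x := by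
  filter_upwards [rightLim_ae_eq_of_boundedVariationOn c.α_bv,
    rightLim_ae_eq_of_boundedVariationOn c.β_bv, rightLim_ae_eq_of_boundedVariationOn c.V₁_bv,
    rightLim_ae_eq_of_boundedVariationOn c.b₁_bv] with x h1 h2 h3 h4
  rw [effective, h1, h2, h3, h4]

namespace ExteriorBounds

variable {c} {E Emax m M R τ : ℝ} (B : c.ExteriorBounds E Emax m M R τ)
include B

theorem M_pos : 0 < M := B.m_pos.trans_le ((B.le_α 0).trans (B.α_le 0))

theorem Emax_nonneg : 0 ≤ Emax := (abs_nonneg _).trans B.abs_E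

theorem rightLim_α (x : ℝ) : c.α.rightLim x ∈ Icc m M :=
  mem_of_tendsto_right_of_ae (c.α_bv.tendsto_rightLim x) isClosed_Icc
    (Eventually.of_forall fun y => ⟨B.le_α y, B.α_le y⟩)

theorem rightLim_β (x : ℝ) : c.β.rightLim x ∈ Icc m M :=
  mem_of_tendsto_right_of_ae (c.β_bv.tendsto_rightLim x) isClosed_Icc
    (Eventually.of_forall fun y => ⟨B.le_β y, B.β_le y⟩)

theorem rightLim_V₁ (x : ℝ) : |c.V₁.rightLim x| ≤ M :=
  abs_le.2 (mem_of_tendsto_right_of_ae (c.V₁_bv.tendsto_rightLim x) isClosed_Icc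
    (B.V₁_le.mono fun _ hy => abs_le.1 hy))

theorem rightLim_b₁ (x : ℝ) : |c.b₁.rightLim x| ≤ M :=
  abs_le.2 (mem_of_tendsto_right_of_ae (c.b₁_bv.tendsto_rightLim x) isClosed_Icc
    (B.b₁_le.mono fun _ hy => abs_le.1 hy))

/-- The inequality |x| > R must be strict: the right limit at -R is taken through points where no
positivity is known. -/
theorem le_effective {x : ℝ} (hx : R < |x|) : τ ≤ c.effective E x := by
  have hlim : Tendsto (fun y => (c.β y)⁻¹ * c.α y * (E - c.V₁ y) + c.b₁ y ^ 2) (𝓝[>] x)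
      (𝓝 (c.effective E x)) :=
    ((((c.β_bv.tendsto_rightLim x).inv₀ (B.m_pos.trans_le (B.rightLim_β x).1).ne').mul
      (c.α_bv.tendsto_rightLim x)).mul ((c.V₁_bv.tendsto_rightLim x).const_sub E)).add
      ((c.b₁_bv.tendsto_rightLim x).pow 2)
  refine ge_of_tendsto hlim ?_
  have h1 : ∀ᶠ y in 𝓝 x, R < |y| := continuous_abs.continuousAt.eventually_const_lt hx
  filter_upwards [nhdsWithin_le_nhds h1] with y hy
  exact B.pos y hy.le

theorem abs_sub_rightLim_le (x : ℝ) : |E - c.V₁.rightLim x| ≤ Emax + M :=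
  (abs_sub _ _).trans (add_le_add B.abs_E (B.rightLim_V₁ x))

theorem effective_le (x : ℝ) : c.effective E x ≤ m⁻¹ * M * (Emax + M) + M ^ 2 := by
  have hβ := B.rightLim_β x
  have hα := B.rightLim_α x
  have hm := B.m_pos
  have hM := B.M_pos
  have hE := B.Emax_nonneg
  have h1 : (c.β.rightLim x)⁻¹ ≤ m⁻¹ := inv_anti₀ hm hβ.1
  have h2 : 0 ≤ (c.β.rightLim x)⁻¹ := (inv_pos.2 (hm.trans_le hβ.1)).le
  refine add_le_add ?_ (sq_le_sq' (abs_le.1 (B.rightLim_b₁ x)).1 (abs_le.1 (B.rightLim_b₁ x)).2)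
  have h3 : (c.β.rightLim x)⁻¹ * c.α.rightLim x ≤ m⁻¹ * M :=
    mul_le_mul h1 hα.2 (hm.le.trans hα.1) (by positivity)
  refine (mul_le_mul_of_nonneg_left ((le_abs_self _).trans (B.abs_sub_rightLim_le x))
    (mul_nonneg h2 (hm.le.trans hα.1))).trans ?_
  exact mul_le_mul_of_nonneg_right h3 (by positivity)

/-- The product rule for increments, changing one factor at a time. The right limits of the other
factors are bounded everywhere, even where V₁ and b₁ are bounded only almost everywhere. -/
theorem abs_effective_sub_le {x y : ℝ} (hxy : x ≤ y) : |c.effective E y - c.effective E x|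
    ≤ c.effectiveVariation Emax m M y - c.effectiveVariation Emax m M x := by
  have hm := B.m_pos
  have hM := B.M_pos
  have hE := B.Emax_nonneg
  have h1 := abs_rightLim_sub_le c.α_bv B.derivNorm_α hxy
  have h2 := abs_rightLim_sub_le c.β_bv B.derivNorm_β hxy
  have h3 := abs_rightLim_sub_le c.V₁_bv B.derivNorm_V₁ hxy
  have h4 := abs_rightLim_sub_le c.b₁_bv B.derivNorm_b₁ hxy
  have inv : ∀ z, 0 < (c.β.rightLim z)⁻¹ ∧ (c.β.rightLim z)⁻¹ ≤ m⁻¹ := fun z =>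
    ⟨inv_pos.2 (hm.trans_le (B.rightLim_β z).1), inv_anti₀ hm (B.rightLim_β z).1⟩
  have e1 : c.effective E y - c.effective E x
      = -((c.β.rightLim y)⁻¹ * (c.β.rightLim x)⁻¹ * c.α.rightLim y * (E - c.V₁.rightLim y)
          * (c.β.rightLim y - c.β.rightLim x))
        + (c.β.rightLim x)⁻¹ * (E - c.V₁.rightLim y) * (c.α.rightLim y - c.α.rightLim x)
        - (c.β.rightLim x)⁻¹ * c.α.rightLim x * (c.V₁.rightLim y - c.V₁.rightLim x)
        + (c.b₁.rightLim y + c.b₁.rightLim x) * (c.b₁.rightLim y - c.b₁.rightLim x) := by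
    have n1 := (hm.trans_le (B.rightLim_β x).1).ne'
    have n2 := (hm.trans_le (B.rightLim_β y).1).ne'
    simp only [effective]
    field_simp
    ring
  have hV := B.abs_sub_rightLim_le y
  have hαy : |c.α.rightLim y| ≤ M := by
    rw [abs_of_pos (hm.trans_le (B.rightLim_α y).1)]
    exact (B.rightLim_α y).2
  have hαx : |c.α.rightLim x| ≤ M := by
    rw [abs_of_pos (hm.trans_le (B.rightLim_α x).1)]
    exact (B.rightLim_α x).2
  have hβx : |(c.β.rightLim x)⁻¹| ≤ m⁻¹ := by rw [abs_of_pos (inv x).1]; exact (inv x).2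
  have hβy : |(c.β.rightLim y)⁻¹| ≤ m⁻¹ := by rw [abs_of_pos (inv y).1]; exact (inv y).2
  have hb : |c.b₁.rightLim y + c.b₁.rightLim x| ≤ 2 * M :=
    (abs_add_le _ _).trans (by linarith [B.rightLim_b₁ x, B.rightLim_b₁ y])
  have t1 : |(c.β.rightLim y)⁻¹ * (c.β.rightLim x)⁻¹ * c.α.rightLim y * (E - c.V₁.rightLim y)
      * (c.β.rightLim y - c.β.rightLim x)| ≤ m⁻¹ ^ 2 * M * (Emax + M)
        * (cumVariation c.β_bv y - cumVariation c.β_bv x) := by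
    rw [abs_mul, abs_mul, abs_mul, abs_mul, sq]
    gcongr
  have t2 : |(c.β.rightLim x)⁻¹ * (E - c.V₁.rightLim y) * (c.α.rightLim y - c.α.rightLim x)|
      ≤ m⁻¹ * (Emax + M) * (cumVariation c.α_bv y - cumVariation c.α_bv x) := by
    rw [abs_mul, abs_mul]
    gcongr
  have t3 : |(c.β.rightLim x)⁻¹ * c.α.rightLim x * (c.V₁.rightLim y - c.V₁.rightLim x)|
      ≤ m⁻¹ * M * (cumVariation c.V₁_bv y - cumVariation c.V₁_bv x) := by
    rw [abs_mul, abs_mul]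
    gcongr
  have t4 : |(c.b₁.rightLim y + c.b₁.rightLim x) * (c.b₁.rightLim y - c.b₁.rightLim x)|
      ≤ 2 * M * (cumVariation c.b₁_bv y - cumVariation c.b₁_bv x) := by
    rw [abs_mul]
    gcongr
  rw [e1]
  refine (abs_add_le _ _).trans ?_
  refine (add_le_add_left (abs_sub _ _) _).trans ?_
  have t5 := abs_add_le (-((c.β.rightLim y)⁻¹ * (c.β.rightLim x)⁻¹ * c.α.rightLim y *
    (E - c.V₁.rightLim y) * (c.β.rightLim y - c.β.rightLim x)))
    ((c.β.rightLim x)⁻¹ * (E - c.V₁.rightLim y) * (c.α.rightLim y - c.α.rightLim x))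
  rw [abs_neg] at t5
  simp only [effectiveVariation]
  linarith

theorem effectiveVariation_nonneg (x : ℝ) : 0 ≤ c.effectiveVariation Emax m M x := by
  have hm := B.m_pos
  have hM := B.M_pos
  have hE := B.Emax_nonneg
  exact add_nonneg (add_nonneg (add_nonneg
    (mul_nonneg (by positivity) ENNReal.toReal_nonneg)
    (mul_nonneg (by positivity) ENNReal.toReal_nonneg))
    (mul_nonneg (by positivity) ENNReal.toReal_nonneg))
    (mul_nonneg (by positivity) ENNReal.toReal_nonneg)

theorem effectiveVariation_le (x : ℝ) : c.effectiveVariation Emax m M x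
    ≤ m⁻¹ ^ 2 * M * (Emax + M) * M + m⁻¹ * (Emax + M) * M + m⁻¹ * M * M + 2 * M * M := by
  have hm := B.m_pos
  have hM := B.M_pos
  have hE := B.Emax_nonneg
  have h1 := cumVariation_le c.α_bv B.derivNorm_α hM.le x
  have h2 := cumVariation_le c.β_bv B.derivNorm_β hM.le x
  have h3 := cumVariation_le c.V₁_bv B.derivNorm_V₁ hM.le x
  have h4 := cumVariation_le c.b₁_bv B.derivNorm_b₁ hM.le x
  unfold effectiveVariation
  gcongr

/-- `α` times the zeroth order coefficient of the first order system is the effective potential. -/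
theorem mul_coefficient_ae_eq : ∀ᵐ x, R < |x| →
    c.α x * ((E - c.V₁ x) / c.β x + c.b x ^ 2 / c.α x) = c.effective E x := by
  filter_upwards [c.effective_ae_eq E, B.b₀_eq_zero] with x h1 h2 hx
  have h3 : x ∉ Icc (-R) R := fun h => absurd (abs_le.2 h) (not_le.2 hx)
  have := (c.α_pos x).ne'
  rw [← h1, b, h2 h3, zero_add]
  field_simp

/-- The product of α with this coefficient is the effective potential, which is positive and bounded
above; since α ≥ m, division by α costs m⁻¹. -/
theorem coefficient_ae_le : ∀ᵐ x, R < |x| →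
    (E - c.V₁ x) / c.β x + c.b x ^ 2 / c.α x ≤ m⁻¹ * (m⁻¹ * M * (Emax + M) + M ^ 2) := by
  have hm := B.m_pos
  filter_upwards [B.mul_coefficient_ae_eq] with x h hx
  have h1 := B.effective_le x
  have h2 : 0 ≤ c.effective E x := B.τ_pos.le.trans (B.le_effective hx)
  rw [← h hx] at h1 h2
  have h3 : 0 ≤ (E - c.V₁ x) / c.β x + c.b x ^ 2 / c.α x :=
    nonneg_of_mul_nonneg_right h2 (c.α_pos x)
  rw [← div_eq_inv_mul, le_div_iff₀ hm, mul_comm]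
  exact (mul_le_mul_of_nonneg_right (B.le_α x) h3).trans h1

end ExteriorBounds

end Coefficients

end MagneticSchrodinger

end

/-! ### Reduction of the equation to the first order system on both exterior half lines. -/

noncomputable section

namespace MagneticSchrodinger

open Filter Topology

theorem setIntegral_Ioc_comp_neg (g : ℝ → ℂ) {x y : ℝ} (hxy : x ≤ y) :
    ∫ t in Ioc x y, g (-t) = ∫ t in Ioc (-y) (-x), g t := by
  rw [← intervalIntegral.integral_of_le hxy, intervalIntegral.integral_comp_neg,
    intervalIntegral.integral_of_le (neg_le_neg hxy)]

theorem IntegrableOn.Ioc_comp_neg {g : ℝ → ℂ} {x y : ℝ}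
    (hg : IntegrableOn g (Ioc (-y) (-x)) volume) :
    IntegrableOn (fun t => g (-t)) (Ioc x y) volume := by
  rcases le_total x y with hxy | hyx
  · rw [← intervalIntegrable_iff_integrableOn_Ioc_of_le (neg_le_neg hxy)] at hg
    rw [← intervalIntegrable_iff_integrableOn_Ioc_of_le hxy]
    have h := IntervalIntegrable.iff_comp_neg (f := g) (a := -y) (b := -x)
    rw [neg_neg, neg_neg] at h
    exact (h.1 hg).symm
  · rw [Ioc_eq_empty (not_lt.2 hyx)]
    exact integrableOn_empty

namespace Coefficients

/-- The zeroth order coefficient of the first order system satisfied by `u` and `hαu' + ibu`. -/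
def zerothOrder (c : Coefficients) (E x : ℝ) : ℝ := (E - c.V₁ x) / c.β x + c.b x ^ 2 / c.α x

variable {c : Coefficients} {h E ε : ℝ} {u v : L2} {u' r f : ℝ → ℂ}

namespace IsSolution

theorem deriv_ae_eq (hh : 0 < h) {g : L2} (S : c.IsSolution h u g u' r f) :
    u' =ᵐ[volume] fun t => (-(f t / h) - Complex.I * c.b t * r t) / (h * c.α t) := by
  have hh' : (h : ℂ) ≠ 0 := by exact_mod_cast hh.ne'
  filter_upwards [S.ae_eq] with t ht
  have hα : (c.α t : ℂ) ≠ 0 := by exact_mod_cast (c.α_pos t).ne'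
  rw [ht]
  field_simp
  ring

variable (S : c.IsSolution h u (v + ((E : ℂ) + Complex.I * ε) • u) u' r f)
include S

/-- Here w = -f/h. Substituting u' = (w - ibu)/(hα) into the magnetic term produces b²/α, which
joins (E - V₁)/β in the zeroth order coefficient. -/
theorem density_ae_eq (hh : 0 < h) :
    (fun t => (-(Complex.I * c.b t * (-(f t / h)) / c.α t) - c.zerothOrder E t * r t
      - (v t + Complex.I * ε * r t) / c.β t) / h) =ᵐ[volume]
    fun t => -(h : ℂ)⁻¹ * c.density h r u' (v + ((E : ℂ) + Complex.I * ε) • u : L2) t := by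
  have hh' : (h : ℂ) ≠ 0 := by exact_mod_cast hh.ne'
  filter_upwards [S.deriv_ae_eq hh, S.isRep.ae_eq, Lp.coeFn_add v (((E : ℂ) + Complex.I * ε) • u),
    Lp.coeFn_smul ((E : ℂ) + Complex.I * ε) u] with t h1 h2 h3 h4
  have hα : (c.α t : ℂ) ≠ 0 := by exact_mod_cast (c.α_pos t).ne'
  have hβ : (c.β t : ℂ) ≠ 0 := by exact_mod_cast (c.β_pos t).ne'
  rw [density, h1, h3, Pi.add_apply, h4, Pi.smul_apply, ← h2, zerothOrder, smul_eq_mul]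
  push_cast
  field_simp
  linear_combination (-(c.β t : ℂ) * h * c.b t ^ 2 * r t) * Complex.I_sq

theorem increments_rep (hh : 0 < h) {x y : ℝ} (hxy : x ≤ y) : r y - r x
    = ∫ t in Ioc x y, (-(f t / h) - Complex.I * c.b t * r t) / (h * c.α t) := by
  rw [S.isRep.increments x y hxy]
  exact integral_congr_ae (ae_restrict_of_ae (S.deriv_ae_eq hh))

theorem integrableOn_deriv (hh : 0 < h) (x y : ℝ) : IntegrableOn (fun t =>
    (-(f t / h) - Complex.I * c.b t * r t) / (h * c.α t)) (Ioc x y) volume :=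
  (integrableOn_Ioc_of_memLp_two S.memLp_deriv x y).congr (ae_restrict_of_ae (S.deriv_ae_eq hh))

theorem integrableOn_flux (hh : 0 < h) (x y : ℝ) : IntegrableOn (fun t =>
    (-(Complex.I * c.b t * (-(f t / h)) / c.α t) - c.zerothOrder E t * r t
      - (v t + Complex.I * ε * r t) / c.β t) / h) (Ioc x y) volume :=
  ((S.integrableOn_density x y).const_mul (-(h : ℂ)⁻¹)).congr
    (ae_restrict_of_ae (S.density_ae_eq hh).symm)

theorem increments_flux (hh : 0 < h) {x y : ℝ} (hxy : x ≤ y) (h0 : c.absV₀ (Ioc x y) = 0) :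
    -(f y / h) - -(f x / h) = ∫ t in Ioc x y,
      (-(Complex.I * c.b t * (-(f t / h)) / c.α t) - c.zerothOrder E t * r t
        - (v t + Complex.I * ε * r t) / c.β t) / h := by
  rw [integral_congr_ae (ae_restrict_of_ae (S.density_ae_eq hh)), integral_const_mul]
  have h1 := S.increments x y hxy
  rw [Measure.restrict_eq_zero.2 h0, integral_zero_measure, add_zero] at h1
  rw [← h1]
  ring

theorem halfLineSystem (hh : 0 < h) {a : ℝ} (h0 : c.absV₀ (Ioi a) = 0) :
    HalfLineSystem h a c.α c.β c.b (c.zerothOrder E) r (fun t => -(f t / h))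
      fun t => v t + Complex.I * ε * r t where
  integrableOn_u y := S.integrableOn_deriv hh a y
  integrableOn_w y := S.integrableOn_flux hh a y
  increments_u _ _ _ hxy := S.increments_rep hh hxy
  increments_w _ _ hx hxy := S.increments_flux hh hxy
    (measure_mono_null (Ioc_subset_Ioi_self.trans (Ioi_subset_Ioi hx)) h0)

/-- Under x ↦ -x the derivative changes sign, hence so do b and w = -f/h, while α, β and the zeroth
order coefficient are only reflected. -/
theorem halfLineSystem_neg (hh : 0 < h) {a : ℝ} (h0 : c.absV₀ (Iic (-a)) = 0) :
    HalfLineSystem h a (fun t => c.α (-t)) (fun t => c.β (-t)) (fun t => -c.b (-t))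
      (fun t => c.zerothOrder E (-t)) (fun t => r (-t)) (fun t => f (-t) / h)
      fun t => v (-t) + Complex.I * ε * r (-t) := by
  have e1 : (fun t => (f (-t) / h - Complex.I * ((-c.b (-t) : ℝ) : ℂ) * r (-t)) / (h * c.α (-t)))
      = fun t => -(fun s => (-(f s / h) - Complex.I * c.b s * r s) / (h * c.α s)) (-t) := by
    funext t
    push_cast
    ring
  have e2 : (fun t => (-(Complex.I * ((-c.b (-t) : ℝ) : ℂ) * (f (-t) / h) / c.α (-t))
      - c.zerothOrder E (-t) * r (-t) - (v (-t) + Complex.I * ε * r (-t)) / c.β (-t)) / h)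
      = fun t => (fun s => (-(Complex.I * c.b s * (-(f s / h)) / c.α s) - c.zerothOrder E s * r s
        - (v s + Complex.I * ε * r s) / c.β s) / h) (-t) := by
    funext t
    push_cast
    ring
  refine ⟨fun _ => ?_, fun _ => ?_, fun _ _ _ hxy => ?_, fun _ _ hx hxy => ?_⟩
  · rw [e1]
    exact (IntegrableOn.Ioc_comp_neg (S.integrableOn_deriv hh _ _)).neg
  · rw [e2]
    exact IntegrableOn.Ioc_comp_neg (S.integrableOn_flux hh _ _)
  · have e := S.increments_rep hh (neg_le_neg hxy)
    rw [← setIntegral_Ioc_comp_neg _ hxy] at e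
    rw [e1, integral_neg]
    refine Eq.trans ?_ (congrArg Neg.neg e)
    ring
  · have e := S.increments_flux hh (neg_le_neg hxy)
      (measure_mono_null (fun t ht => ht.2.trans (neg_le_neg hx)) h0)
    rw [← setIntegral_Ioc_comp_neg _ hxy] at e
    rw [e2]
    refine Eq.trans ?_ e
    ring

/-- The exterior estimate on both half lines. -/
theorem exterior_energy_le (hh : 0 < h) {Emax m M R τ : ℝ} (B : c.ExteriorBounds E Emax m M R τ)
    (hv : Integrable v) {σ s D γ P KQ : ℝ}
    (hP : P = m⁻¹ ^ 2 * M * (Emax + M) * M + m⁻¹ * (Emax + M) * M + m⁻¹ * M * M + 2 * M * M)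
    (hKQ : KQ = m⁻¹ * (m⁻¹ * M * (Emax + M) + M ^ 2))
    (hs : 0 ≤ s) (hws : ∀ x, R < |x| → ‖f x / h‖ ≤ s) (hus : ∀ x, R < |x| → ‖r x‖ ≤ σ * s)
    (hD : |ε| * (∫ t, ‖r t‖ ^ 2) ≤ D) (hγ : ∫ t, ‖v t‖ ≤ γ) {x : ℝ} (hx : R < |x|) :
    ‖f x / h‖ ^ 2 + c.effective E x * ‖r x‖ ^ 2 ≤ Real.exp (P / τ) * (2 / (h * m) * (s * γ
      + (M * (2 * h * σ * s ^ 2 * |ε| + KQ * D + |ε| * (σ * s * γ / m)) + D) / 2)) := by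
  have hm := B.m_pos
  have hM := B.M_pos
  have hE := B.Emax_nonneg
  obtain ⟨K₁, hK₁⟩ := S.exists_bound_rep
  obtain ⟨K₂, hK₂⟩ := S.exists_bound
  obtain ⟨Kβ, hKβ⟩ := c.exists_bound_inv_β
  set K := max K₁ (K₂ / h) with hK
  have hrK : ∀ x, ‖r x‖ ≤ K := fun x => (hK₁ x).trans (le_max_left _ _)
  have hfK : ∀ x, ‖f x / h‖ ≤ K := fun x => by
    rw [norm_div, Complex.norm_real, Real.norm_of_nonneg hh.le]
    exact (div_le_div_of_nonneg_right (hK₂ x) hh.le).trans (le_max_right _ _)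
  have mr := S.memLp_rep
  have mw : MemLp (fun t => f t / h) 2 volume := by
    simpa only [div_eq_inv_mul] using S.memLp.const_mul (h : ℂ)⁻¹
  have ir : Integrable (fun t => ‖r t‖ ^ 2) := (memLp_two_iff_integrable_sq_norm mr.1).1 mr
  have iw : Integrable (fun t => ‖f t / h‖ ^ 2) := (memLp_two_iff_integrable_sq_norm mw.1).1 mw
  have iG : ∀ {k : ℝ → ℂ}, MemLp k 2 volume → Integrable (fun t =>
      ((v t + Complex.I * ε * r t) * (starRingEnd ℂ) (k t)).re / c.β t) := fun {k} hk => by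
    have h1 : MemLp (fun t => v t + Complex.I * ε * r t) 2 volume :=
      (Lp.memLp v).add (mr.const_mul _)
    have h2 := (integrable_mul_of_memLp_two h1 (memLp_two_conj hk)).re
    refine (h2.bdd_mul (c := Kβ) (f := fun t => (c.β t)⁻¹)
      c.measurable_β.inv.aestronglyMeasurable (Eventually.of_forall hKβ)).congr
      (Eventually.of_forall fun t => ?_)
    simp only [div_eq_inv_mul]
    rfl
  have nn : ∀ {g : ℝ → ℝ} (_ : Integrable g) (_ : ∀ t, 0 ≤ g t) (a : ℝ),
      ∫ t in Ioi a, g t ≤ ∫ t, g t := fun hg h0 a =>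
    setIntegral_le_integral hg (Eventually.of_forall h0)
  have hKQ0 : 0 ≤ KQ := by rw [hKQ]; positivity
  -- The singular potential does not charge the exterior region, so the half line systems contain no
  -- measure term.
  have hnull : ∀ {A : Set ℝ}, (∀ t ∈ A, R < |t|) → c.absV₀ A = 0 := fun {A} hA => by
    have hsub : A ⊆ (Icc (-R) R)ᶜ := fun t ht hIcc =>
      absurd (abs_le.2 hIcc) (not_le.2 (hA t ht))
    exact measure_mono_null hsub B.absV₀_eq_zero
  rcases le_or_gt 0 x with hx0 | hx0
  · rw [abs_of_nonneg hx0] at hx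
    have hout : ∀ t, x ≤ t → R < |t| := fun t ht => by
      rw [abs_of_nonneg (hx0.trans ht)]
      exact hx.trans_le ht
    have H := (S.halfLineSystem hh (a := x) (hnull fun t ht => hout t (le_of_lt ht)))
    have key := H.energy_le_of_bound hh hm B.le_α B.α_le B.le_β (q := c.effective E)
      (p := c.effectiveVariation Emax m M) (P := P) (KQ := KQ) (K := K) (D := D) (γ := γ)
      B.τ_pos (by
        filter_upwards [B.mul_coefficient_ae_eq] with t ht hxt
        exact ht (hout t hxt.le))
      (fun s t _ hst => B.abs_effective_sub_le hst) B.effectiveVariation_nonneg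
      (fun t => (B.effectiveVariation_le t).trans_eq hP.symm)
      (fun t ht => B.le_effective (hout t ht)) (fun t _ => B.effective_le t) (by
        filter_upwards [B.coefficient_ae_le] with t ht hxt
        rw [hKQ]
        exact ht (hout t hxt.le)) hKQ0 hrK (fun t => by rw [norm_neg]; exact hfK t)
      ir.integrableOn (by simpa only [norm_neg] using iw.integrableOn) hv.norm.integrableOn
      (iG mw.neg).integrableOn (iG mr).integrableOn hs
      (fun t ht => by rw [norm_neg]; exact hws t (hout t ht)) (fun t ht => hus t (hout t ht))
      ((mul_le_mul_of_nonneg_left (nn ir (fun _ => by positivity) x) (abs_nonneg ε)).trans hD)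
      ((nn hv.norm (fun _ => norm_nonneg _) x).trans hγ)
    simpa only [norm_neg] using key
  · obtain ⟨a, rfl⟩ : ∃ a, x = -a := ⟨-x, by ring⟩
    rw [abs_of_neg hx0, neg_neg] at hx
    have ha0 : 0 < a := by linarith
    have hout : ∀ t, a ≤ t → R < |(-t)| := fun t ht => by
      rw [abs_neg, abs_of_nonneg (ha0.le.trans ht)]
      exact hx.trans_le ht
    have H := (S.halfLineSystem_neg hh (a := a) (hnull fun t ht => by
      have := hout (-t) (le_neg.2 ht)
      rwa [neg_neg] at this))
    have ae_neg : ∀ {p : ℝ → Prop}, (∀ᵐ t, p t) → ∀ᵐ t, p (-t) := fun hp =>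
      (Measure.measurePreserving_neg (volume : Measure ℝ)).quasiMeasurePreserving.ae hp
    exact H.energy_le_of_bound hh hm (fun t => B.le_α _) (fun t => B.α_le _) (fun t => B.le_β _)
      (q := fun t => c.effective E (-t))
      -- Reflection reverses monotonicity, so P minus the reflected variation is the nondecreasing
      -- majorant, again between 0 and P.
      (p := fun t => P - c.effectiveVariation Emax m M (-t)) (P := P) (KQ := KQ) (K := K)
      (D := D) (γ := γ) B.τ_pos (by
        filter_upwards [ae_neg B.mul_coefficient_ae_eq] with t ht hxt
        exact ht (hout t hxt.le))
      (fun s t _ hst => by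
        rw [abs_sub_comm]
        exact (B.abs_effective_sub_le (neg_le_neg hst)).trans (by linarith))
      (fun t => sub_nonneg.2 ((B.effectiveVariation_le _).trans_eq hP.symm))
      (fun t => sub_le_self _ (B.effectiveVariation_nonneg _))
      (fun t ht => B.le_effective (hout t ht)) (fun t _ => B.effective_le _) (by
        filter_upwards [ae_neg B.coefficient_ae_le] with t ht hxt
        rw [hKQ]
        exact ht (hout t hxt.le)) hKQ0 (fun t => hrK _) (fun t => hfK _)
      ir.comp_neg.integrableOn iw.comp_neg.integrableOn hv.norm.comp_neg.integrableOn
      (iG mw).comp_neg.integrableOn (iG mr).comp_neg.integrableOn hs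
      (fun t ht => hws _ (hout t ht)) (fun t ht => hus _ (hout t ht))
      ((mul_le_mul_of_nonneg_left ((nn ir.comp_neg (fun _ => by positivity) a).trans_eq
        (integral_neg_eq_self (fun t => ‖r t‖ ^ 2) _)) (abs_nonneg ε)).trans hD)
      (((nn hv.norm.comp_neg (fun _ => norm_nonneg _) a).trans_eq
        (integral_neg_eq_self (fun t => ‖v t‖) _)).trans hγ)

end IsSolution

end Coefficients

end MagneticSchrodinger

end

/-! ### The exterior bound uniform in ε, and square integrability of the weight. -/

noncomputable section

namespace MagneticSchrodinger

open Filter Topology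

theorem integral_norm_mul_norm_le {f g : ℝ → ℂ} (hf : MemLp f 2 volume) (hg : MemLp g 2 volume) :
    ∫ x, ‖f x‖ * ‖g x‖ ≤ ‖hf.toLp f‖ * ‖hg.toLp g‖ := by
  have e := integral_mul_le_Lp_mul_Lq_of_nonneg (μ := (volume : Measure ℝ))
    Real.HolderConjugate.two_two (f := fun x => ‖f x‖) (g := fun x => ‖g x‖)
    (Eventually.of_forall fun _ => norm_nonneg _) (Eventually.of_forall fun _ => norm_nonneg _)
    (by simpa using hf.norm) (by simpa using hg.norm)
  have h : ∀ {k : ℝ → ℂ} (hk : MemLp k 2 volume), ∫ x, ‖k x‖ ^ 2 = ‖hk.toLp k‖ ^ 2 := fun hk => by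
    rw [L2_norm_sq_eq]
    refine integral_congr_ae ?_
    filter_upwards [hk.coeFn_toLp] with x hx
    rw [hx]
  simp only [Real.rpow_two, ← Real.sqrt_eq_rpow, h hf, h hg, Real.sqrt_sq (norm_nonneg _)] at e
  exact e

namespace Coefficients

/-- The solution is bounded outside `[-R, R]` by the `L¹` norm of the source, uniformly up to the
real axis. -/
theorem exists_exterior_bound {Emax m M τ : ℝ} (hEmax : 0 ≤ Emax) (hm : 0 < m) (hM : 0 < M)
    (hτ : 0 < τ) : ∃ C ε₁ : ℝ, 0 < C ∧ 0 < ε₁ ∧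
    ∀ (c : Coefficients) (E R h ε : ℝ) (u v : L2) (u' r f : ℝ → ℂ), 0 < h → |ε| ≤ ε₁ →
      c.ExteriorBounds E Emax m M R τ →
      c.IsSolution h u (v + ((E : ℂ) + Complex.I * ε) • u) u' r f →
      |ε| * (∫ x, (c.β x)⁻¹ * ‖u x‖ ^ 2) ≤ ∫ x, (c.β x)⁻¹ * (‖u x‖ * ‖v x‖) →
      Integrable v → (∀ᵐ x, |x| ≤ R → v x = 0) →
      ∀ x, R < |x| → ‖r x‖ ≤ C / h * ∫ x, ‖v x‖ := by
  obtain ⟨P, hP⟩ : ∃ P, P = m⁻¹ ^ 2 * M * (Emax + M) * M + m⁻¹ * (Emax + M) * M + m⁻¹ * M * M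
    + 2 * M * M := ⟨_, rfl⟩
  obtain ⟨KQ, hKQ⟩ : ∃ KQ, KQ = m⁻¹ * (m⁻¹ * M * (Emax + M) + M ^ 2) := ⟨_, rfl⟩
  have hKQ0 : 0 ≤ KQ := by rw [hKQ]; positivity
  set σ := (Real.sqrt τ)⁻¹ with hσ
  have hσ0 : 0 < σ := inv_pos.2 (Real.sqrt_pos.2 hτ)
  -- A/h is the coefficient of sγ, with |ε| ≤ 1 already used, and L|ε| is that of s². In L the
  -- factor h of the boundary term cancels 2/(hm), so the threshold for |ε| does not depend on h.
  set A := Real.exp (P / τ) * (2 / m) * (1 + (M * (KQ * (M * σ / m) + σ / m) + M * σ / m) / 2)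
    with hA
  set L := Real.exp (P / τ) * (2 / m) * (M * σ) with hL
  have hexp := Real.exp_pos (P / τ)
  have hA0 : 0 < A := by positivity
  have hL0 : 0 < L := by positivity
  refine ⟨2 * A * σ, min 1 (1 / (2 * L)), by positivity, by positivity, ?_⟩
  intro c E R h ε u v u' r f hh hε B S henergy hv hv0
  have hε1 : |ε| ≤ 1 := hε.trans (min_le_left _ _)
  have hεL : L * |ε| ≤ 1 / 2 := by
    have := hε.trans (min_le_right _ _)
    rw [le_div_iff₀ (by positivity)] at this
    linarith
  set F : ℝ → ℝ := fun x => ‖f x / h‖ ^ 2 + c.effective E x * ‖r x‖ ^ 2 with hF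
  set N := sSup (F '' {x | R < |x|}) with hN
  set s := Real.sqrt N with hs
  set γ := ∫ x, ‖v x‖ with hγ
  have hγ0 : 0 ≤ γ := integral_nonneg fun _ => norm_nonneg _
  have hne : (F '' {x | R < |x|}).Nonempty :=
    ⟨_, R + 1, (lt_add_one R).trans_le (le_abs_self _), rfl⟩
  -- Finiteness of the supremum, from the boundedness of u and of the flux f, is what allows it to
  -- be absorbed later. The bounds used here may depend on h and ε.
  have hbdd : BddAbove (F '' {x | R < |x|}) := by
    obtain ⟨K₁, hK₁⟩ := S.exists_bound_rep
    obtain ⟨K₂, hK₂⟩ := S.exists_bound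
    refine ⟨(K₂ / h) ^ 2 + (m⁻¹ * M * (Emax + M) + M ^ 2) * K₁ ^ 2, ?_⟩
    rintro _ ⟨x, -, rfl⟩
    have e1 : ‖f x / h‖ ≤ K₂ / h := by
      rw [norm_div, Complex.norm_real, Real.norm_of_nonneg hh.le]
      exact div_le_div_of_nonneg_right (hK₂ x) hh.le
    have e2 := B.effective_le x
    have e3 := hK₁ x
    simp only [hF]
    exact add_le_add (pow_le_pow_left₀ (norm_nonneg _) e1 2)
      (mul_le_mul e2 (pow_le_pow_left₀ (norm_nonneg _) e3 2) (by positivity) (by positivity))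
  have hFN : ∀ x, R < |x| → F x ≤ N := fun x hx => le_csSup hbdd ⟨x, hx, rfl⟩
  have hτF : ∀ x, R < |x| → τ * ‖r x‖ ^ 2 ≤ c.effective E x * ‖r x‖ ^ 2 := fun x hx =>
    mul_le_mul_of_nonneg_right (B.le_effective hx) (by positivity)
  have hN0 : 0 ≤ N := by
    obtain ⟨_, x, hx, rfl⟩ := hne
    refine le_trans ?_ (hFN x hx)
    have := hτF x hx
    have : 0 ≤ τ * ‖r x‖ ^ 2 := by positivity
    simp only [hF]
    nlinarith [sq_nonneg ‖f x / h‖]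
  have hs2 : s ^ 2 = N := Real.sq_sqrt hN0
  have hs0 : 0 ≤ s := Real.sqrt_nonneg _
  have hws : ∀ x, R < |x| → ‖f x / h‖ ≤ s := fun x hx => by
    refine Real.le_sqrt_of_sq_le (le_trans ?_ (hFN x hx))
    have := hτF x hx
    have : 0 ≤ τ * ‖r x‖ ^ 2 := by positivity
    simp only [hF]
    linarith
  have hus : ∀ x, R < |x| → ‖r x‖ ≤ σ * s := fun x hx => by
    rw [hσ, inv_mul_eq_div, le_div_iff₀ (Real.sqrt_pos.2 hτ), ← abs_of_nonneg (norm_nonneg (r x))]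
    rw [← Real.sqrt_sq_eq_abs, ← Real.sqrt_mul (sq_nonneg _)]
    refine Real.sqrt_le_sqrt (le_trans ?_ (hFN x hx))
    have := hτF x hx
    simp only [hF]
    nlinarith [sq_nonneg ‖f x / h‖]
  have hu_ae : ∀ᵐ x, r x = u x := S.isRep.ae_eq
  -- In the energy inequality v vanishes on [-R, R], so the right side only involves u where |u| ≤
  -- σs.
  have hD : |ε| * (∫ x, ‖r x‖ ^ 2) ≤ M * σ / m * (s * γ) := by
    have e1 : ∫ x, ‖r x‖ ^ 2 = ‖u‖ ^ 2 := by
      rw [L2_norm_sq_eq]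
      exact integral_congr_ae (by filter_upwards [hu_ae] with x hx; rw [hx])
    have e2 := c.le_integral_inv_β B.β_le u
    have e3 : ∫ x, (c.β x)⁻¹ * (‖u x‖ * ‖v x‖) ≤ m⁻¹ * (σ * s) * γ := by
      rw [hγ, ← integral_const_mul]
      refine integral_mono_of_nonneg (Eventually.of_forall fun x => ?_) (hv.norm.const_mul _) ?_
      · exact mul_nonneg (inv_pos.2 (c.β_pos x)).le (by positivity)
      · filter_upwards [hu_ae, hv0] with x hx hx0
        rcases le_or_gt |x| R with hxR | hxR
        · simp [hx0 hxR]
        · rw [← hx, mul_assoc]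
          refine mul_le_mul (inv_anti₀ hm (B.le_β x))
            (mul_le_mul_of_nonneg_right (hus x hxR) (norm_nonneg _)) (by positivity)
            (by positivity)
    rw [e1]
    have e4 : |ε| * (M⁻¹ * ‖u‖ ^ 2) ≤ m⁻¹ * (σ * s) * γ :=
      (mul_le_mul_of_nonneg_left e2 (abs_nonneg _)).trans (henergy.trans e3)
    have e5 := mul_le_mul_of_nonneg_left e4 hM.le
    calc |ε| * ‖u‖ ^ 2 = M * (|ε| * (M⁻¹ * ‖u‖ ^ 2)) := by field_simp
      _ ≤ M * (m⁻¹ * (σ * s) * γ) := e5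
      _ = _ := by ring
  have hmain : N ≤ A / h * (s * γ) + L * |ε| * s ^ 2 := by
    refine csSup_le hne ?_
    rintro _ ⟨x, hx, rfl⟩
    refine (S.exterior_energy_le hh B hv hP hKQ hs0 hws hus hD le_rfl hx).trans ?_
    have hsγ : 0 ≤ s * γ := mul_nonneg hs0 hγ0
    have e1 : |ε| * (σ * s * γ / m) ≤ σ / m * (s * γ) := by
      calc |ε| * (σ * s * γ / m) = |ε| * (σ / m * (s * γ)) := by ring
        _ ≤ 1 * (σ / m * (s * γ)) := mul_le_mul_of_nonneg_right hε1 (by positivity)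
        _ = _ := one_mul _
    calc _ ≤ Real.exp (P / τ) * (2 / (h * m) * (s * γ + (M * (2 * h * σ * s ^ 2 * |ε|
          + KQ * (M * σ / m * (s * γ)) + σ / m * (s * γ)) + M * σ / m * (s * γ)) / 2)) := by
          gcongr
      _ = A / h * (s * γ) + L * |ε| * s ^ 2 := by
          rw [hA, hL]
          field_simp
          ring
  have hfin : s ≤ 2 * A / h * γ := by
    rcases hs0.eq_or_lt with h0 | h0
    · rw [← h0]
      positivity
    -- Since L|ε| ≤ 1/2, half of s² is absorbed, and division by s > 0 gives the linear bound.
    · have e1 : s ^ 2 ≤ A / h * (s * γ) + 1 / 2 * s ^ 2 := by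
        have := mul_le_mul_of_nonneg_right hεL (sq_nonneg s)
        linarith [hs2 ▸ hmain]
      have e2 : s * s ≤ 2 * A / h * γ * s := by
        calc s * s = 2 * (s ^ 2 - 1 / 2 * s ^ 2) := by ring
          _ ≤ 2 * (A / h * (s * γ)) := by linarith
          _ = _ := by ring
      exact le_of_mul_le_mul_right e2 h0
  intro x hx
  calc ‖r x‖ ≤ σ * s := hus x hx
    _ ≤ σ * (2 * A / h * γ) := mul_le_mul_of_nonneg_left hfin hσ0.le
    _ = _ := by ring

end Coefficients

section Weight

variable {s : ℝ} (hs : 1 / 2 < s) (R : ℝ)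
include hs

/-- The square of the weight is at most (1 + x²)^(-s), which is integrable because 2s > 1. -/
theorem exteriorWeight_memLp_two : MemLp (exteriorWeight s R) 2 volume := by
  rw [memLp_two_iff_integrable_sq_norm (exteriorWeight_memLp hs R).1]
  have h1 := integrable_rpow_neg_one_add_norm_sq (E := ℝ) (μ := volume) (r := 2 * s)
    (by simpa using by linarith)
  refine h1.mono' ((exteriorWeight_memLp hs R).1.norm.pow 2) (Eventually.of_forall fun x => ?_)
  have h2 : ‖exteriorWeight s R x‖ ≤ Real.sqrt (1 + |x| ^ 2) ^ (-s) := by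
    refine (norm_indicator_le_norm_self _ x).trans (le_of_eq ?_)
    rw [Complex.norm_real, Real.norm_of_nonneg (by positivity)]
  rw [Real.norm_of_nonneg (by positivity)]
  refine (pow_le_pow_left₀ (norm_nonneg _) h2 2).trans (le_of_eq ?_)
  rw [Real.sqrt_eq_rpow, ← Real.rpow_mul (by positivity), ← Real.rpow_natCast,
    ← Real.rpow_mul (by positivity), Real.norm_eq_abs]
  congr 1
  push_cast
  ring

theorem exteriorWeightOp_coeFn (g : L2) :
    exteriorWeightOp hs R g =ᵐ[volume] fun x => exteriorWeight s R x * g x := by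
  have h1 : exteriorWeightOp hs R g = (ContinuousLinearMap.mul ℂ ℂ).holder 2
    ((exteriorWeight_memLp hs R).toLp _) g := rfl
  rw [h1]
  filter_upwards [(ContinuousLinearMap.mul ℂ ℂ).coeFn_holder (r := 2)
    ((exteriorWeight_memLp hs R).toLp _) g, (exteriorWeight_memLp hs R).coeFn_toLp] with x h2 h3
  rw [h2, h3, ContinuousLinearMap.mul_apply']

end Weight

theorem ae_abs_le_of_eLpNorm_top_le {f : ℝ → ℝ} {M : ℝ} (hM : 0 ≤ M)
    (h : eLpNorm f ⊤ volume ≤ ENNReal.ofReal M) : ∀ᵐ x, |f x| ≤ M := by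
  rw [eLpNorm_exponent_top] at h
  filter_upwards [ae_le_eLpNormEssSup (f := f) (μ := volume)] with x hx
  have h1 := hx.trans h
  rwa [← ofReal_norm, ENNReal.ofReal_le_ofReal_iff hM] at h1

end MagneticSchrodinger

end

/-! ### The weighted resolvent estimate. -/

open MagneticSchrodinger in
theorem corollary2
    (s Emax h₀ ε₀ : ℝ) (hs : 1 / 2 < s) (hEmax : 0 < Emax) (hh₀ : 0 < h₀) (hε₀ : 0 < ε₀)
    -- the coefficients and the energy, which may depend on `h ∈ (0, h₀]`
    (c : ℝ → Coefficients) (E : ℝ → ℝ)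
    (hE : ∀ h ∈ Ioc 0 h₀, E h ∈ Icc (-Emax) Emax)
    -- (1) the coefficients are bounded uniformly in `h`
    (M : ℝ)
    (hV₁ : ∀ h ∈ Ioc 0 h₀, eLpNorm (c h).V₁ ∞ volume ≤ ENNReal.ofReal M)
    (hdV₁ : ∀ h ∈ Ioc 0 h₀, derivNorm (c h).V₁_bv ≤ ENNReal.ofReal M)
    (hb₁ : ∀ h ∈ Ioc 0 h₀, eLpNorm (c h).b₁ ∞ volume ≤ ENNReal.ofReal M)
    (hdb₁ : ∀ h ∈ Ioc 0 h₀, derivNorm (c h).b₁_bv ≤ ENNReal.ofReal M)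
    (hdα : ∀ h ∈ Ioc 0 h₀, derivNorm (c h).α_bv ≤ ENNReal.ofReal M)
    (hdβ : ∀ h ∈ Ioc 0 h₀, derivNorm (c h).β_bv ≤ ENNReal.ofReal M)
    (hα : ∀ h ∈ Ioc 0 h₀, ∀ x, (c h).α x ≤ M)
    (hβ : ∀ h ∈ Ioc 0 h₀, ∀ x, (c h).β x ≤ M)
    -- (2) `α` and `β` are bounded below uniformly in `h`
    (m : ℝ) (hm : 0 < m)
    (hα' : ∀ h ∈ Ioc 0 h₀, ∀ x, m ≤ (c h).α x)
    (hβ' : ∀ h ∈ Ioc 0 h₀, ∀ x, m ≤ (c h).β x)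
    -- (3) positivity for `|x| ≥ R₁`, uniformly in `h`
    (R₁ : ℝ) (hR₁ : 0 < R₁) (τ₁ : ℝ) (hτ₁ : 0 < τ₁)
    (hpos : ∀ h ∈ Ioc 0 h₀, ∀ x : ℝ, R₁ ≤ |x| →
      τ₁ ≤ ((c h).β x)⁻¹ * (c h).α x * (E h - (c h).V₁ x) + (c h).b₁ x ^ 2)
    -- (4) `V₀` and `b₀` are supported in `[-R₀, R₀]`
    (R₀ : ℝ) (hR₀ : 0 < R₀)
    (hV₀ : ∀ h ∈ Ioc 0 h₀, (c h).V₀.variation (Icc (-R₀) R₀)ᶜ = 0)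
    (hb₀ : ∀ h ∈ Ioc 0 h₀, ∀ᵐ x, x ∉ Icc (-R₀) R₀ → (c h).b₀ x = 0) :
    ∃ C₀ : ℝ, 0 < C₀ ∧ ∀ h ∈ Ioc 0 h₀, ∀ ε ∈ Icc (-ε₀) ε₀, ε ≠ 0 →
      ∃ T : L2 →L[ℂ] L2, (c h).IsResolvent h (E h + Complex.I * ε) T ∧
        ‖exteriorWeightOp hs (max R₀ R₁) ∘L T ∘L exteriorWeightOp hs (max R₀ R₁)‖ ≤ C₀ / h := by
  set R := max R₀ R₁ with hRdef
  have hh₀' : h₀ ∈ Ioc 0 h₀ := ⟨hh₀, le_rfl⟩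
  have hM : 0 < M := hm.trans_le ((hα' h₀ hh₀' 0).trans (hα h₀ hh₀' 0))
  obtain ⟨C, ε₁, hC, hε₁, hbound⟩ := Coefficients.exists_exterior_bound hEmax.le hm hM hτ₁
  set κ := ‖(exteriorWeight_memLp_two hs R).toLp _‖ with hκ
  set W := ‖exteriorWeightOp hs R‖ with hW
  -- The first summand serves |ε| ≤ ε₁ and the second |ε| > ε₁; the 1 ensures positivity.
  refine ⟨C * κ ^ 2 + W * (M * h₀ / (m * ε₁)) * W + 1, by positivity, fun h hh ε _ hε => ?_⟩
  have hh0 : 0 < h := hh.1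
  have hz : ((E h : ℂ) + Complex.I * ε).im = ε := by simp
  obtain ⟨T, hT⟩ := (c h).exists_isResolvent hh0 (z := (E h : ℂ) + Complex.I * ε) (by rwa [hz])
  refine ⟨T, hT, ?_⟩
  rcases le_or_gt |ε| ε₁ with hsmall | hlarge
  · have B : (c h).ExteriorBounds (E h) Emax m M R τ₁ :=
      { m_pos := hm
        τ_pos := hτ₁
        abs_E := abs_le.2 (hE h hh)
        le_α := hα' h hh
        α_le := hα h hh
        le_β := hβ' h hh
        β_le := hβ h hh
        V₁_le := ae_abs_le_of_eLpNorm_top_le hM.le (hV₁ h hh)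
        b₁_le := ae_abs_le_of_eLpNorm_top_le hM.le (hb₁ h hh)
        derivNorm_α := hdα h hh
        derivNorm_β := hdβ h hh
        derivNorm_V₁ := hdV₁ h hh
        derivNorm_b₁ := hdb₁ h hh
        pos := fun x hx => hpos h hh x ((le_max_right _ _).trans hx)
        absV₀_eq_zero := by
          rw [Coefficients.absV₀, SignedMeasure.totalVariation_eq_variation]
          exact measure_mono_null (compl_subset_compl.2 (Icc_subset_Icc
            (neg_le_neg (le_max_left _ _)) (le_max_left _ _))) (hV₀ h hh)
        b₀_eq_zero := by
          filter_upwards [hb₀ h hh] with x hx hxR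
          exact hx fun hx' => hxR ⟨(neg_le_neg (le_max_left _ _)).trans hx'.1,
            hx'.2.trans (le_max_left _ _)⟩ }
    have hnorm : ‖exteriorWeightOp hs R ∘L T ∘L exteriorWeightOp hs R‖ ≤ C * κ ^ 2 / h := by
      refine ContinuousLinearMap.opNorm_le_bound _ (by positivity) fun g => ?_
      set v := exteriorWeightOp hs R g with hv
      have hvg := exteriorWeightOp_coeFn hs R g
      have H := (hT v (T v)).1 rfl
      have henergy := H.energy
      rw [hz] at henergy
      obtain ⟨u', r, f, -, S⟩ := H.exists_isSolution
      -- The weighted datum is a product of two L² functions, hence in L¹, with norm at most κ‖g‖.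
      have iv : MeasureTheory.Integrable v :=
        (integrable_mul_of_memLp_two (exteriorWeight_memLp_two hs R) (Lp.memLp g)).congr hvg.symm
      have hγ : ∫ x, ‖v x‖ ≤ κ * ‖g‖ := by
        have h1 := integral_norm_mul_norm_le (exteriorWeight_memLp_two hs R) (Lp.memLp g)
        rw [Lp.toLp_coeFn] at h1
        refine le_trans (le_of_eq (integral_congr_ae ?_)) h1
        filter_upwards [hvg] with x hx
        rw [hx, norm_mul]
      have hr := hbound (c h) (E h) R h ε (T v) v u' r f hh0 hsmall B S henergy iv (by
        filter_upwards [hvg] with x hx hxR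
        rw [hx, exteriorWeight, indicator_of_notMem (by simpa using hxR), zero_mul])
      -- Outside [-R, R] the solution is bounded by a constant, and multiplication by the weight
      -- makes that constant an L² bound; inside, the weight vanishes.
      have h2 : ‖exteriorWeightOp hs R (T v)‖ ≤ C / h * (∫ x, ‖v x‖) * κ := by
        refine Lp.norm_le_mul_norm_of_ae_le_mul ?_
        filter_upwards [exteriorWeightOp_coeFn hs R (T v), S.isRep.ae_eq,
          (exteriorWeight_memLp_two hs R).coeFn_toLp] with x h3 h4 h5
        rw [h3, h5, norm_mul, mul_comm, ← h4]
        by_cases hx : R < |x|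
        · exact mul_le_mul_of_nonneg_right (hr x hx) (norm_nonneg _)
        · rw [exteriorWeight, indicator_of_notMem (by simpa using hx)]
          simp
      calc ‖exteriorWeightOp hs R (T v)‖ ≤ C / h * (∫ x, ‖v x‖) * κ := h2
        _ ≤ C / h * (κ * ‖g‖) * κ := by gcongr
        _ = _ := by ring
    refine hnorm.trans (div_le_div_of_nonneg_right ?_ hh0.le)
    have : 0 ≤ W * (M * h₀ / (m * ε₁)) * W := by positivity
    linarith
  · have h1 := hT.norm_le (by rwa [hz]) hm (hβ' h hh) (hβ h hh)
    rw [hz] at h1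
    -- From |ε| > ε₁ and h ≤ h₀ follows 1/|ε| ≤ h₀/(ε₁h), so the elementary bound is already of
    -- order 1/h.
    have h2 : M / (m * |ε|) ≤ M * h₀ / (m * ε₁) / h := by
      rw [div_div, div_le_div_iff₀ (by positivity) (by positivity)]
      have h3 : ε₁ * h ≤ |ε| * h₀ := mul_le_mul hlarge.le hh.2 hh0.le (abs_nonneg _)
      calc M * (m * ε₁ * h) = M * m * (ε₁ * h) := by ring
        _ ≤ M * m * (|ε| * h₀) := mul_le_mul_of_nonneg_left h3 (by positivity)
        _ = _ := by ring
    have h4 : ‖exteriorWeightOp hs R ∘L T ∘L exteriorWeightOp hs R‖ ≤ W * (‖T‖ * W) :=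
      (ContinuousLinearMap.opNorm_comp_le _ _).trans
        (mul_le_mul_of_nonneg_left (ContinuousLinearMap.opNorm_comp_le _ _) (norm_nonneg _))
    calc _ ≤ W * (‖T‖ * W) := h4
      _ ≤ W * (M * h₀ / (m * ε₁) / h * W) := by
        have := h1.trans h2
        gcongr
      _ = W * (M * h₀ / (m * ε₁)) * W / h := by ring
      _ ≤ _ := by
        refine div_le_div_of_nonneg_right ?_ hh0.le
        have : 0 ≤ C * κ ^ 2 := by positivity
        linarith
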